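/- **Setting.** Let $n\ge 0$, $T>0$, $f:\mathbb{R}^{n+1}\to\mathbb{R}$, $\phi:\mathbb{R}\to\mathbb{R}$, and let $\varphi(t,x)=e^{-x^2/(2t)}/\sqrt{2\pi t}$, $t>0$. For $u:[0,T]\times\mathbb{R}\to\mathbb{R}$ and $h:\mathbb{R}^{n+1}\to\mathbb{R}$ smooth in $x$, resp. smooth, put $h^*(u)(t,x):=h(u(t,x),\partial_xu(t,x),\dots,\partial_x^nu(t,x))$. **Assumption (A).** (i) $f\in C^\infty(\mathbb{R}^{n+1})$ and $\phi\in C^\infty(\mathbb{R})$. (ii) $u$ is the unique function in $C^{1,\infty}([0,T]\times\mathbb{R})$ that satisfies both $$\partial_tu+\tfrac12\partial_x^2u+f(u,\partial_xu,\dots,\partial_x^nu)=0,\qquad u(T,\cdot)=\phi,$$ and the Duhamel formula $$u(t,x)=\int_{\mathbb{R}}\varphi(T-t,y-x)\phi(y)\,dy+\int_t^T\!\int_{\mathbb{R}}\varphi(s-t,y-x)f^*(u)(s,y)\,dy\,ds,\quad (t,x)\in[0,T)\times\mathbb{R},$$ with absolutely convergent integrals. (iii) For all $\eta>0$ and all integers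 $p\ge1$: $\phi^{(k)}\in L^p(\mathbb{R},\varphi(\eta,x)dx)$ and $\partial_x^ku\in L^p([0,T]\times\mathbb{R},\varphi(\eta,x)dx\,ds)$ for all $k\ge0$, and $(\partial^\lambda f)^*(u)\in L^p([0,T]\times\mathbb{R},\varphi(\eta,x)dx\,ds)$ for all $\lambda\in\mathbb{N}^{n+1}$, where $\partial^\lambda=\partial_{z_0}^{\lambda_0}\cdots\partial_{z_n}^{\lambda_n}$. **Codes.** The set $\mathfrak{C}$ of codes consists of the symbols $\mathrm{Id}$, $(a\,\partial^\lambda f)^*$ ($a\in\mathbb{R}\setminus\{0\}$, $\lambda\in\mathbb{N}^{n+1}$) and $\partial_x^k$ ($k\ge1$), each of which denotes the corresponding operator $u\mapsto c(u)$. **Mechanism.** For $k\ge1$ let $\mathcal{F}_k$ be the family, indexed by all $s\ge1$, $1\le l_1<\dots<l_s$ and non-zero $\mathbf{k}_1,\dots,\mathbf{k}_s\in\mathbb{N}^{n+1}$ with $\sum_j|\mathbf{k}_j|l_j=k$, of the tuples $$\Big(\Big(\tfrac{k!}{\prod_{j,q}k_j^q!\,(l_j!)^{k_j^q}}\,\partial^\lambda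 f\Big)^*,\ \big(\partial_x^{q+l_j}\big)_{1\le r\le k_j^q,\ 1\le j\le s,\ 0\le q\le n}\Big),\qquad \lambda=\mathbf{k}_1+\dots+\mathbf{k}_s .$$ The mechanism associates to each code a finite family of tuples of codes: $\mathcal{M}(\mathrm{Id})=\{(f^*)\}$; $\mathcal{M}(\partial_x^k)=\mathcal{F}_k$; and for $g=a\,\partial^\mu f$, $\mathcal{M}(g^*)$ consists of $(f^*,(\partial_{z_0}g)^*)$, of $((\partial_{z_k}g)^*,Z)$ for $1\le k\le n$ and $Z\in\mathcal{F}_k$, and of $(-\frac12(\partial_{z_l}\partial_{z_j}g)^*,\partial_x^{j+1},\partial_x^{l+1})$ for $0\le j,l\le n$. Families are counted with multiplicity. **Random coding tree.** Let $\rho>0$ be a probability density on $\mathbb{R}_+$ and $\bar F(t)=\int_t^\infty\rho(s)\,ds$. The tree $\mathcal{T}_{t,x,c}$ starts at time $t\in[0,T]$ with one particle at $x\in\mathbb{R}$ that bears the code $c$. Each particle moves along an independent standard Brownian motion and has an independent lifetime with density $\rho$. If a particle with code $c'$ dies before $T$, a tuple $(c_1,\dots,c_m)$ is drawn independently and uniformly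 in the family $\mathcal{M}(c')$ (each term having probability $q_{c'}=1/|\mathcal{M}(c')|$), and the particle is replaced at its place of death by $m$ particles bearing the codes $c_1,\dots,c_m$, which evolve in the same way; otherwise it is stopped at time $T$. Let $\mathcal{K}^\circ$ be the set of particles that die before $T$ and $\mathcal{K}^\partial$ the set of the other ones. For a particle $k$, let $c_k$ be its code, $\tau_k$ its lifetime, $T_{k-}$ its time of birth and $X_T^k$ its position at time $T$ (if $k\in\mathcal{K}^\partial$), and set $$\mathcal{H}(\mathcal{T}_{t,x,c})=\prod_{k\in\mathcal{K}^\circ}\frac1{q_{c_k}\,\rho(\tau_k)}\ \prod_{k\in\mathcal{K}^\partial}\frac{c_k(u)(T,X^k_T)}{\bar F(T-T_{k-})}.$$ **Theorem 1.** Assume (A) and that $\mathbb{E}[|\mathcal{H}(\mathcal{T}_{t,x,c})|]<\infty$ for all $(t,x)\in[0,T]\times\mathbb{R}$ and $c\in\mathfrak{C}$. Then the functions $u_c(t,x):=\mathbb{E}[\mathcal{H}(\mathcal{T}_{t,x,c})]$, $c\in\mathfrak{C}$, solve the system $$u_c(t,x)=\int_{\mathbb{R}}\varphi(T-t,y-x)\,c(u)(T,y)\,dy+\sum_{Z\in\mathcal{M}(c)}\int_t^T\!\int_{\mathbb{R}}\varphi(s-t,y-x)\prod_{z\in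 Z}u_z(s,y)\,dy\,ds,\qquad (t,x)\in[0,T)\times\mathbb{R},$$ $u_c(T,x)=c(u)(T,x)$, $x\in\mathbb{R}$, $c\in\mathfrak{C}$, with absolutely convergent integrals. Moreover, let $\mathcal{U}$ be any class of families of functions indexed by $\mathfrak{C}$ (for instance the class of all families) that contains $(u_c)_{c\in\mathfrak{C}}$ and $(c(u))_{c\in\mathfrak{C}}$. If the system has at most one solution in $\mathcal{U}$, then $$c(u)(t,x)=u_c(t,x)=\mathbb{E}[\mathcal{H}(\mathcal{T}_{t,x,c})],\qquad (t,x)\in[0,T]\times\mathbb{R},\ c\in\mathfrak{C};$$ in particular $u(t,x)=\mathbb{E}[\mathcal{H}(\mathcal{T}_{t,x,\mathrm{Id}})]$ for all $(t,x)\in[0,T]\times\mathbb{R}$. -/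

import Mathlib

open MeasureTheory ProbabilityTheory Set
open scoped NNReal ENNReal

noncomputable section

namespace CodingTree

/-- The Gaussian kernel `φ(t,x) = exp (-x²/(2t)) / √(2πt)` of variance `t > 0`. -/
def heatKernel (t x : ℝ) : ℝ := Real.exp (-x ^ 2 / (2 * t)) / Real.sqrt (2 * Real.pi * t)

/-- The measure `φ(η,x) dx` on `ℝ`. -/
def gaussWeight (η : ℝ) : Measure ℝ :=
  volume.withDensity fun x => ENNReal.ofReal (heatKernel η x)

/-- The measure `φ(η,x) dx ds` on `[0,T] × ℝ`. -/
def spaceTimeWeight (T η : ℝ) : Measure (ℝ × ℝ) :=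
  (volume.restrict (Icc 0 T)).prod (gaussWeight η)

/-- The first order partial derivative `∂_{z_i} h`. -/
def partialZ {n : ℕ} (i : Fin (n + 1)) (h : (Fin (n + 1) → ℝ) → ℝ) : (Fin (n + 1) → ℝ) → ℝ :=
  fun z => fderiv ℝ h z (Pi.single i 1)

/-- The mixed partial derivative `∂_{z_0}^{α 0} ⋯ ∂_{z_n}^{α n} h`. -/
def mixedPartial {n : ℕ} (α : Fin (n + 1) → ℕ) (h : (Fin (n + 1) → ℝ) → ℝ) :
    (Fin (n + 1) → ℝ) → ℝ :=
  (List.finRange (n + 1)).foldr (fun i g => (partialZ i)^[α i] g) h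

/-- The point `(ψ(t,x), ∂_x ψ(t,x), …, ∂_x^n ψ(t,x))` of `ℝ^{n+1}`. -/
def jet (n : ℕ) (ψ : ℝ → ℝ → ℝ) (t x : ℝ) : Fin (n + 1) → ℝ :=
  fun i => iteratedDeriv i (ψ t) x

/-! ### The partial differential equation -/

/-- `u` is of class `C^{1,∞}` on `[0,T] × ℝ`: differentiable in time and infinitely differentiable
in space, with continuous partial derivatives. -/
structure IsC1Infty (T : ℝ) (u : ℝ → ℝ → ℝ) : Prop where
  smooth_space : ∀ t ∈ Icc 0 T, ContDiff ℝ (⊤ : ℕ∞) (u t)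
  continuous_space : ∀ k : ℕ,
    ContinuousOn (fun p : ℝ × ℝ => iteratedDeriv k (u p.1) p.2) (Icc 0 T ×ˢ univ)
  differentiable_time : ∀ x, DifferentiableOn ℝ (fun t => u t x) (Icc 0 T)
  continuous_time :
    ContinuousOn (fun p : ℝ × ℝ => derivWithin (fun s => u s p.2) (Icc 0 T) p.1) (Icc 0 T ×ˢ univ)

/-- `u` is a `C^{1,∞}` solution on `[0,T] × ℝ` of
`∂_t u + ½ ∂_x² u + f(u, ∂_x u, …, ∂_x^n u) = 0`, `u(T,·) = φ`, which satisfies the Duhamel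
formula (with absolutely convergent integrals). -/
structure IsSmoothSolution {n : ℕ} (T : ℝ) (f : (Fin (n + 1) → ℝ) → ℝ) (φ : ℝ → ℝ)
    (u : ℝ → ℝ → ℝ) : Prop where
  regular : IsC1Infty T u
  pde : ∀ t ∈ Icc 0 T, ∀ x,
    derivWithin (fun s => u s x) (Icc 0 T) t + 1 / 2 * iteratedDeriv 2 (u t) x
      + f (jet n u t x) = 0
  terminal : ∀ x, u T x = φ x
  integrable_terminal : ∀ t ∈ Ico 0 T, ∀ x,
    Integrable fun y => heatKernel (T - t) (y - x) * φ y
  integrable_source : ∀ t ∈ Ico 0 T, ∀ x,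
    Integrable (fun p : ℝ × ℝ => heatKernel (p.1 - t) (p.2 - x) * f (jet n u p.1 p.2))
      ((volume.restrict (Ioc t T)).prod volume)
  duhamel : ∀ t ∈ Ico 0 T, ∀ x,
    u t x = (∫ y, heatKernel (T - t) (y - x) * φ y)
      + ∫ s in t..T, ∫ y, heatKernel (s - t) (y - x) * f (jet n u s y)

/-- The standing assumption on the coefficients and on the solution of the equation. -/
structure AssumptionA {n : ℕ} (T : ℝ) (f : (Fin (n + 1) → ℝ) → ℝ) (φ : ℝ → ℝ)
    (u : ℝ → ℝ → ℝ) : Prop where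
  smooth_f : ContDiff ℝ (⊤ : ℕ∞) f
  smooth_φ : ContDiff ℝ (⊤ : ℕ∞) φ
  solution : IsSmoothSolution T f φ u
  unique : ∀ v, IsSmoothSolution T f φ v → ∀ t ∈ Icc 0 T, ∀ x, v t x = u t x
  memLp_φ : ∀ k p : ℕ, 1 ≤ p → ∀ η : ℝ, 0 < η →
    MemLp (iteratedDeriv k φ) p (gaussWeight η)
  memLp_u : ∀ k p : ℕ, 1 ≤ p → ∀ η : ℝ, 0 < η →
    MemLp (fun z : ℝ × ℝ => iteratedDeriv k (u z.1) z.2) p (spaceTimeWeight T η)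
  memLp_f : ∀ (α : Fin (n + 1) → ℕ) (p : ℕ), 1 ≤ p → ∀ η : ℝ, 0 < η →
    MemLp (fun z : ℝ × ℝ => mixedPartial α f (jet n u z.1 z.2)) p (spaceTimeWeight T η)

/-! ### Codes and mechanism -/

/-- The set of codes. They are kept as symbols, because the mechanism depends on how an operator
is written; the operator denoted by a code is `Code.eval`. -/
inductive Code (n : ℕ) : Type
  /-- the identity `Id` -/
  | id : Code n
  /-- `(a ∂_{z_0}^{α 0} ⋯ ∂_{z_n}^{α n} f)^*` with `a ≠ 0` -/
  | star (a : ℝˣ) (α : Fin (n + 1) → ℕ) : Code n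
  /-- `∂_x^k` with `k ≥ 1` -/
  | dx (k : ℕ) (hk : 1 ≤ k) : Code n

/-- The operator on functions of `(t,x)` denoted by a code; `c.eval f u` is `c(u)`. -/
def Code.eval {n : ℕ} (f : (Fin (n + 1) → ℝ) → ℝ) : Code n → (ℝ → ℝ → ℝ) → ℝ → ℝ → ℝ
  | .id, ψ => ψ
  | .star a α, ψ => fun t x => (a : ℝ) * mixedPartial α f (jet n ψ t x)
  | .dx k _, ψ => fun t x => iteratedDeriv k (ψ t) x

/-- Index set of the terms of the Faà di Bruno formula for
`∂_x^k (f(u, ∂_x u, …, ∂_x^n u))`. The number `m i q` is the multiplicity of the factor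
`∂_x^{q+l} u`, with `l = i + 1 ∈ {1, …, k}`; the integers `l_1 < ⋯ < l_s` of the formula are those
`l` whose row is not zero, and the vectors `𝐤_1, …, 𝐤_s` are these rows. -/
def FdBIdx (n k : ℕ) : Type :=
  {m : Fin k → Fin (n + 1) → Fin (k + 1) //
    ∑ i : Fin k, (∑ q, (m i q : ℕ)) * ((i : ℕ) + 1) = k}

instance (n k : ℕ) : Fintype (FdBIdx n k) :=
  inferInstanceAs (Fintype {m : Fin k → Fin (n + 1) → Fin (k + 1) //
    ∑ i : Fin k, (∑ q, (m i q : ℕ)) * ((i : ℕ) + 1) = k})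

/-- The order of differentiation `α_q = ∑_j k_j^q` of `f` with respect to `z_q` in a term. -/
def FdBIdx.order {n k : ℕ} (m : FdBIdx n k) (q : Fin (n + 1)) : ℕ := ∑ i, (m.1 i q : ℕ)

/-- The coefficient `k! / ∏_{j,q} (k_j^q! (l_j!)^{k_j^q})` of a term. -/
def FdBIdx.coeff {n k : ℕ} (m : FdBIdx n k) : ℝˣ :=
  Units.mk0 ((k.factorial : ℝ) /
      ∏ i : Fin k, ∏ q, (((m.1 i q : ℕ).factorial : ℝ) * (((i : ℕ) + 1).factorial : ℝ) ^ (m.1 i q : ℕ)))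
    (div_ne_zero (by positivity) (Finset.prod_ne_zero_iff.2 fun _ _ =>
      Finset.prod_ne_zero_iff.2 fun _ _ => by positivity))

/-- The code tuple of a term of the Faà di Bruno formula: the derivative of `f`, which carries the
coefficient, followed by `k_j^q` copies of each `∂_x^{q+l_j}`. -/
def FdBIdx.tuple {n k : ℕ} (m : FdBIdx n k) : List (Code n) :=
  Code.star m.coeff m.order ::
    (List.finRange k).flatMap fun i => (List.finRange (n + 1)).flatMap fun q =>
      List.replicate (m.1 i q) (Code.dx ((q : ℕ) + ((i : ℕ) + 1)) (by omega))

/-- The finite index set of the family of code tuples `M(c)`. -/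
def MechIdx {n : ℕ} : Code n → Type
  | .id => Unit
  | .star _ _ => Unit ⊕ (Σ k : Fin n, FdBIdx n ((k : ℕ) + 1)) ⊕ (Fin (n + 1) × Fin (n + 1))
  | .dx k _ => FdBIdx n k

instance {n : ℕ} : (c : Code n) → Fintype (MechIdx c)
  | .id => inferInstanceAs (Fintype Unit)
  | .star _ _ => inferInstanceAs
      (Fintype (Unit ⊕ (Σ k : Fin n, FdBIdx n ((k : ℕ) + 1)) ⊕ (Fin (n + 1) × Fin (n + 1))))
  | .dx k _ => inferInstanceAs (Fintype (FdBIdx n k))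

instance {n : ℕ} (c : Code n) : MeasurableSpace (MechIdx c) := ⊤

/-- The code `f^*`. -/
def fStar (n : ℕ) : Code n := .star 1 0

/-- The mechanism: the family `M(c)` of code tuples, as a finite family indexed by `MechIdx c`.
* `M(Id)` consists of `(f^*)`;
* for `g = a ∂^α f`, `M(g^*)` consists of `(f^*, (∂_{z_0} g)^*)`, of the Faà di Bruno tuples of
  `∂_x^k f(u, …, ∂_x^n u)` preceded by `(∂_{z_k} g)^*`, `1 ≤ k ≤ n`, and of
  `(-½ (∂_{z_l} ∂_{z_j} g)^*, ∂_x^{j+1}, ∂_x^{l+1})`, `0 ≤ j, l ≤ n`;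
* `M(∂_x^k)` consists of the Faà di Bruno tuples of `∂_x^k f(u, …, ∂_x^n u)`. -/
def mech {n : ℕ} : (c : Code n) → MechIdx c → List (Code n)
  | .id, _ => [fStar n]
  | .star a α, .inl _ => [fStar n, .star a (α + Pi.single 0 1)]
  | .star a α, .inr (.inl ⟨k, m⟩) => .star a (α + Pi.single k.succ 1) :: m.tuple
  | .star a α, .inr (.inr (j, l)) =>
      [.star (-(Units.mk0 (1 / 2 : ℝ) (by norm_num)) * a) (α + Pi.single j 1 + Pi.single l 1),
        .dx ((j : ℕ) + 1) (by omega), .dx ((l : ℕ) + 1) (by omega)]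
  | .dx _ _, m => FdBIdx.tuple m

/-! ### The system of integral equations -/

/-- `(v_c)_c` solves, on `[0,T] × ℝ`, the system
`v_c(t,x) = ∫ φ(T-t,y-x) c(u)(T,y) dy + ∑_{Z ∈ M(c)} ∫_t^T ∫ φ(s-t,y-x) ∏_{z ∈ Z} v_z(s,y) dy ds`
with `v_c(T,·) = c(u)(T,·)`, all integrals being absolutely convergent. -/
structure IsSystemSolution {n : ℕ} (T : ℝ) (f : (Fin (n + 1) → ℝ) → ℝ) (u : ℝ → ℝ → ℝ)
    (v : Code n → ℝ → ℝ → ℝ) : Prop where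
  terminal : ∀ c x, v c T x = c.eval f u T x
  integrable_terminal : ∀ c : Code n, ∀ t ∈ Ico 0 T, ∀ x,
    Integrable fun y => heatKernel (T - t) (y - x) * c.eval f u T y
  integrable_source : ∀ c, ∀ t ∈ Ico 0 T, ∀ x, ∀ Z : MechIdx c,
    Integrable (fun p : ℝ × ℝ => heatKernel (p.1 - t) (p.2 - x)
        * ((mech c Z).map fun z => v z p.1 p.2).prod)
      ((volume.restrict (Ioc t T)).prod volume)
  equation : ∀ c, ∀ t ∈ Ico 0 T, ∀ x,
    v c t x = (∫ y, heatKernel (T - t) (y - x) * c.eval f u T y)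
      + ∑ Z : MechIdx c, ∫ s in t..T, ∫ y, heatKernel (s - t) (y - x)
          * ((mech c Z).map fun z => v z s y).prod

/-! ### The random coding tree -/

/-- Labels of particles: the root is `[]` and the `i`-th child of `k` is `i :: k`, `i ≥ 0`. -/
abbrev Label : Type := List ℕ

/-- The law of nonnegative lifetimes with density `ρ`. -/
def lifetimeLaw (ρ : ℝ → ℝ) : Measure ℝ :=
  (volume.restrict (Ioi 0)).withDensity fun s => ENNReal.ofReal (ρ s)

/-- The tail distribution function `F̄(t) = ∫_t^∞ ρ(s) ds`. -/
def tail (ρ : ℝ → ℝ) (t : ℝ) : ℝ := ∫ s in Ioi t, ρ s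

/-- The random inputs of the tree: for each label, a lifetime with density `ρ`, for every code `c`
a uniform choice in `M(c)`, and a standard Brownian motion, all of them mutually independent. -/
structure IsTreeNoise {n : ℕ} {Ω : Type*} [MeasurableSpace Ω] (P : Measure Ω) (ρ : ℝ → ℝ)
    (τ : Label → Ω → ℝ) (I : (c : Code n) → Label → Ω → MechIdx c)
    (W : Label → ℝ≥0 → Ω → ℝ) : Prop where
  measurable_τ : ∀ k, Measurable (τ k)
  measurable_I : ∀ c k, Measurable (I c k)
  measurable_W : ∀ k s, Measurable (W k s)
  law_τ : ∀ k, P.map (τ k) = lifetimeLaw ρ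
  law_I : ∀ c k b, P {ω | I c k ω = b} = (Fintype.card (MechIdx c) : ℝ≥0∞)⁻¹
  brownian : ∀ k, IsBrownianReal (W k) P
  indep : iIndep
    (Sum.elim (fun k : Label => MeasurableSpace.comap (τ k) inferInstance)
      (Sum.elim
        (fun ck : Code n × Label => MeasurableSpace.comap (I ck.1 ck.2) inferInstance)
        (fun k : Label => MeasurableSpace.comap (fun ω s => W k s ω) inferInstance))) P

/-- A particle: its code, its time of birth and its position at birth. -/
structure Particle (n : ℕ) where
  code : Code n
  birth : ℝ
  pos : ℝ

open Classical in
/-- The particle with a given label in the coding tree started at time `t` from the position `x`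
with the code `c`, or `none` if there is no such particle. The arguments `τ`, `I`, `W` are
realizations of the lifetimes, of the choices and of the Brownian motions. A particle that dies
before `T` branches into as many particles as its tuple of codes has entries. -/
def particle {n : ℕ} (T : ℝ) (τ : Label → ℝ) (I : (c : Code n) → Label → MechIdx c)
    (W : Label → ℝ≥0 → ℝ) (t x : ℝ) (c : Code n) : Label → Option (Particle n)
  | [] => some ⟨c, t, x⟩
  | i :: k => (particle T τ I W t x c k).bind fun p =>
      if p.birth + τ k < T then
        ((mech p.code (I p.code k))[i]?).map fun z =>
          ⟨z, p.birth + τ k, p.pos + W k (τ k).toNNReal⟩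
      else none

open Classical in
/-- The factor contributed by a label `k`:
`1 / (q_{c_k}(I_{c_k}) ρ(τ_k))` if it is that of a particle dying before `T`, where `q_c` is the
uniform distribution on `M(c)`; `c_k(u)(T, X_T^k) / F̄(T - T_{k-})` if it is that of a particle
alive at `T`; and `1` if it is not the label of a particle. -/
def factor {n : ℕ} (T : ℝ) (f : (Fin (n + 1) → ℝ) → ℝ) (u : ℝ → ℝ → ℝ) (ρ : ℝ → ℝ)
    (τ : Label → ℝ) (I : (c : Code n) → Label → MechIdx c)
    (W : Label → ℝ≥0 → ℝ) (t x : ℝ) (c : Code n) (k : Label) : ℝ :=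
  match particle T τ I W t x c k with
  | none => 1
  | some p =>
      if p.birth + τ k < T then 1 / ((Fintype.card (MechIdx p.code) : ℝ)⁻¹ * ρ (τ k))
      else p.code.eval f u T (p.pos + W k (T - p.birth).toNNReal) / tail ρ (T - p.birth)

/-- The multiplicative functional `H(T_{t,x,c})` of the coding tree (almost surely, the tree is
finite and this is a product of finitely many factors). -/
def treeFunctional {n : ℕ} (T : ℝ) (f : (Fin (n + 1) → ℝ) → ℝ) (u : ℝ → ℝ → ℝ) (ρ : ℝ → ℝ)
    (τ : Label → ℝ) (I : (c : Code n) → Label → MechIdx c)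
    (W : Label → ℝ≥0 → ℝ) (t x : ℝ) (c : Code n) : ℝ :=
  ∏ᶠ k : Label, factor T f u ρ τ I W t x c k

/-- The random variable `H(T_{t,x,c})`. -/
def randomFunctional {n : ℕ} {Ω : Type*} (T : ℝ) (f : (Fin (n + 1) → ℝ) → ℝ) (u : ℝ → ℝ → ℝ)
    (ρ : ℝ → ℝ) (τ : Label → Ω → ℝ) (I : (c : Code n) → Label → Ω → MechIdx c)
    (W : Label → ℝ≥0 → Ω → ℝ) (t x : ℝ) (c : Code n) (ω : Ω) : ℝ :=
  treeFunctional T f u ρ (fun k => τ k ω) (fun c k => I c k ω) (fun k s => W k s ω) t x c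

end CodingTree

end

open CodingTree

/-!
The theorem has two halves: the expectations `u_c` solve the system of integral equations, and so do
the functions `c(u)`. The assumed uniqueness of solutions in `𝒰` then identifies them.

**The expectations solve the system.** The random inputs attached to the labels are independent and
identically distributed, so the whole noise has the law `infinitePi` of a single law `labelLaw` on
the space `LabelNoise` (`IsTreeNoise.map_toNoise`). Under such a product law, the input at the root
and the noises of the subtrees of its children are independent, and each subtree has the law of the
whole tree (`map_split_infinitePi`). Since the labels of a subtree are the lists `k ++ [i]`, the
functional of a tree whose root dies before `T` is the factor of the root times the product of the
functionals of the subtrees (`noiseFunctional_eq`). This needs the tree to be almost surely finite,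
because `finprod` is `1` on an infinite multiplicative support: giving the code `∂_x^k` the size `k`
and the others the size `1`, the total size of a tuple of `M(c)` is at most a constant times that
of `c`, and for large `a` the factor `E[exp (-a τ)]` gained at each death makes the mean number of
particles of generation `g` decay geometrically (`ae_finite_particleLabels`). The factor
`1 / (q_c ρ(τ))` turns the law of the branching point of the root into `φ(s-t,y-x) ds dy`
(`map_branchPoint`), and `1 / F̄(T-t)` turns that of its position at `T`, on survival, into
`φ(T-t,y-x) dy` (`map_survival`). Fubini's theorem gives the system (`IsTreeNoise.branching`).
Brownian paths are evaluated through `pathEval`, which is jointly measurable on the space of all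
paths and agrees with evaluation on the continuous ones.

**The functions `c(u)` solve the system.** The mechanism is made so that
`∂_t c(u) + ½ ∂_x² c(u) + ∑_{Z ∈ M(c)} ∏_{z ∈ Z} z(u) = 0` (`hasDerivWithinAt_eval`). This combines
the chain rule, the Faà di Bruno formula for `∂_x^k (f(u, …, ∂_x^n u))` (`iteratedDeriv_comp_jet`)
and the fact that `∂_x^k u` satisfies the equation differentiated `k` times
(`hasDerivWithinAt_iteratedDeriv`). The functions `c(u)`, their first space derivatives and the
source terms belong to an algebra of functions with finite moments for all Gaussian weights
(`IsModerate`), hence are integrable against the heat kernel (`integrable_kernelMeasure_of_memLp`).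
The Duhamel formula holds for functions of compact support in space
(`duhamel_of_compactSupport`) and extends to this algebra by truncation
(`duhamel_of_isModerate`). The integrability of the terminal term is inherited from the first half.
-/

noncomputable section

namespace CodingTree

/-! ### Grouping independent σ-algebras -/

/-- σ-algebras generated by disjoint groups of independent σ-algebras are independent. -/
theorem _root_.ProbabilityTheory.iIndep.iSup_fiber {Ω ι κ : Type*} {mΩ : MeasurableSpace Ω}
    {P : Measure Ω} {m : ι → MeasurableSpace Ω} (h_le : ∀ i, m i ≤ mΩ) (h : iIndep m P)
    (g : ι → κ) : iIndep (fun k => ⨆ i ∈ g ⁻¹' {k}, m i) P := by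
  classical
  have := h.isProbabilityMeasure
  rw [iIndep_iff]
  intro S
  induction S using Finset.induction_on with
  | empty => intro s _; simp
  | insert k S hk ih =>
    intro s hs
    rw [Finset.set_biInter_insert, Finset.prod_insert hk,
      ← ih fun i hi => hs i (Finset.mem_insert_of_mem hi)]
    have hind : Indep (⨆ i ∈ g ⁻¹' {k}, m i) (⨆ i ∈ g ⁻¹' (S : Set κ), m i) P :=
      indep_iSup_of_disjoint h_le h (by
        rw [Set.disjoint_left]
        rintro i hi hi'
        simp only [Set.mem_preimage, Set.mem_singleton_iff] at hi hi'
        exact hk (hi ▸ hi'))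
    rw [Indep_iff] at hind
    refine hind _ _ (hs k (Finset.mem_insert_self k S)) ?_
    refine Finset.measurableSet_biInter _ fun i hi => ?_
    refine (?_ : (⨆ j ∈ g ⁻¹' {i}, m j) ≤ ⨆ j ∈ g ⁻¹' (S : Set κ), m j) _
      (hs i (Finset.mem_insert_of_mem hi))
    refine biSup_mono fun j hj => ?_
    simp only [Set.mem_preimage, Set.mem_singleton_iff] at hj ⊢
    rw [hj]; exact hi

theorem _root_.MeasurableSpace.comap_prodMk_le {Ω α β : Type*} {m' : MeasurableSpace Ω}
    [mα : MeasurableSpace α] [mβ : MeasurableSpace β] {f : Ω → α} {g : Ω → β}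
    (hf : MeasurableSpace.comap f mα ≤ m') (hg : MeasurableSpace.comap g mβ ≤ m') :
    MeasurableSpace.comap (fun ω => (f ω, g ω)) inferInstance ≤ m' :=
  measurable_iff_comap_le.1 <|
    (measurable_iff_comap_le.2 hf).prodMk (measurable_iff_comap_le.2 hg)

theorem _root_.MeasurableSpace.comap_pi_le {Ω ι : Type*} {α : ι → Type*} {m' : MeasurableSpace Ω}
    [mα : ∀ i, MeasurableSpace (α i)] {f : Ω → (i : ι) → α i}
    (hf : ∀ i, MeasurableSpace.comap (fun ω => f ω i) (mα i) ≤ m') :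
    MeasurableSpace.comap f inferInstance ≤ m' :=
  measurable_iff_comap_le.1 <|
    measurable_pi_iff.2 fun i => measurable_iff_comap_le.2 (hf i)

/-! ### The noise attached to one label -/

/-- The random inputs attached to one label: a lifetime, a choice in `M(c)` for every code `c`, and
a path. -/
abbrev LabelNoise (n : ℕ) : Type := ℝ × ((c : Code n) → MechIdx c) × (ℝ≥0 → ℝ)

/-- Realizations of all the random inputs of a tree. -/
abbrev Noise (n : ℕ) : Type := Label → LabelNoise n

/-- The random inputs as a random variable with values in `Noise n`. -/
def toNoise {n : ℕ} {Ω : Type*} (τ : Label → Ω → ℝ) (I : (c : Code n) → Label → Ω → MechIdx c)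
    (W : Label → ℝ≥0 → Ω → ℝ) (ω : Ω) : Noise n :=
  fun k => (τ k ω, fun c => I c k ω, fun s => W k s ω)

/-- The noise of the subtree that starts from the `i`-th child of the root. -/
def subNoise {n : ℕ} (θ : Noise n) (i : ℕ) : Noise n := fun k => θ (k ++ [i])

namespace IsTreeNoise

variable {n : ℕ} {Ω : Type*} [MeasurableSpace Ω] {P : Measure Ω}
  {ρ : ℝ → ℝ} {τ : Label → Ω → ℝ} {I : (c : Code n) → Label → Ω → MechIdx c}
  {W : Label → ℝ≥0 → Ω → ℝ}

theorem measurable_path (h : IsTreeNoise P ρ τ I W) (k : Label) :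
    Measurable fun ω s => W k s ω := measurable_pi_lambda _ fun s => h.measurable_W k s

theorem measurable_choices (h : IsTreeNoise P ρ τ I W) (k : Label) :
    Measurable fun ω c => I c k ω := measurable_pi_lambda _ fun c => h.measurable_I c k

theorem measurable_toNoise (h : IsTreeNoise P ρ τ I W) : Measurable (toNoise τ I W) :=
  measurable_pi_lambda _ fun k =>
    (h.measurable_τ k).prodMk ((h.measurable_choices k).prodMk (h.measurable_path k))

/-- The label to which each of the independent inputs belongs. -/
def inputLabel (n : ℕ) : Label ⊕ ((Code n × Label) ⊕ Label) → Label :=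
  Sum.elim id (Sum.elim Prod.snd id)

theorem sigma_le (h : IsTreeNoise P ρ τ I W) (j) :
    Sum.elim (fun k : Label => MeasurableSpace.comap (τ k) inferInstance)
      (Sum.elim
        (fun ck : Code n × Label => MeasurableSpace.comap (I ck.1 ck.2) inferInstance)
        (fun k : Label => MeasurableSpace.comap (fun ω s => W k s ω) inferInstance)) j
      ≤ (inferInstance : MeasurableSpace Ω) := by
  rcases j with k | ck | k
  · exact (h.measurable_τ k).comap_le
  · exact (h.measurable_I _ _).comap_le
  · exact (h.measurable_path k).comap_le

theorem iIndepFun_label (h : IsTreeNoise P ρ τ I W) :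
    iIndepFun (fun k ω => toNoise τ I W ω k) P := by
  rw [iIndepFun_iff_iIndep]
  refine iIndep_of_iIndep_of_le (h.indep.iSup_fiber h.sigma_le (inputLabel n)) fun k => ?_
  refine MeasurableSpace.comap_prodMk_le ?_ (MeasurableSpace.comap_prodMk_le
    (MeasurableSpace.comap_pi_le fun c => ?_) ?_)
  · exact le_iSup₂_of_le (Sum.inl k) rfl le_rfl
  · exact le_iSup₂_of_le (Sum.inr (Sum.inl (c, k))) rfl le_rfl
  · exact le_iSup₂_of_le (Sum.inr (Sum.inr k)) rfl le_rfl

/-- The uniform distribution on `M(c)`. -/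
def _root_.CodingTree.choiceLaw {n : ℕ} (c : Code n) : Measure (MechIdx c) :=
  (Fintype.card (MechIdx c) : ℝ≥0∞)⁻¹ • Measure.count

instance (c : Code n) : MeasurableSingletonClass (MechIdx c) := ⟨fun _ => trivial⟩

instance (c : Code n) : Countable (MechIdx c) := Finite.to_countable

theorem map_choice (h : IsTreeNoise P ρ τ I W) (c : Code n) (k : Label) :
    P.map (I c k) = choiceLaw c := by
  refine Measure.ext_of_singleton fun b => ?_
  rw [Measure.map_apply (h.measurable_I c k) (measurableSet_singleton b), choiceLaw,
    Measure.smul_apply, Measure.count_singleton, smul_eq_mul, mul_one]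
  exact h.law_I c k b

theorem map_path (h : IsTreeNoise P ρ τ I W) (k l : Label) :
    P.map (fun ω s => W k s ω) = P.map (fun ω s => W l s ω) := by
  have key (k : Label) : IsProjectiveLimit (P.map (fun ω s => W k s ω))
      BrownianReal.projectiveFamily := fun J => by
    rw [Measure.map_map (by fun_prop) (h.measurable_path k)]
    exact ((h.brownian k).hasLaw J).map_eq
  have : ∀ J, IsFiniteMeasure (BrownianReal.projectiveFamily J) := fun J => inferInstance
  exact (key k).unique (key l)

end IsTreeNoise

/-- The law of Brownian paths, realized as the law of the path attached to the root. -/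
def pathLaw {Ω : Type*} [MeasurableSpace Ω] (P : Measure Ω) (W : Label → ℝ≥0 → Ω → ℝ) :
    Measure (ℝ≥0 → ℝ) := P.map fun ω s => W [] s ω

/-- The law of the random inputs attached to one label. -/
def labelLaw {n : ℕ} {Ω : Type*} [MeasurableSpace Ω] (P : Measure Ω) (ρ : ℝ → ℝ)
    (W : Label → ℝ≥0 → Ω → ℝ) : Measure (LabelNoise n) :=
  (lifetimeLaw ρ).prod ((Measure.infinitePi fun c => choiceLaw c).prod (pathLaw P W))

namespace IsTreeNoise

variable {n : ℕ} {Ω : Type*} [MeasurableSpace Ω] {P : Measure Ω} [IsProbabilityMeasure P]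
  {ρ : ℝ → ℝ} {τ : Label → Ω → ℝ} {I : (c : Code n) → Label → Ω → MechIdx c}
  {W : Label → ℝ≥0 → Ω → ℝ}

theorem isProbabilityMeasure_lifetimeLaw (h : IsTreeNoise P ρ τ I W) :
    IsProbabilityMeasure (lifetimeLaw ρ) :=
  h.law_τ [] ▸ Measure.isProbabilityMeasure_map (h.measurable_τ []).aemeasurable

theorem isProbabilityMeasure_choiceLaw (h : IsTreeNoise P ρ τ I W) (c : Code n) :
    IsProbabilityMeasure (choiceLaw c) :=
  h.map_choice c [] ▸ Measure.isProbabilityMeasure_map (h.measurable_I c []).aemeasurable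

theorem isProbabilityMeasure_pathLaw (h : IsTreeNoise P ρ τ I W) :
    IsProbabilityMeasure (pathLaw P W) :=
  Measure.isProbabilityMeasure_map (h.measurable_path []).aemeasurable

theorem isProbabilityMeasure_labelLaw (h : IsTreeNoise P ρ τ I W) :
    IsProbabilityMeasure (labelLaw P ρ W : Measure (LabelNoise n)) := by
  have := h.isProbabilityMeasure_lifetimeLaw
  have := h.isProbabilityMeasure_choiceLaw
  have := h.isProbabilityMeasure_pathLaw
  unfold labelLaw
  infer_instance

/-- The law of the inputs at a label: the lifetime, the choices and the path are independent, and
so are the choices for different codes. -/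
theorem map_toNoise_apply (h : IsTreeNoise P ρ τ I W) (k : Label) :
    P.map (fun ω => toNoise τ I W ω k) = labelLaw P ρ W := by
  have := h.isProbabilityMeasure_choiceLaw
  have hchoices : P.map (fun ω c => I c k ω) = Measure.infinitePi fun c => choiceLaw c := by
    have h1 : iIndepFun (fun c => I c k) P := by
      rw [iIndepFun_iff_iIndep]
      exact h.indep.precomp (g := fun c : Code n => Sum.inr (Sum.inl (c, k)))
        fun a b hab => by simpa using hab
    rw [h1.map_fun_eq_infinitePi_map fun c => h.measurable_I c k]
    congr 1
    funext c
    exact h.map_choice c k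
  have h2 : IndepFun (fun ω c => I c k ω) (fun ω s => W k s ω) P := by
    have := indep_iSup_of_disjoint h.sigma_le h.indep
      (S := range fun c : Code n => Sum.inr (Sum.inl (c, k))) (T := {Sum.inr (Sum.inr k)})
      (by simp)
    rw [IndepFun_iff_Indep]
    refine indep_of_indep_of_le this (MeasurableSpace.comap_pi_le fun c => ?_) ?_
    · exact le_iSup₂_of_le (Sum.inr (Sum.inl (c, k))) ⟨c, rfl⟩ le_rfl
    · exact le_iSup₂_of_le (Sum.inr (Sum.inr k)) rfl le_rfl
  have h3 : IndepFun (τ k) (fun ω => ((fun c => I c k ω), fun s => W k s ω)) P := by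
    have := indep_iSup_of_disjoint h.sigma_le h.indep
      (S := {Sum.inl k}) (T := range Sum.inr) (by simp)
    rw [IndepFun_iff_Indep]
    refine indep_of_indep_of_le this ?_ (MeasurableSpace.comap_prodMk_le
      (MeasurableSpace.comap_pi_le fun c => ?_) ?_)
    · exact le_iSup₂_of_le (Sum.inl k) rfl le_rfl
    · exact le_iSup₂_of_le (Sum.inr (Sum.inl (c, k))) ⟨_, rfl⟩ le_rfl
    · exact le_iSup₂_of_le (Sum.inr (Sum.inr k)) ⟨_, rfl⟩ le_rfl
  have e3 := (indepFun_iff_map_prod_eq_prod_map_map (h.measurable_τ k).aemeasurable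
    ((h.measurable_choices k).prodMk (h.measurable_path k)).aemeasurable).1 h3
  have e2 := (indepFun_iff_map_prod_eq_prod_map_map (h.measurable_choices k).aemeasurable
    (h.measurable_path k).aemeasurable).1 h2
  rw [e2, hchoices, h.law_τ, h.map_path k []] at e3
  exact e3

theorem map_toNoise (h : IsTreeNoise P ρ τ I W) :
    P.map (toNoise τ I W) = Measure.infinitePi fun _ : Label => labelLaw P ρ W := by
  have := h.iIndepFun_label.map_fun_eq_infinitePi_map fun k =>
    (measurable_pi_apply k).comp h.measurable_toNoise
  refine Eq.trans this ?_
  congr 1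
  funext k
  exact h.map_toNoise_apply k

end IsTreeNoise

/-! ### Splitting the noise at the root -/

/-- The coordinate `k` belongs to the root if `k = []` and to the subtree of the `i`-th child of the
root if `k` ends with `i`. -/
def branchOf (k : Label) : Option ℕ := k.getLast?

/-- Under a product measure, the coordinate at the root and the subtrees of its children are
independent, and each subtree has the law of the whole. -/
theorem map_split_infinitePi {E : Type*} [MeasurableSpace E] (ν : Measure E)
    [IsProbabilityMeasure ν] :
    (Measure.infinitePi fun _ : Label => ν).map
      (fun θ => (θ [], fun (i : ℕ) (k : Label) => θ (k ++ [i])))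
      = ν.prod (Measure.infinitePi fun _ : ℕ => Measure.infinitePi fun _ : Label => ν) := by
  set μ := Measure.infinitePi fun _ : Label => ν
  have hco : iIndepFun (fun (k : Label) (θ : Label → E) => θ k) μ :=
    iIndepFun_infinitePi (X := fun _ x => x) fun _ => measurable_id
  have hle (k : Label) : MeasurableSpace.comap (fun θ : Label → E => θ k) inferInstance
      ≤ (inferInstance : MeasurableSpace (Label → E)) := (measurable_pi_apply k).comap_le
  have hind := iIndep.iSup_fiber hle hco.iIndep branchOf
  have hsub : iIndepFun (fun (i : ℕ) (θ : Label → E) (k : Label) => θ (k ++ [i])) μ := by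
    rw [iIndepFun_iff_iIndep]
    refine iIndep_of_iIndep_of_le (hind.precomp (Option.some_injective ℕ)) fun i => ?_
    refine MeasurableSpace.comap_pi_le fun k => ?_
    exact le_iSup₂_of_le (f := fun j (_ : j ∈ branchOf ⁻¹' {some i}) =>
      MeasurableSpace.comap (fun θ : Label → E => θ j) inferInstance) (k ++ [i])
      (by simp [branchOf]) le_rfl
  have hlaw (i : ℕ) : μ.map (fun (θ : Label → E) (k : Label) => θ (k ++ [i])) = μ :=
    Measure.map_infinitePi_infinitePi_of_inj (P := fun _ : Label => ν)
      (f := fun k : Label => k ++ [i]) (List.append_left_injective [i])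
  have hms : Measurable fun (θ : Label → E) (i : ℕ) (k : Label) => θ (k ++ [i]) := by fun_prop
  have h0 : IndepFun (fun θ : Label → E => θ [])
      (fun (θ : Label → E) (i : ℕ) (k : Label) => θ (k ++ [i])) μ := by
    have := indep_iSup_of_disjoint hle hco.iIndep (S := {[]}) (T := {k | k ≠ []}) (by simp)
    rw [IndepFun_iff_Indep]
    refine indep_of_indep_of_le this ?_ (MeasurableSpace.comap_pi_le fun i =>
      MeasurableSpace.comap_pi_le fun k => ?_)
    · exact le_iSup₂_of_le [] rfl le_rfl
    · exact le_iSup₂_of_le (k ++ [i]) (by simp) le_rfl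
  rw [(indepFun_iff_map_prod_eq_prod_map_map (measurable_pi_apply _).aemeasurable
    hms.aemeasurable).1 h0, Measure.infinitePi_map_eval,
    hsub.map_fun_eq_infinitePi_map fun i => by fun_prop]
  simp only [hlaw]

/-! ### Evaluation of paths -/

/-- A version of the evaluation `(w, s) ↦ w s` which is jointly measurable on the space of all
paths, and which is the evaluation for continuous `w`. -/
def pathEval (w : ℝ≥0 → ℝ) (s : ℝ≥0) : ℝ :=
  Filter.limsup (fun m : ℕ => w ((⌊s * m⌋₊ : ℝ≥0) / m)) Filter.atTop

theorem pathEval_eq_of_continuous {w : ℝ≥0 → ℝ} (hw : Continuous w) : pathEval w = w := by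
  funext s
  refine Filter.Tendsto.limsup_eq ((hw.tendsto s).comp ?_)
  rw [← NNReal.tendsto_coe]
  have h := (tendsto_nat_floor_mul_div_atTop (R := ℝ) s.2).comp tendsto_natCast_atTop_atTop
  refine h.congr fun m => ?_
  have : ⌊(s : ℝ) * m⌋₊ = ⌊s * m⌋₊ := by
    refine (Nat.floor_eq_iff (by positivity)).2 ?_
    have h1 := Nat.floor_le (show (0 : ℝ≥0) ≤ s * m from zero_le)
    have h2 := Nat.lt_floor_add_one (s * m)
    exact ⟨by exact_mod_cast h1, by exact_mod_cast h2⟩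
  simp [this]

theorem measurable_pathEval : Measurable fun p : (ℝ≥0 → ℝ) × ℝ≥0 => pathEval p.1 p.2 := by
  refine Measurable.limsup fun m => ?_
  have h1 : Measurable fun q : (ℝ≥0 → ℝ) × ℕ => q.1 ((q.2 : ℝ≥0) / m) :=
    measurable_from_prod_countable_left fun i => measurable_pi_apply ((i : ℝ≥0) / m)
  have h2 : Measurable fun p : (ℝ≥0 → ℝ) × ℝ≥0 => (p.1, ⌊p.2 * m⌋₊) :=
    measurable_fst.prodMk (Nat.measurable_floor.comp (measurable_snd.mul_const _))
  exact h1.comp h2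

theorem Measurable.pathEval {α : Type*} [MeasurableSpace α] {w : α → ℝ≥0 → ℝ} {g : α → ℝ≥0}
    (hw : Measurable w) (hg : Measurable g) :
    Measurable fun a => CodingTree.pathEval (w a) (g a) :=
  Measurable.comp (g := fun p : (ℝ≥0 → ℝ) × ℝ≥0 => CodingTree.pathEval p.1 p.2)
    (f := fun a => (w a, g a)) measurable_pathEval (hw.prodMk hg)

/-! ### Decomposition of labels and of products over labels -/

/-- A label is either that of the root or belongs to the subtree of one of its children. -/
theorem bijective_label :
    Function.Bijective fun o : Option (ℕ × Label) => o.elim ([] : Label) fun p => p.2 ++ [p.1] := by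
  constructor
  · rintro (_ | ⟨i, k⟩) (_ | ⟨j, l⟩) h
    · rfl
    · simp at h
    · simp at h
    · simp only [Option.elim_some] at h
      obtain ⟨h1, h2⟩ := List.append_inj' h rfl
      simp_all
  · intro k
    rcases List.eq_nil_or_concat k with rfl | ⟨l, i, rfl⟩
    · exact ⟨none, rfl⟩
    · exact ⟨some (i, l), by simp⟩

theorem finprod_option {α : Type*} (f : Option α → ℝ) (hf : (Function.mulSupport f).Finite) :
    ∏ᶠ o, f o = f none * ∏ᶠ a, f (some a) := by
  rw [← finprod_mem_univ, ← Set.insert_none_range_some,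
    finprod_mem_insert' _ (by simp) (hf.subset inter_subset_right),
    finprod_mem_range (Option.some_injective α)]

theorem finprod_label (F : Label → ℝ) (hF : (Function.mulSupport F).Finite) :
    ∏ᶠ k, F k = F [] * ∏ᶠ i : ℕ, ∏ᶠ k : Label, F (k ++ [i]) := by
  have hfin : (Function.mulSupport fun o : Option (ℕ × Label) =>
      F (o.elim ([] : Label) fun p => p.2 ++ [p.1])).Finite :=
    hF.preimage (f := fun o : Option (ℕ × Label) => o.elim ([] : Label) fun p => p.2 ++ [p.1])
      bijective_label.1.injOn
  rw [← finprod_comp _ bijective_label, finprod_option _ hfin]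
  simp only [Option.elim_none, Option.elim_some]
  congr 1
  exact finprod_curry (fun p : ℕ × Label => F (p.2 ++ [p.1]))
    (hfin.preimage (f := some) (Option.some_injective _).injOn)

theorem tsum_label (F : Label → ℝ≥0∞) :
    ∑' k, F k = F [] + ∑' i : ℕ, ∑' k : Label, F (k ++ [i]) := by
  rw [← (Equiv.ofBijective _ bijective_label).tsum_eq F, ← ENNReal.tsum_prod,
    ← (Equiv.optionEquivSumPUnit.{0} (ℕ × Label)).symm.tsum_eq,
    ENNReal.summable.tsum_sum ENNReal.summable, add_comm, tsum_fintype, Fintype.sum_unique]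
  rfl

/-! ### The tree as a function of its noise -/

section Tree

variable {n : ℕ} (T : ℝ) (f : (Fin (n + 1) → ℝ) → ℝ) (u : ℝ → ℝ → ℝ) (ρ : ℝ → ℝ)

/-- The particle with label `k` in the tree driven by the noise `θ`. -/
def noiseParticle (θ : Noise n) (t x : ℝ) (c : Code n) (k : Label) : Option (Particle n) :=
  particle T (fun k => (θ k).1) (fun c k => (θ k).2.1 c) (fun k => (θ k).2.2) t x c k

/-- The factor of the label `k` in the tree driven by the noise `θ`. -/
def noiseFactor (θ : Noise n) (t x : ℝ) (c : Code n) (k : Label) : ℝ :=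
  factor T f u ρ (fun k => (θ k).1) (fun c k => (θ k).2.1 c) (fun k => (θ k).2.2) t x c k

/-- The functional of the tree driven by the noise `θ`. -/
def noiseFunctional (θ : Noise n) (t x : ℝ) (c : Code n) : ℝ :=
  ∏ᶠ k : Label, noiseFactor T f u ρ θ t x c k

variable {T f u ρ}

/-- The labels that end with `i` are those of the tree of the `i`-th child of the root, which is
driven by `subNoise θ i`. -/
theorem noiseParticle_append (θ : Noise n) (t x : ℝ) (c : Code n) (i : ℕ) (k : Label) :
    noiseParticle T θ t x c (k ++ [i]) =
      if t + (θ []).1 < T then ((mech c ((θ []).2.1 c))[i]?).bind fun z =>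
        noiseParticle T (subNoise θ i) (t + (θ []).1)
          (x + (θ []).2.2 (θ []).1.toNNReal) z k
      else none := by
  induction k with
  | nil =>
    simp only [noiseParticle, List.nil_append, particle, Option.bind_some]
    split_ifs
    · rw [Option.map_eq_bind]; rfl
    · rfl
  | cons j k ih =>
    have h : noiseParticle T θ t x c (j :: k ++ [i]) =
        (noiseParticle T θ t x c (k ++ [i])).bind fun p =>
          if p.birth + (subNoise θ i k).1 < T then
            ((mech p.code ((subNoise θ i k).2.1 p.code))[j]?).map fun z =>
              ⟨z, p.birth + (subNoise θ i k).1,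
                p.pos + (subNoise θ i k).2.2 (subNoise θ i k).1.toNNReal⟩
          else none := rfl
    rw [h, ih]
    split_ifs
    · rw [Option.bind_assoc]; rfl
    · rfl

/-- The factor at a label, as a function of the particle at that label. -/
theorem noiseFactor_eq (θ : Noise n) (t x : ℝ) (c : Code n) (k : Label) :
    noiseFactor T f u ρ θ t x c k = (noiseParticle T θ t x c k).elim 1 fun p =>
      if p.birth + (θ k).1 < T then
        1 / ((Fintype.card (MechIdx p.code) : ℝ)⁻¹ * ρ (θ k).1)
      else p.code.eval f u T (p.pos + (θ k).2.2 (T - p.birth).toNNReal)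
        / tail ρ (T - p.birth) := by
  unfold noiseFactor factor noiseParticle
  split <;> simp_all

theorem noiseFactor_nil (θ : Noise n) (t x : ℝ) (c : Code n) :
    noiseFactor T f u ρ θ t x c [] =
      if t + (θ []).1 < T then 1 / ((Fintype.card (MechIdx c) : ℝ)⁻¹ * ρ (θ []).1)
      else c.eval f u T (x + (θ []).2.2 (T - t).toNNReal) / tail ρ (T - t) := by
  rw [noiseFactor_eq]; rfl

theorem noiseFactor_append (θ : Noise n) (t x : ℝ) (c : Code n) (i : ℕ) (k : Label) :
    noiseFactor T f u ρ θ t x c (k ++ [i]) =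
      if t + (θ []).1 < T then ((mech c ((θ []).2.1 c))[i]?).elim 1 fun z =>
        noiseFactor T f u ρ (subNoise θ i) (t + (θ []).1)
          (x + (θ []).2.2 (θ []).1.toNNReal) z k
      else 1 := by
  rw [noiseFactor_eq, noiseParticle_append]
  split_ifs
  · cases h : (mech c ((θ []).2.1 c))[i]? with
    | none => rfl
    | some z => simp only [Option.bind_some, Option.elim_some, noiseFactor_eq]; rfl
  · rfl

variable (T) in
/-- The labels of the particles of the tree. -/
def particleLabels (θ : Noise n) (t x : ℝ) (c : Code n) : Set Label :=
  {k | (noiseParticle T θ t x c k).isSome}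

theorem mulSupport_noiseFactor_subset (θ : Noise n) (t x : ℝ) (c : Code n) :
    Function.mulSupport (noiseFactor T f u ρ θ t x c) ⊆ particleLabels T θ t x c := by
  intro k hk
  by_contra h
  simp only [particleLabels, mem_ofPred_eq, Bool.not_eq_true, Option.isSome_eq_false_iff,
    Option.isNone_iff_eq_none] at h
  exact hk (by simp [noiseFactor_eq, h])

/-- The branching recursion for the functional of a finite tree. -/
theorem noiseFunctional_eq {θ : Noise n} {t x : ℝ} {c : Code n}
    (hfin : (particleLabels T θ t x c).Finite) :
    noiseFunctional T f u ρ θ t x c =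
      if t + (θ []).1 < T then 1 / ((Fintype.card (MechIdx c) : ℝ)⁻¹ * ρ (θ []).1) *
        ∏ i : Fin (mech c ((θ []).2.1 c)).length,
          noiseFunctional T f u ρ (subNoise θ i) (t + (θ []).1)
            (x + (θ []).2.2 (θ []).1.toNNReal) (mech c ((θ []).2.1 c))[i]
      else c.eval f u T (x + (θ []).2.2 (T - t).toNNReal) / tail ρ (T - t) := by
  rw [noiseFunctional, finprod_label _ (hfin.subset (mulSupport_noiseFactor_subset θ t x c)),
    noiseFactor_nil]
  simp only [noiseFactor_append]
  split_ifs with h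
  · congr 1
    rw [finprod_eq_prod_of_mulSupport_subset (s := Finset.range (mech c ((θ []).2.1 c)).length),
      Finset.prod_range]
    · refine Finset.prod_congr rfl fun i _ => ?_
      simp [noiseFunctional]
    · intro i hi
      by_contra hlt
      simp only [Finset.coe_range, mem_Iio, not_lt] at hlt
      exact hi (by simp [List.getElem?_eq_none hlt])
  · simp

end Tree

/-! ### Measurability -/

/-- Products over a countable set, with the convention `1` for infinitely many nontrivial factors,
are measurable. -/
theorem measurable_finprod {ι Ω : Type*} [Countable ι] [MeasurableSpace Ω] {F : ι → Ω → ℝ}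
    (hF : ∀ i, Measurable (F i)) : Measurable fun ω => ∏ᶠ i, F i ω := by
  set A : Finset ι → Set Ω := fun s => {ω | (Function.mulSupport fun i => F i ω) = s} with hA
  have hAm (s : Finset ι) : MeasurableSet (A s) := by
    have : A s = ⋂ i, {ω | F i ω ≠ 1 ↔ i ∈ s} := by
      ext ω
      simp only [hA, mem_ofPred_eq, mem_iInter, Set.ext_iff, Function.mem_mulSupport,
        Finset.mem_coe]
    rw [this]
    refine MeasurableSet.iInter fun i => ?_
    have h1 : MeasurableSet {ω | F i ω ≠ 1} := (hF i (measurableSet_singleton 1)).compl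
    exact h1.iff (MeasurableSet.const _)
  intro B hB
  have key : (fun ω => ∏ᶠ i, F i ω) ⁻¹' B =
      (⋃ s, A s ∩ (fun ω => ∏ i ∈ s, F i ω) ⁻¹' B) ∪ ((⋃ s, A s)ᶜ ∩ {_ω | (1 : ℝ) ∈ B}) := by
    ext ω
    by_cases hω : (Function.mulSupport fun i => F i ω).Finite
    · have hs (s : Finset ι) (h : ω ∈ A s) : ∏ᶠ i, F i ω = ∏ i ∈ s, F i ω :=
        finprod_eq_prod_of_mulSupport_subset _ (le_of_eq h)
      have hmem : ω ∈ A hω.toFinset := by simp [hA]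
      simp only [mem_preimage, mem_union, mem_iUnion, mem_inter_iff, mem_compl_iff]
      constructor
      · intro h
        exact Or.inl ⟨hω.toFinset, hmem, hs _ hmem ▸ h⟩
      · rintro (⟨s, h, hB⟩ | ⟨h, _⟩)
        · rwa [hs s h]
        · exact absurd ⟨_, hmem⟩ h
    · have hno (s : Finset ι) : ω ∉ A s := fun h => hω (by
        rw [show (Function.mulSupport fun i => F i ω) = s from h]; exact s.finite_toSet)
      simp [hno, finprod_of_infinite_mulSupport (Set.not_finite.1 hω)]
  rw [key]
  exact (MeasurableSet.iUnion fun s => (hAm s).inter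
    (Finset.measurable_prod s (fun i _ => hF i) hB)).union
    ((MeasurableSet.iUnion hAm).compl.inter (MeasurableSet.const _))

/-- The noise in which each path `w` is replaced by `pathEval w`. -/
def regNoise {n : ℕ} (θ : Noise n) : Noise n := fun k => ((θ k).1, (θ k).2.1, pathEval (θ k).2.2)

theorem measurable_subNoise {n : ℕ} (i : ℕ) :
    Measurable fun θ : Noise n => subNoise θ i := by
  unfold subNoise; fun_prop

section

variable {n : ℕ} {T : ℝ} {f : (Fin (n + 1) → ℝ) → ℝ} {u : ℝ → ℝ → ℝ} {ρ : ℝ → ℝ}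

/-- Measurability of a function that depends on the choice made at the root. -/
theorem measurable_choice_case {α β : Type*} [MeasurableSpace α] [MeasurableSpace β] {c : Code n}
    {Z : α → MechIdx c} (hZ : Measurable Z) {G : MechIdx c → α → β} (hG : ∀ z, Measurable (G z)) :
    Measurable fun a => G (Z a) a :=
  (measurable_from_prod_countable_right (f := fun p : MechIdx c × α => G p.1 p.2) hG).comp
    (hZ.prodMk measurable_id)

theorem measurable_tail (hρ : Measurable ρ) : Measurable (tail ρ) := by
  have h : tail ρ = fun t => ∫ s, (Ioi t).indicator ρ s := by
    funext t
    exact (integral_indicator measurableSet_Ioi).symm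
  rw [h]
  have hm : Measurable fun p : ℝ × ℝ => (Ioi p.1).indicator ρ p.2 := by
    have : (fun p : ℝ × ℝ => (Ioi p.1).indicator ρ p.2)
        = {p : ℝ × ℝ | p.1 < p.2}.indicator fun p => ρ p.2 := rfl
    rw [this]
    exact (hρ.comp measurable_snd).indicator (measurableSet_lt measurable_fst measurable_snd)
  exact hm.stronglyMeasurable.integral_prod_right.measurable

/-- The lifetime, the time of birth, the choice and the displacement of the root. -/
theorem measurable_root_displacement (g : ℝ × ℝ × Noise n → ℝ≥0) (hg : Measurable g) :
    Measurable fun p : ℝ × ℝ × Noise n => p.2.1 + pathEval (p.2.2 []).2.2 (g p) := by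
  have h0 : Measurable fun p : ℝ × ℝ × Noise n => (p.2.2 []).2.2 :=
    measurable_snd.comp (measurable_snd.comp
      ((measurable_pi_apply ([] : Label)).comp (measurable_snd.comp measurable_snd)))
  have h1 : Measurable fun p : ℝ × ℝ × Noise n => pathEval (p.2.2 []).2.2 (g p) :=
    Measurable.pathEval h0 hg
  have h2 : Measurable fun p : ℝ × ℝ × Noise n => p.2.1 := measurable_fst.comp measurable_snd
  exact h2.add h1

theorem measurableSet_root_dies :
    MeasurableSet {p : ℝ × ℝ × Noise n | p.1 + (p.2.2 []).1 < T} :=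
  measurableSet_lt (by fun_prop) measurable_const

theorem measurable_child (i : ℕ) :
    Measurable fun p : ℝ × ℝ × Noise n => (p.1 + (p.2.2 []).1,
      p.2.1 + pathEval (p.2.2 []).2.2 (p.2.2 []).1.toNNReal, subNoise p.2.2 i) := by
  refine Measurable.prodMk (by fun_prop) (Measurable.prodMk ?_ ?_)
  · exact measurable_root_displacement (fun p => (p.2.2 []).1.toNNReal)
      (measurable_real_toNNReal.comp (by fun_prop))
  · exact (measurable_subNoise i).comp (by fun_prop)

theorem measurable_noiseFactor (hρ : Measurable ρ) (hev : ∀ c : Code n, Measurable (c.eval f u T))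
    (k : Label) : ∀ c : Code n,
    Measurable fun p : ℝ × ℝ × Noise n => noiseFactor T f u ρ (regNoise p.2.2) p.1 p.2.1 c k := by
  induction k using List.reverseRecOn with
  | nil =>
    intro c
    simp only [noiseFactor_nil]
    refine Measurable.ite measurableSet_root_dies ?_ ?_
    · exact measurable_const.div
        (measurable_const.mul (hρ.comp (by simp only [regNoise]; fun_prop)))
    · refine ((hev c).comp (measurable_root_displacement (fun p => (T - p.1).toNNReal)
        (measurable_real_toNNReal.comp (by fun_prop)))).div
        ((measurable_tail hρ).comp (by fun_prop))
  | append_singleton k i ih =>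
    intro c
    simp only [noiseFactor_append]
    refine Measurable.ite measurableSet_root_dies ?_ measurable_const
    refine measurable_choice_case (Z := fun p : ℝ × ℝ × Noise n => (p.2.2 []).2.1 c)
      (G := fun Z p => ((mech c Z)[i]?).elim 1 fun z => noiseFactor T f u ρ
        (subNoise (regNoise p.2.2) i) (p.1 + (p.2.2 []).1)
        (p.2.1 + pathEval (p.2.2 []).2.2 (p.2.2 []).1.toNNReal) z k) (by fun_prop) fun Z => ?_
    cases (mech c Z)[i]? with
    | none => exact measurable_const
    | some z => exact (ih z).comp (measurable_child i)

theorem measurable_noiseFunctional (hρ : Measurable ρ)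
    (hev : ∀ c : Code n, Measurable (c.eval f u T)) (c : Code n) :
    Measurable fun p : ℝ × ℝ × Noise n =>
      noiseFunctional T f u ρ (regNoise p.2.2) p.1 p.2.1 c :=
  measurable_finprod fun k => measurable_noiseFactor hρ hev k c

theorem measurableSet_isSome_noiseParticle (k : Label) : ∀ c : Code n,
    MeasurableSet {p : ℝ × ℝ × Noise n |
      (noiseParticle T (regNoise p.2.2) p.1 p.2.1 c k).isSome} := by
  induction k using List.reverseRecOn with
  | nil => intro c; simp [noiseParticle, particle]
  | append_singleton k i ih =>
    intro c
    have h : Measurable fun p : ℝ × ℝ × Noise n =>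
        (((mech c ((p.2.2 []).2.1 c))[i]?).bind fun z => noiseParticle T
          (subNoise (regNoise p.2.2) i) (p.1 + (p.2.2 []).1)
          (p.2.1 + pathEval (p.2.2 []).2.2 (p.2.2 []).1.toNNReal) z k).isSome := by
      refine measurable_choice_case (Z := fun p : ℝ × ℝ × Noise n => (p.2.2 []).2.1 c)
        (G := fun Z p => (((mech c Z)[i]?).bind fun z => noiseParticle T
          (subNoise (regNoise p.2.2) i) (p.1 + (p.2.2 []).1)
          (p.2.1 + pathEval (p.2.2 []).2.2 (p.2.2 []).1.toNNReal) z k).isSome)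
        (by fun_prop) fun Z => ?_
      cases (mech c Z)[i]? with
      | none => exact measurable_const
      | some z =>
        have := measurable_to_bool (f := fun p : ℝ × ℝ × Noise n =>
          (noiseParticle T (regNoise p.2.2) p.1 p.2.1 z k).isSome) (ih z)
        exact this.comp (measurable_child i)
    have h2 := measurableSet_root_dies (T := T).inter (h (measurableSet_singleton true))
    convert h2 using 1
    ext p
    simp only [noiseParticle_append, mem_ofPred_eq, mem_inter_iff, mem_preimage,
      mem_singleton_iff]
    change (if p.1 + (p.2.2 []).1 < T then _ else _ : Option (Particle n)).isSome = true ↔ _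
    split_ifs with h3
    · simp only [h3, true_and]; rfl
    · simp [h3]

end

/-! ### Almost sure finiteness of the tree -/

/-- A weight on codes under which the total weight of a tuple in `M(c)` is at most a constant times
the weight of `c`. -/
def Code.size {n : ℕ} : Code n → ℕ
  | .id => 1
  | .star _ _ => 1
  | .dx k _ => k

theorem Code.one_le_size {n : ℕ} : ∀ c : Code n, 1 ≤ c.size
  | .id => le_rfl
  | .star _ _ => le_rfl
  | .dx _ hk => hk

theorem FdBIdx.sum_size_tuple_le {n k : ℕ} (m : FdBIdx n k) :
    (m.tuple.map Code.size).sum ≤ 1 + (n + 1) * k := by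
  have h : (m.tuple.map Code.size).sum =
      1 + ∑ i : Fin k, ∑ q : Fin (n + 1), (m.1 i q : ℕ) * ((q : ℕ) + ((i : ℕ) + 1)) := by
    simp only [FdBIdx.tuple, List.map_cons, List.sum_cons, List.map_flatMap, List.map_replicate]
    congr 1
    simp only [List.flatMap, List.sum_flatten, List.map_map, Function.comp_def,
      List.sum_replicate, smul_eq_mul, Code.size]
    simp only [← List.ofFn_eq_map, List.sum_ofFn]
  have h2 := m.2
  rw [h]
  gcongr
  calc _ ≤ ∑ i : Fin k, (n + 1) * ((∑ q, (m.1 i q : ℕ)) * ((i : ℕ) + 1)) := by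
        refine Finset.sum_le_sum fun i _ => ?_
        rw [Finset.sum_mul, Finset.mul_sum]
        refine Finset.sum_le_sum fun q _ => ?_
        have hq : (q : ℕ) ≤ n := by omega
        have : (q : ℕ) + ((i : ℕ) + 1) ≤ (n + 1) * ((i : ℕ) + 1) := by nlinarith
        calc _ ≤ (m.1 i q : ℕ) * ((n + 1) * ((i : ℕ) + 1)) := by gcongr
          _ = _ := by ring
    _ = (n + 1) * k := by rw [← Finset.mul_sum, h2]

theorem sum_size_mech_le {n : ℕ} (c : Code n) (Z : MechIdx c) :
    ((mech c Z).map Code.size).sum ≤ (n + 3) ^ 2 * c.size := by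
  match c, Z with
  | .id, _ =>
    have : (1 : ℕ) ≤ (n + 3) ^ 2 := Nat.one_le_pow _ _ (by omega)
    simpa [mech, fStar, Code.size] using this
  | .star a α, .inl _ =>
    have : (2 : ℕ) ≤ (n + 3) ^ 2 := by nlinarith [Nat.zero_le n]
    simpa [mech, fStar, Code.size] using this
  | .star a α, .inr (.inl ⟨k, m⟩) =>
    have h := m.sum_size_tuple_le
    have hk : (k : ℕ) + 1 ≤ n := k.2
    simp only [mech, List.map_cons, List.sum_cons, Code.size]
    nlinarith
  | .star a α, .inr (.inr (j, l)) =>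
    have hj : (j : ℕ) ≤ n := by omega
    have hl : (l : ℕ) ≤ n := by omega
    simp only [mech, List.map_cons, List.sum_cons, Code.size, List.map_nil, List.sum_nil]
    nlinarith
  | .dx k hk, m =>
    have h := m.sum_size_tuple_le
    simp only [mech, Code.size]
    refine h.trans ?_
    nlinarith [mul_nonneg (Nat.zero_le n) (Nat.zero_le k),
      mul_nonneg (Nat.zero_le (n * n)) (Nat.zero_le k)]

section

variable {n : ℕ} {T : ℝ}

/-- The number of particles of generation `g`. -/
def genCount (T : ℝ) (g : ℕ) (θ : Noise n) (t x : ℝ) (c : Code n) : ℝ≥0∞ :=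
  ∑' k : Label, if k.length = g ∧ (noiseParticle T θ t x c k).isSome then 1 else 0

theorem genCount_zero (θ : Noise n) (t x : ℝ) (c : Code n) : genCount T 0 θ t x c = 1 := by
  unfold genCount
  rw [tsum_eq_single []]
  · simp [noiseParticle, particle]
  · intro k hk
    simp [hk]

theorem genCount_succ (g : ℕ) (θ : Noise n) (t x : ℝ) (c : Code n) :
    genCount T (g + 1) θ t x c = if t + (θ []).1 < T then
      ∑ i : Fin (mech c ((θ []).2.1 c)).length, genCount T g (subNoise θ i) (t + (θ []).1)
        (x + (θ []).2.2 (θ []).1.toNNReal) (mech c ((θ []).2.1 c))[i]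
      else 0 := by
  unfold genCount
  rw [tsum_label]
  simp only [noiseParticle_append, List.length_nil, List.length_append, List.length_singleton]
  rw [if_neg (by simp), zero_add]
  by_cases h : t + (θ []).1 < T
  all_goals simp only [h, if_true, if_false]
  · rw [tsum_eq_sum (s := Finset.range (mech c ((θ []).2.1 c)).length), Finset.sum_range]
    · simp
    · intro i hi
      rw [Finset.mem_range, not_lt] at hi
      simp [List.getElem?_eq_none hi]
  · simp

theorem tsum_genCount (θ : Noise n) (t x : ℝ) (c : Code n) :
    ∑' g, genCount T g θ t x c =
      ∑' k : Label, if (noiseParticle T θ t x c k).isSome then 1 else 0 := by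
  unfold genCount
  rw [ENNReal.tsum_comm]
  refine tsum_congr fun k => ?_
  rw [tsum_eq_single k.length]
  · simp
  · intro g hg
    simp [hg.symm]

theorem measurable_genCount (g : ℕ) (c : Code n) :
    Measurable fun p : ℝ × ℝ × Noise n => genCount T g (regNoise p.2.2) p.1 p.2.1 c := by
  unfold genCount
  refine Measurable.tsum fun k => ?_
  by_cases hk : k.length = g
  · simp only [hk, true_and]
    exact Measurable.ite (measurableSet_isSome_noiseParticle k c) measurable_const measurable_const
  · simp only [hk, false_and, if_false]
    exact measurable_const

/-- The law of the whole noise when `ν` is the law of the noise at one label. -/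
abbrev noiseLaw (ν : Measure (LabelNoise n)) : Measure (Noise n) :=
  Measure.infinitePi fun _ : Label => ν

variable {ν : Measure (LabelNoise n)} [IsProbabilityMeasure ν] {ρ : ℝ → ℝ}

theorem measurePreserving_split :
    MeasurePreserving (fun θ : Noise n => (θ [], subNoise θ)) (noiseLaw ν)
      (ν.prod (Measure.infinitePi fun _ : ℕ => noiseLaw ν)) where
  measurable := (measurable_pi_apply _).prodMk (measurable_pi_lambda _ measurable_subNoise)
  map_eq := map_split_infinitePi ν

/-- The mean number of particles of generation `g` is at most geometric in `g`. -/
theorem lintegral_genCount_le {a : ℝ} (ha : 0 ≤ a) (hν : ν.map Prod.fst = lifetimeLaw ρ) (g : ℕ) :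
    ∀ (t x : ℝ) (c : Code n), t ≤ T →
      ∫⁻ θ, genCount T g (regNoise θ) t x c ∂(noiseLaw ν) ≤
        c.size * ((n + 3 : ℕ) ^ 2 * ∫⁻ s, ENNReal.ofReal (Real.exp (-a * s)) ∂(lifetimeLaw ρ)) ^ g
          * ENNReal.ofReal (Real.exp (a * (T - t))) := by
  set L := ∫⁻ s, ENNReal.ofReal (Real.exp (-a * s)) ∂(lifetimeLaw ρ)
  induction g with
  | zero =>
    intro t x c ht
    simp only [genCount_zero, lintegral_one, measure_univ, pow_zero, mul_one]
    have h1 : (1 : ℝ≥0∞) ≤ c.size := by exact_mod_cast c.one_le_size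
    have h2 : (1 : ℝ≥0∞) ≤ ENNReal.ofReal (Real.exp (a * (T - t))) := by
      rw [ENNReal.one_le_ofReal]
      exact Real.one_le_exp (mul_nonneg ha (by linarith))
    calc (1 : ℝ≥0∞) = 1 * 1 := (one_mul 1).symm
      _ ≤ _ := mul_le_mul' h1 h2
  | succ g ih =>
    intro t x c ht
    set K : ℝ≥0∞ := (n + 3 : ℕ) ^ 2 * L
    set G : LabelNoise n × (ℕ → Noise n) → ℝ≥0∞ := fun p => if t + p.1.1 < T then
      ∑ i : Fin (mech c (p.1.2.1 c)).length, genCount T g (regNoise (p.2 i)) (t + p.1.1)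
        (x + pathEval p.1.2.2 p.1.1.toNNReal) (mech c (p.1.2.1 c))[i] else 0 with hG
    have hGm : Measurable G := by
      refine Measurable.ite (measurableSet_lt (by fun_prop) measurable_const) ?_ measurable_const
      refine measurable_choice_case (Z := fun p : LabelNoise n × (ℕ → Noise n) => p.1.2.1 c)
        (G := fun Z p => ∑ i : Fin (mech c Z).length, genCount T g (regNoise (p.2 i)) (t + p.1.1)
          (x + pathEval p.1.2.2 p.1.1.toNNReal) (mech c Z)[i]) (by fun_prop) fun Z => ?_
      refine Finset.measurable_sum _ fun i _ => ?_
      refine (measurable_genCount g _).comp (Measurable.prodMk (by fun_prop)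
        (Measurable.prodMk (measurable_const.add (Measurable.pathEval (by fun_prop) ?_))
          (by fun_prop)))
      exact measurable_real_toNNReal.comp (by fun_prop)
    have h1 : ∫⁻ θ, genCount T (g + 1) (regNoise θ) t x c ∂(noiseLaw ν) =
        ∫⁻ e, ∫⁻ η, G (e, η) ∂(Measure.infinitePi fun _ : ℕ => noiseLaw ν) ∂ν := by
      rw [← lintegral_prod _ hGm.aemeasurable,
        ← measurePreserving_split.lintegral_comp hGm]
      simp only [genCount_succ]
      rfl
    rw [h1]
    have h2 (e : LabelNoise n) :
        ∫⁻ η, G (e, η) ∂(Measure.infinitePi fun _ : ℕ => noiseLaw ν) ≤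
          ((n + 3 : ℕ) ^ 2 * c.size * K ^ g * ENNReal.ofReal (Real.exp (a * (T - t))))
            * ENNReal.ofReal (Real.exp (-a * e.1)) := by
      by_cases he : t + e.1 < T
      · simp only [hG, he, if_true]
        have hm (i : Fin (mech c (e.2.1 c)).length) : Measurable fun θ : Noise n =>
            genCount T g (regNoise θ) (t + e.1) (x + pathEval e.2.2 e.1.toNNReal)
              (mech c (e.2.1 c))[i] := (measurable_genCount g _).comp
            (measurable_const.prodMk (measurable_const.prodMk measurable_id))
        have hm' (i : Fin (mech c (e.2.1 c)).length) : Measurable fun η : ℕ → Noise n =>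
            genCount T g (regNoise (η i)) (t + e.1) (x + pathEval e.2.2 e.1.toNNReal)
              (mech c (e.2.1 c))[i] := (hm i).comp (measurable_pi_apply (i : ℕ))
        refine (lintegral_finsetSum' Finset.univ fun i _ => (hm' i).aemeasurable).trans_le ?_
        calc _ = ∑ i : Fin (mech c (e.2.1 c)).length, ∫⁻ θ, genCount T g (regNoise θ) (t + e.1)
                (x + pathEval e.2.2 e.1.toNNReal) (mech c (e.2.1 c))[i] ∂(noiseLaw ν) := by
              refine Finset.sum_congr rfl fun i _ => ?_
              exact (measurePreserving_eval_infinitePi (fun _ : ℕ => noiseLaw ν)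
                (i : ℕ)).lintegral_comp (hm i)
          _ ≤ ∑ i : Fin (mech c (e.2.1 c)).length, ((mech c (e.2.1 c))[i].size : ℝ≥0∞) * (K ^ g
                * ENNReal.ofReal (Real.exp (a * (T - (t + e.1))))) := by
              refine Finset.sum_le_sum fun i _ => ?_
              rw [← mul_assoc]
              exact ih _ _ _ he.le
          _ = (((mech c (e.2.1 c)).map Code.size).sum : ℕ) * (K ^ g
                * ENNReal.ofReal (Real.exp (a * (T - (t + e.1))))) := by
              rw [← Finset.sum_mul]
              congr 1
              rw [← Nat.cast_sum]
              congr 1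
              rw [← Fin.sum_univ_fun_getElem]
              rfl
          _ ≤ ((n + 3) ^ 2 * c.size : ℕ) * (K ^ g
                * ENNReal.ofReal (Real.exp (a * (T - (t + e.1))))) := by
              gcongr
              exact sum_size_mech_le c _
          _ = _ := by
              have : Real.exp (a * (T - (t + e.1)))
                  = Real.exp (a * (T - t)) * Real.exp (-a * e.1) := by
                rw [← Real.exp_add]; ring_nf
              rw [this, ENNReal.ofReal_mul (Real.exp_pos _).le]
              push_cast
              ring
      · simp [hG, he]
    calc _ ≤ ∫⁻ e : LabelNoise n,
          ((n + 3 : ℕ) ^ 2 * c.size * K ^ g * ENNReal.ofReal (Real.exp (a * (T - t))))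
            * ENNReal.ofReal (Real.exp (-a * e.1)) ∂ν := lintegral_mono h2
      _ = ((n + 3 : ℕ) ^ 2 * c.size * K ^ g * ENNReal.ofReal (Real.exp (a * (T - t)))) * L := by
          rw [lintegral_const_mul _ (by fun_prop)]
          congr 1
          have : L = ∫⁻ s, ENNReal.ofReal (Real.exp (-a * s)) ∂(ν.map Prod.fst) := by rw [hν]
          rw [this, lintegral_map (by fun_prop) measurable_fst]
      _ = _ := by
          rw [pow_succ]; ring

theorem tendsto_laplace_lifetimeLaw [IsProbabilityMeasure (lifetimeLaw ρ)] :
    Filter.Tendsto (fun a : ℕ => ∫⁻ s, ENNReal.ofReal (Real.exp (-(a : ℝ) * s)) ∂(lifetimeLaw ρ))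
      Filter.atTop (nhds 0) := by
  have hpos : ∀ᵐ s ∂(lifetimeLaw ρ), 0 < s :=
    (withDensity_absolutelyContinuous _ _).ae_le (ae_restrict_mem measurableSet_Ioi)
  have h := tendsto_lintegral_of_dominated_convergence (μ := lifetimeLaw ρ)
    (F := fun (a : ℕ) s => ENNReal.ofReal (Real.exp (-(a : ℝ) * s))) (f := fun _ => 0) (fun _ => 1)
    (fun a => by fun_prop) (fun a => ?_) (by simp) ?_
  · simpa using h
  · filter_upwards [hpos] with s hs
    rw [ENNReal.ofReal_le_one, Real.exp_le_one_iff]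
    nlinarith [(Nat.cast_nonneg a : (0 : ℝ) ≤ a)]
  · filter_upwards [hpos] with s hs
    rw [← ENNReal.ofReal_zero]
    refine ENNReal.tendsto_ofReal (Real.tendsto_exp_atBot.comp ?_)
    simp only [neg_mul]
    exact Filter.tendsto_neg_atTop_atBot.comp
      (tendsto_natCast_atTop_atTop.atTop_mul_const hs)

/-- Almost surely, the tree has finitely many particles. -/
theorem ae_finite_particleLabels [IsProbabilityMeasure (lifetimeLaw ρ)]
    (hν : ν.map Prod.fst = lifetimeLaw ρ) {t : ℝ} (ht : t ≤ T) (x : ℝ) (c : Code n) :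
    ∀ᵐ θ ∂(noiseLaw ν), (particleLabels T (regNoise θ) t x c).Finite := by
  obtain ⟨a, ha⟩ : ∃ a : ℕ, ((n + 3 : ℕ) ^ 2 : ℝ≥0∞) *
      ∫⁻ s, ENNReal.ofReal (Real.exp (-(a : ℝ) * s)) ∂(lifetimeLaw ρ) < 1 := by
    have h := ENNReal.Tendsto.const_mul (a := ((n + 3 : ℕ) ^ 2 : ℝ≥0∞))
      (tendsto_laplace_lifetimeLaw (ρ := ρ)) (Or.inr (by finiteness))
    rw [mul_zero] at h
    exact (h.eventually_lt_const one_pos).exists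
  set K : ℝ≥0∞ := ((n + 3 : ℕ) ^ 2 : ℝ≥0∞) *
      ∫⁻ s, ENNReal.ofReal (Real.exp (-(a : ℝ) * s)) ∂(lifetimeLaw ρ)
  have hm (g : ℕ) : Measurable fun θ : Noise n => genCount T g (regNoise θ) t x c :=
    (measurable_genCount g c).comp
      (measurable_const.prodMk (measurable_const.prodMk measurable_id))
  have hsum : ∫⁻ θ, ∑' g, genCount T g (regNoise θ) t x c ∂(noiseLaw ν) ≠ ⊤ := by
    rw [lintegral_tsum fun g => (hm g).aemeasurable]
    refine ne_top_of_le_ne_top ?_ (ENNReal.tsum_le_tsum fun g =>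
      lintegral_genCount_le (Nat.cast_nonneg a) hν g t x c ht)
    rw [ENNReal.tsum_mul_right, ENNReal.tsum_mul_left, ENNReal.tsum_geometric]
    have : (1 - K)⁻¹ ≠ ⊤ := ENNReal.inv_ne_top.2 (tsub_pos_of_lt ha).ne'
    finiteness
  filter_upwards [ae_lt_top (Measurable.tsum hm) hsum] with θ hθ
  rw [tsum_genCount] at hθ
  have := ENNReal.finite_const_le_of_tsum_ne_top hθ.ne one_ne_zero
  refine this.subset fun k hk => ?_
  have hk' : (noiseParticle T (regNoise θ) t x c k).isSome = true := hk
  simp [hk']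

end

/-! ### Laws at the root of the tree -/

theorem heatKernel_nonneg (t x : ℝ) : 0 ≤ heatKernel t x := by
  unfold heatKernel; positivity

theorem measurable_heatKernel : Measurable fun p : ℝ × ℝ => heatKernel p.1 p.2 := by
  unfold heatKernel; fun_prop

theorem measurable_heatKernel_sub (t x : ℝ) :
    Measurable fun p : ℝ × ℝ => heatKernel (p.1 - t) (p.2 - x) :=
  measurable_heatKernel.comp (f := fun p : ℝ × ℝ => (p.1 - t, p.2 - x)) (by fun_prop)

theorem lintegral_gaussianReal {s : ℝ} (hs : 0 < s) (x : ℝ) {g : ℝ → ℝ≥0∞} (hg : Measurable g) :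
    ∫⁻ y, g (x + y) ∂(gaussianReal 0 s.toNNReal)
      = ∫⁻ y, ENNReal.ofReal (heatKernel s (y - x)) * g y := by
  have hs' : s.toNNReal ≠ 0 := (Real.toNNReal_pos.2 hs).ne'
  rw [gaussianReal_of_var_ne_zero _ hs', lintegral_withDensity_eq_lintegral_mul _
    (measurable_gaussianPDF _ _) (by fun_prop),
    ← lintegral_add_left_eq_self (fun y => ENNReal.ofReal (heatKernel s (y - x)) * g y) x]
  refine lintegral_congr fun y => ?_
  simp only [Pi.mul_apply, gaussianPDF, gaussianPDFReal, heatKernel, Real.coe_toNNReal _ hs.le,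
    sub_zero, add_sub_cancel_left]
  congr 2
  rw [div_eq_mul_inv _ (√_), mul_comm]

/-- The measure `φ(s-t,y-x) ds dy` on `(t,T] × ℝ`. -/
def kernelMeasure (T t x : ℝ) : Measure (ℝ × ℝ) :=
  ((volume.restrict (Ioc t T)).prod volume).withDensity
    fun p => ENNReal.ofReal (heatKernel (p.1 - t) (p.2 - x))

instance (T t x : ℝ) : SFinite (kernelMeasure T t x) := by
  unfold kernelMeasure; infer_instance

theorem integrable_kernelMeasure_iff {T t x : ℝ} {g : ℝ × ℝ → ℝ} :
    Integrable g (kernelMeasure T t x) ↔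
      Integrable (fun p : ℝ × ℝ => heatKernel (p.1 - t) (p.2 - x) * g p)
        ((volume.restrict (Ioc t T)).prod volume) := by
  rw [kernelMeasure, integrable_withDensity_iff_integrable_smul'
    (measurable_heatKernel_sub t x).ennreal_ofReal (by simp)]
  simp [ENNReal.toReal_ofReal (heatKernel_nonneg _ _)]

theorem integral_kernelMeasure {T t x : ℝ} (htT : t ≤ T) {g : ℝ × ℝ → ℝ}
    (hg : Integrable g (kernelMeasure T t x)) :
    ∫ p, g p ∂(kernelMeasure T t x)
      = ∫ s in t..T, ∫ y, heatKernel (s - t) (y - x) * g (s, y) := by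
  rw [intervalIntegral.integral_of_le htT, ← integral_prod
    (fun p : ℝ × ℝ => heatKernel (p.1 - t) (p.2 - x) * g p) (integrable_kernelMeasure_iff.1 hg),
    kernelMeasure, integral_withDensity_eq_integral_toReal_smul
    (measurable_heatKernel_sub t x).ennreal_ofReal (by simp)]
  simp [ENNReal.toReal_ofReal (heatKernel_nonneg _ _)]

theorem lifetimeLaw_ae_pos (ρ : ℝ → ℝ) : ∀ᵐ s ∂(lifetimeLaw ρ), 0 < s :=
  (withDensity_absolutelyContinuous _ _).ae_le (ae_restrict_mem measurableSet_Ioi)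

theorem integrableOn_density {ρ : ℝ → ℝ} (hρ : Measurable ρ) (hρ_pos : ∀ s, 0 < s → 0 < ρ s)
    [IsProbabilityMeasure (lifetimeLaw ρ)] : IntegrableOn ρ (Ioi 0) := by
  refine ⟨hρ.aestronglyMeasurable, ?_⟩
  have h : lifetimeLaw ρ univ = 1 := measure_univ
  rw [lifetimeLaw, withDensity_apply _ MeasurableSet.univ, Measure.restrict_univ] at h
  rw [HasFiniteIntegral]
  calc _ = ∫⁻ s in Ioi 0, ENNReal.ofReal (ρ s) := setLIntegral_congr_fun measurableSet_Ioi
        fun s hs => by rw [Real.enorm_of_nonneg (hρ_pos s hs).le]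
    _ < ⊤ := by rw [h]; exact ENNReal.one_lt_top

theorem lifetimeLaw_Ici {ρ : ℝ → ℝ} (hρ : Measurable ρ) (hρ_pos : ∀ s, 0 < s → 0 < ρ s)
    [IsProbabilityMeasure (lifetimeLaw ρ)] {r : ℝ} (hr : 0 ≤ r) :
    lifetimeLaw ρ (Ici r) = ENNReal.ofReal (tail ρ r) := by
  have hint := (integrableOn_density hρ hρ_pos).mono_set (Ioi_subset_Ioi hr)
  rw [lifetimeLaw, withDensity_apply _ measurableSet_Ici, Measure.restrict_restrict
    measurableSet_Ici, tail, ofReal_integral_eq_lintegral_ofReal hint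
    ((ae_restrict_mem measurableSet_Ioi).mono fun s hs => (hρ_pos s (hr.trans_lt hs)).le)]
  refine setLIntegral_congr ?_
  rcases hr.eq_or_lt with rfl | hr
  · rw [inter_eq_right.2 Ioi_subset_Ici_self]
    exact Filter.EventuallyEq.rfl
  · have : Ici r ⊆ Ioi 0 := fun s hs => hr.trans_le hs
    rw [inter_eq_left.2 this]
    exact Ioi_ae_eq_Ici.symm

theorem tail_pos {ρ : ℝ → ℝ} (hρ : Measurable ρ) (hρ_pos : ∀ s, 0 < s → 0 < ρ s)
    [IsProbabilityMeasure (lifetimeLaw ρ)] {r : ℝ} (hr : 0 ≤ r) : 0 < tail ρ r := by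
  have hint := (integrableOn_density hρ hρ_pos).mono_set (Ioi_subset_Ioi hr)
  have hp : ∀ s ∈ Ioi r, 0 < ρ s := fun s hs => hρ_pos s (hr.trans_lt hs)
  rw [tail, setIntegral_pos_iff_support_of_nonneg_ae
    ((ae_restrict_mem measurableSet_Ioi).mono fun s hs => (hp s hs).le) hint]
  have : Ioi r ⊆ Function.support ρ := fun s hs => (hp s hs).ne'
  rw [inter_eq_right.2 this]
  simp

theorem tail_zero {ρ : ℝ → ℝ} (hρ : Measurable ρ) (hρ_pos : ∀ s, 0 < s → 0 < ρ s)
    [IsProbabilityMeasure (lifetimeLaw ρ)] : tail ρ 0 = 1 := by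
  have h := lifetimeLaw_Ici hρ hρ_pos (le_refl (0 : ℝ))
  have h1 : lifetimeLaw ρ (Ici 0) = 1 := by
    rw [prob_compl_eq_zero_iff measurableSet_Ici |>.symm]
    have : ∀ᵐ s ∂(lifetimeLaw ρ), s ∈ Ici (0 : ℝ) :=
      (lifetimeLaw_ae_pos ρ).mono fun s hs => le_of_lt hs
    exact this
  rw [h1] at h
  exact (ENNReal.ofReal_eq_one.1 h.symm)

theorem lintegral_choiceLaw {n : ℕ} (c : Code n) (g : MechIdx c → ℝ≥0∞) :
    ∫⁻ Z, g Z ∂(choiceLaw c) = (Fintype.card (MechIdx c) : ℝ≥0∞)⁻¹ * ∑ Z, g Z := by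
  rw [choiceLaw, lintegral_smul_measure, lintegral_count, tsum_fintype, smul_eq_mul]

section

variable {n : ℕ} {Ω : Type*} [MeasurableSpace Ω] {P : Measure Ω}
  {ρ : ℝ → ℝ} {τ : Label → Ω → ℝ} {I : (c : Code n) → Label → Ω → MechIdx c}
  {W : Label → ℝ≥0 → Ω → ℝ}

namespace IsTreeNoise

theorem map_pathEval (h : IsTreeNoise P ρ τ I W) (s : ℝ≥0) :
    (pathLaw P W).map (fun w => pathEval w s) = gaussianReal 0 s := by
  have hm : Measurable fun w : ℝ≥0 → ℝ => pathEval w s :=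
    Measurable.pathEval measurable_id measurable_const
  rw [pathLaw, Measure.map_map hm (h.measurable_path []),
    ← ((h.brownian []).toIsPreBrownianReal.hasLaw_eval s).map_eq]
  refine Measure.map_congr ?_
  filter_upwards [(h.brownian []).cont] with ω hω
  simp only [Function.comp_apply, pathEval_eq_of_continuous hω]

/-- Integration of a function of the lifetime, of the choice in `M(c)` and of the value of the path
at a time that depends on the lifetime. -/
theorem lintegral_labelLaw [IsProbabilityMeasure P] (h : IsTreeNoise P ρ τ I W) (c : Code n)
    {r : ℝ → ℝ≥0}
    (hr : Measurable r) {G : ℝ × MechIdx c × ℝ → ℝ≥0∞} (hG : Measurable G) :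
    ∫⁻ e : LabelNoise n, G (e.1, e.2.1 c, pathEval e.2.2 (r e.1)) ∂(labelLaw P ρ W)
      = ∫⁻ s, (Fintype.card (MechIdx c) : ℝ≥0∞)⁻¹
          * ∑ Z, ∫⁻ y, G (s, Z, y) ∂(gaussianReal 0 (r s)) ∂(lifetimeLaw ρ) := by
  have := h.isProbabilityMeasure_lifetimeLaw
  have := h.isProbabilityMeasure_choiceLaw
  have := h.isProbabilityMeasure_pathLaw
  have hm : Measurable fun e : LabelNoise n => G (e.1, e.2.1 c, pathEval e.2.2 (r e.1)) := by
    refine hG.comp (Measurable.prodMk measurable_fst (Measurable.prodMk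
      ((measurable_pi_apply c).comp (measurable_fst.comp measurable_snd)) ?_))
    exact Measurable.pathEval (measurable_snd.comp measurable_snd) (hr.comp measurable_fst)
  rw [labelLaw, lintegral_prod _ hm.aemeasurable]
  refine lintegral_congr fun s => ?_
  have hm2 : Measurable fun y : ((c : Code n) → MechIdx c) × (ℝ≥0 → ℝ) =>
      G (s, y.1 c, pathEval y.2 (r s)) := hm.comp measurable_prodMk_left
  refine (lintegral_prod _ hm2.aemeasurable).trans ?_
  rw [← lintegral_choiceLaw,
    ← (measurePreserving_eval_infinitePi (fun c : Code n => choiceLaw c) c).lintegral_comp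
      (measurable_from_top)]
  refine lintegral_congr fun b => ?_
  have hp : Measurable fun w : ℝ≥0 → ℝ => pathEval w (r s) :=
    Measurable.pathEval measurable_id measurable_const
  have hg : Measurable fun y => G (s, Function.eval c b, y) := hG.comp (by fun_prop)
  rw [← h.map_pathEval (r s), lintegral_map hg hp]

end IsTreeNoise

/-- The choice, the time and the position of the branching of the root. -/
def branchPoint (t x : ℝ) (c : Code n) (e : LabelNoise n) : MechIdx c × ℝ × ℝ :=
  (e.2.1 c, t + e.1, x + pathEval e.2.2 e.1.toNNReal)

theorem measurable_branchPoint (t x : ℝ) (c : Code n) : Measurable (branchPoint t x c) := by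
  refine Measurable.prodMk ((measurable_pi_apply c).comp (measurable_fst.comp measurable_snd))
    (Measurable.prodMk (by fun_prop) (measurable_const.add ?_))
  exact Measurable.pathEval (measurable_snd.comp measurable_snd)
    (measurable_real_toNNReal.comp measurable_fst)

/-- The factor `1 / (q_c ρ(τ))` of the root. -/
def branchFactor (ρ : ℝ → ℝ) (c : Code n) (s : ℝ) : ℝ :=
  1 / ((Fintype.card (MechIdx c) : ℝ)⁻¹ * ρ s)

theorem measurable_branchFactor (hρ : Measurable ρ) (c : Code n) :
    Measurable (branchFactor ρ c) := measurable_const.div (measurable_const.mul hρ)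

theorem measurable_rootFactor (hρ : Measurable ρ) (c : Code n) :
    Measurable fun e : LabelNoise n => ENNReal.ofReal (branchFactor ρ c e.1) :=
  ((measurable_branchFactor hρ c).ennreal_ofReal.comp measurable_fst)

theorem branchFactor_nonneg (hρ_pos : ∀ s, 0 < s → 0 < ρ s) (c : Code n) {s : ℝ} (hs : 0 < s) :
    0 ≤ branchFactor ρ c s :=
  one_div_nonneg.2 (mul_nonneg (by positivity) (hρ_pos s hs).le)

theorem measurableSet_dies (T t : ℝ) : MeasurableSet {e : LabelNoise n | t + e.1 < T} :=
  measurableSet_lt (by fun_prop) measurable_const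

namespace IsTreeNoise

theorem labelLaw_ae_pos [IsProbabilityMeasure P] (h : IsTreeNoise P ρ τ I W) :
    ∀ᵐ e ∂(labelLaw P ρ W : Measure (LabelNoise n)), 0 < e.1 := by
  have := h.isProbabilityMeasure_choiceLaw
  have := h.isProbabilityMeasure_pathLaw
  exact Measure.quasiMeasurePreserving_fst.ae (lifetimeLaw_ae_pos ρ)

theorem map_fst_labelLaw [IsProbabilityMeasure P] (h : IsTreeNoise P ρ τ I W) :
    (labelLaw P ρ W : Measure (LabelNoise n)).map Prod.fst = lifetimeLaw ρ := by
  have := h.isProbabilityMeasure_lifetimeLaw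
  have := h.isProbabilityMeasure_choiceLaw
  have := h.isProbabilityMeasure_pathLaw
  rw [labelLaw]
  exact Measure.map_fst_prod.trans (by simp)

theorem card_mechIdx_ne_zero [IsProbabilityMeasure P]
    (_h : IsTreeNoise P ρ τ I W) (c : Code n) :
    Fintype.card (MechIdx c) ≠ 0 := by
  obtain ⟨ω⟩ : Nonempty Ω := P.nonempty_of_neZero
  have : Nonempty (MechIdx c) := ⟨I c [] ω⟩
  exact Fintype.card_ne_zero

theorem lintegral_branch [IsProbabilityMeasure P] (h : IsTreeNoise P ρ τ I W) (hρ : Measurable ρ)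
    (hρ_pos : ∀ s, 0 < s → 0 < ρ s) (T t x : ℝ) (c : Code n) {g : MechIdx c × ℝ × ℝ → ℝ≥0∞}
    (hg : Measurable g) :
    ∫⁻ e in {e : LabelNoise n | t + e.1 < T}, ENNReal.ofReal (branchFactor ρ c e.1)
        * g (branchPoint t x c e) ∂(labelLaw P ρ W)
      = ∑ Z, ∫⁻ p, g (Z, p) ∂(kernelMeasure T t x) := by
  rw [← lintegral_indicator (measurableSet_dies T t)]
  set G : ℝ × MechIdx c × ℝ → ℝ≥0∞ := fun p => (Iio (T - t)).indicator 1 p.1 *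
    (ENNReal.ofReal (branchFactor ρ c p.1) * g (p.2.1, t + p.1, x + p.2.2)) with hG
  have hGm : Measurable G := by
    have h1 : Measurable fun p : ℝ × MechIdx c × ℝ => g (p.2.1, t + p.1, x + p.2.2) :=
      hg.comp (by fun_prop)
    exact ((measurable_one.indicator measurableSet_Iio).comp measurable_fst).mul
      (((measurable_branchFactor hρ c).ennreal_ofReal.comp measurable_fst).mul h1)
  have h1 : ∀ e : LabelNoise n, ({e : LabelNoise n | t + e.1 < T}).indicator
      (fun e => ENNReal.ofReal (branchFactor ρ c e.1) * g (branchPoint t x c e)) e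
      = G (e.1, e.2.1 c, pathEval e.2.2 e.1.toNNReal) := by
    intro e
    by_cases he : t + e.1 < T
    · have he' : e.1 < T - t := by linarith
      simp [hG, he, he', branchPoint, indicator]
    · have he' : ¬ e.1 < T - t := by intro h; apply he; linarith
      simp [hG, he, he', indicator]
  simp only [h1]
  rw [h.lintegral_labelLaw c measurable_real_toNNReal hGm, lifetimeLaw,
    lintegral_withDensity_eq_lintegral_mul_non_measurable _ hρ.ennreal_ofReal (by simp)]
  have hcard := h.card_mechIdx_ne_zero c
  have hmk (Z : MechIdx c) : Measurable fun p : ℝ × ℝ =>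
      ENNReal.ofReal (heatKernel (p.1 - t) (p.2 - x)) * g (Z, p) :=
    (measurable_heatKernel_sub t x).ennreal_ofReal.mul (hg.comp measurable_prodMk_left)
  calc _ = ∫⁻ s in Ioi 0, (Iio (T - t)).indicator 1 s * ∑ Z, ∫⁻ y,
          ENNReal.ofReal (heatKernel (t + s - t) (y - x)) * g (Z, t + s, y) := by
        refine setLIntegral_congr_fun measurableSet_Ioi fun s hs => ?_
        simp only [Pi.mul_apply, hG]
        have hs : 0 < s := hs
        have hgm (Z : MechIdx c) : Measurable fun y => g (Z, t + s, y) := hg.comp (by fun_prop)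
        have e1 (Z : MechIdx c) : ∫⁻ y, (Iio (T - t)).indicator 1 s *
            (ENNReal.ofReal (branchFactor ρ c s) * g (Z, t + s, x + y))
              ∂(gaussianReal 0 s.toNNReal) = (Iio (T - t)).indicator 1 s *
            (ENNReal.ofReal (branchFactor ρ c s) * ∫⁻ y,
              ENNReal.ofReal (heatKernel (t + s - t) (y - x)) * g (Z, t + s, y)) := by
          have hm2 : Measurable fun y => g (Z, t + s, x + y) := (hgm Z).comp (by fun_prop)
          rw [lintegral_const_mul _ (by fun_prop), lintegral_const_mul _ hm2,
            lintegral_gaussianReal hs x (hgm Z), add_sub_cancel_left]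
        simp only [e1, ← Finset.mul_sum]
        have e2 : ENNReal.ofReal (ρ s) * ((Fintype.card (MechIdx c) : ℝ≥0∞)⁻¹ *
            ENNReal.ofReal (branchFactor ρ c s)) = 1 := by
          have e3 : (Fintype.card (MechIdx c) : ℝ≥0∞)⁻¹ =
              ENNReal.ofReal ((Fintype.card (MechIdx c) : ℝ)⁻¹) := by
            rw [ENNReal.ofReal_inv_of_pos (by positivity), ENNReal.ofReal_natCast]
          have hρs := hρ_pos s hs
          rw [e3, ← ENNReal.ofReal_mul (by positivity), ← ENNReal.ofReal_mul hρs.le,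
            ← ENNReal.ofReal_one]
          congr 1
          unfold branchFactor
          field_simp
        set S := ∑ Z, ∫⁻ y, ENNReal.ofReal (heatKernel (t + s - t) (y - x)) * g (Z, t + s, y)
        calc _ = (ENNReal.ofReal (ρ s) * ((Fintype.card (MechIdx c) : ℝ≥0∞)⁻¹ *
            ENNReal.ofReal (branchFactor ρ c s))) * ((Iio (T - t)).indicator 1 s * S) := by ring
          _ = _ := by rw [e2, one_mul]
    _ = ∫⁻ s, (Ioo t T).indicator (fun s => ∑ Z, ∫⁻ y,
          ENNReal.ofReal (heatKernel (s - t) (y - x)) * g (Z, s, y)) s := by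
        rw [← lintegral_indicator measurableSet_Ioi, ← lintegral_add_left_eq_self (μ := volume)
          ((Ioo t T).indicator _) t]
        refine lintegral_congr fun s => ?_
        by_cases h1 : 0 < s
        · by_cases h2 : s < T - t
          · have : t + s < T := by linarith
            simp [indicator, h1, h2, this]
          · have : ¬ t + s < T := by intro h; apply h2; linarith
            simp [indicator, h2, this]
        · simp [indicator, h1]
    _ = ∫⁻ s in Ioc t T, ∑ Z, ∫⁻ y,
          ENNReal.ofReal (heatKernel (s - t) (y - x)) * g (Z, s, y) := by
        rw [lintegral_indicator measurableSet_Ioo]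
        exact setLIntegral_congr Ioo_ae_eq_Ioc
    _ = ∑ Z, ∫⁻ s in Ioc t T, ∫⁻ y,
          ENNReal.ofReal (heatKernel (s - t) (y - x)) * g (Z, s, y) := by
        rw [lintegral_finsetSum _ fun Z _ => (hmk Z).lintegral_prod_right']
    _ = _ := by
        refine Finset.sum_congr rfl fun Z _ => ?_
        rw [kernelMeasure, lintegral_withDensity_eq_lintegral_mul_non_measurable _
          (measurable_heatKernel_sub t x).ennreal_ofReal (by simp)]
        exact (lintegral_prod _ (hmk Z).aemeasurable).symm

/-- The law of the branching point of the root, weighted by the factor of the root. -/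
theorem map_branchPoint [IsProbabilityMeasure P] (h : IsTreeNoise P ρ τ I W) (hρ : Measurable ρ)
    (hρ_pos : ∀ s, 0 < s → 0 < ρ s) (T t x : ℝ) (c : Code n) :
    (((labelLaw P ρ W).restrict {e : LabelNoise n | t + e.1 < T}).withDensity
      fun e => ENNReal.ofReal (branchFactor ρ c e.1)).map (branchPoint t x c)
      = Measure.count.prod (kernelMeasure T t x) := by
  refine Measure.ext_of_lintegral _ fun g hg => ?_
  rw [lintegral_map hg (measurable_branchPoint t x c),
    lintegral_withDensity_eq_lintegral_mul_non_measurable _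
      (measurable_rootFactor hρ c) (by simp),
    lintegral_prod _ hg.aemeasurable, lintegral_count, tsum_fintype,
    ← h.lintegral_branch hρ hρ_pos T t x c hg]
  rfl

theorem integrable_branch_iff [IsProbabilityMeasure P] (h : IsTreeNoise P ρ τ I W)
    (hρ : Measurable ρ) (hρ_pos : ∀ s, 0 < s → 0 < ρ s) (T t x : ℝ) (c : Code n)
    {b : MechIdx c × ℝ × ℝ → ℝ} (hb : Measurable b) :
    IntegrableOn (fun e => branchFactor ρ c e.1 * b (branchPoint t x c e))
        {e : LabelNoise n | t + e.1 < T} (labelLaw P ρ W)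
      ↔ ∀ Z, Integrable (fun p => b (Z, p)) (kernelMeasure T t x) := by
  have h1 : (∀ Z, Integrable (fun p => b (Z, p)) (kernelMeasure T t x)) ↔
      Integrable b (Measure.count.prod (kernelMeasure T t x)) := by
    rw [integrable_prod_iff hb.aestronglyMeasurable]
    have : (∀ᵐ Z ∂(Measure.count : Measure (MechIdx c)),
        Integrable (fun p => b (Z, p)) (kernelMeasure T t x)) ↔
        ∀ Z, Integrable (fun p => b (Z, p)) (kernelMeasure T t x) := by
      rw [ae_iff, Measure.count_eq_zero_iff, Set.eq_empty_iff_forall_notMem]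
      simp
    rw [this, integrable_count_iff]
    exact ⟨fun h => ⟨h, (hasSum_fintype _).summable⟩, fun h => h.1⟩
  rw [h1, ← h.map_branchPoint hρ hρ_pos, integrable_map_measure hb.aestronglyMeasurable
    (measurable_branchPoint t x c).aemeasurable, integrable_withDensity_iff_integrable_smul'
    (measurable_rootFactor hρ c) (by simp)]
  refine integrable_congr ?_
  filter_upwards [ae_restrict_of_ae h.labelLaw_ae_pos] with e he
  simp [ENNReal.toReal_ofReal (branchFactor_nonneg hρ_pos c he)]

theorem integral_branch [IsProbabilityMeasure P] (h : IsTreeNoise P ρ τ I W)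
    (hρ : Measurable ρ) (hρ_pos : ∀ s, 0 < s → 0 < ρ s) (T t x : ℝ) (c : Code n)
    {b : MechIdx c × ℝ × ℝ → ℝ} (hb : Measurable b)
    (hi : ∀ Z, Integrable (fun p => b (Z, p)) (kernelMeasure T t x)) :
    ∫ e in {e : LabelNoise n | t + e.1 < T}, branchFactor ρ c e.1 * b (branchPoint t x c e)
        ∂(labelLaw P ρ W)
      = ∑ Z, ∫ p, b (Z, p) ∂(kernelMeasure T t x) := by
  have hint : Integrable b (Measure.count.prod (kernelMeasure T t x)) := by
    rw [integrable_prod_iff hb.aestronglyMeasurable, integrable_count_iff]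
    exact ⟨.of_forall hi, (hasSum_fintype _).summable⟩
  rw [← integral_count, ← integral_prod _ hint, ← h.map_branchPoint hρ hρ_pos,
    integral_map (measurable_branchPoint t x c).aemeasurable hb.aestronglyMeasurable,
    integral_withDensity_eq_integral_toReal_smul
      (measurable_rootFactor hρ c) (by simp)]
  refine integral_congr_ae ?_
  filter_upwards [ae_restrict_of_ae h.labelLaw_ae_pos] with e he
  simp [ENNReal.toReal_ofReal (branchFactor_nonneg hρ_pos c he)]

/-- The law of the position at time `T` of a root that survives up to time `T`. -/
theorem map_survival [IsProbabilityMeasure P] (h : IsTreeNoise P ρ τ I W) (hρ : Measurable ρ)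
    (hρ_pos : ∀ s, 0 < s → 0 < ρ s) {T t : ℝ} (ht : t < T) (x : ℝ) :
    ((labelLaw P ρ W).restrict {e : LabelNoise n | t + e.1 < T}ᶜ).map
        (fun e => x + pathEval e.2.2 (T - t).toNNReal)
      = ENNReal.ofReal (tail ρ (T - t)) •
          volume.withDensity fun y => ENNReal.ofReal (heatKernel (T - t) (y - x)) := by
  have := h.isProbabilityMeasure_lifetimeLaw
  have hm : Measurable fun e : LabelNoise n => x + pathEval e.2.2 (T - t).toNNReal :=
    measurable_const.add (Measurable.pathEval (measurable_snd.comp measurable_snd) measurable_const)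
  refine Measure.ext_of_lintegral _ fun g hg => ?_
  rw [lintegral_map hg hm, ← lintegral_indicator (measurableSet_dies T t).compl,
    lintegral_smul_measure, lintegral_withDensity_eq_lintegral_mul_non_measurable _
      (by unfold heatKernel; fun_prop) (by simp), smul_eq_mul]
  set G : ℝ × MechIdx (Code.id : Code n) × ℝ → ℝ≥0∞ := fun p =>
    (Ici (T - t)).indicator 1 p.1 * g (x + p.2.2) with hG
  have hGm : Measurable G := ((measurable_one.indicator measurableSet_Ici).comp measurable_fst).mul
    (hg.comp (by fun_prop))
  have h1 : ∀ e : LabelNoise n, ({e : LabelNoise n | t + e.1 < T}ᶜ).indicator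
      (fun e => g (x + pathEval e.2.2 (T - t).toNNReal)) e
      = G (e.1, e.2.1 Code.id, pathEval e.2.2 ((fun _ => (T - t).toNNReal) e.1)) := by
    intro e
    by_cases he : t + e.1 < T
    · have he' : ¬ T - t ≤ e.1 := by intro h; linarith
      rw [indicator_of_notMem (by simpa using he), hG]
      simp only [indicator_of_notMem (show e.1 ∉ Ici (T - t) from he'), zero_mul]
    · have he' : T - t ≤ e.1 := by linarith
      rw [indicator_of_mem (by simpa using he), hG]
      simp only [indicator_of_mem (show e.1 ∈ Ici (T - t) from he'), Pi.one_apply, one_mul]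
  simp only [h1]
  rw [h.lintegral_labelLaw Code.id measurable_const hGm]
  have hone : Fintype.card (MechIdx (Code.id : Code n)) = 1 := rfl
  have hgm : Measurable fun y => g (x + y) := by fun_prop
  simp only [hG, hone, Nat.cast_one, inv_one, one_mul, lintegral_const_mul _ hgm,
    lintegral_gaussianReal (sub_pos.2 ht) x hg, Finset.sum_const, Finset.card_univ, one_smul]
  rw [lintegral_mul_const _ (measurable_one.indicator measurableSet_Ici),
    lintegral_indicator_one measurableSet_Ici, lifetimeLaw_Ici hρ hρ_pos (sub_nonneg.2 ht.le)]
  rfl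

theorem integrable_survival_iff [IsProbabilityMeasure P] (h : IsTreeNoise P ρ τ I W)
    (hρ : Measurable ρ) (hρ_pos : ∀ s, 0 < s → 0 < ρ s) {T t : ℝ} (ht : t < T) (x : ℝ)
    {a : ℝ → ℝ} (ha : Measurable a) :
    IntegrableOn (fun e : LabelNoise n => a (x + pathEval e.2.2 (T - t).toNNReal) / tail ρ (T - t))
        {e : LabelNoise n | t + e.1 < T}ᶜ (labelLaw P ρ W)
      ↔ Integrable fun y => heatKernel (T - t) (y - x) * a y := by
  have := h.isProbabilityMeasure_lifetimeLaw
  have htail := tail_pos hρ hρ_pos (sub_nonneg.2 ht.le)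
  have hm : Measurable fun e : LabelNoise n => x + pathEval e.2.2 (T - t).toNNReal :=
    measurable_const.add (Measurable.pathEval (measurable_snd.comp measurable_snd) measurable_const)
  rw [IntegrableOn]
  have h1 := integrable_map_measure
    (μ := (labelLaw P ρ W).restrict {e : LabelNoise n | t + e.1 < T}ᶜ)
    (g := fun y => a y / tail ρ (T - t)) (ha.div_const _).aestronglyMeasurable hm.aemeasurable
  refine h1.symm.trans ?_
  rw [h.map_survival hρ hρ_pos ht, integrable_smul_measure (by simpa using htail) (by simp),
    integrable_withDensity_iff_integrable_smul' (by unfold heatKernel; fun_prop) (by simp)]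
  simp only [ENNReal.toReal_ofReal (heatKernel_nonneg _ _), smul_eq_mul, ← mul_div_assoc]
  constructor
  · intro hh
    refine (hh.mul_const (tail ρ (T - t))).congr (.of_forall fun y => ?_)
    field_simp
  · exact fun hh => hh.div_const _

theorem integral_survival [IsProbabilityMeasure P] (h : IsTreeNoise P ρ τ I W)
    (hρ : Measurable ρ) (hρ_pos : ∀ s, 0 < s → 0 < ρ s) {T t : ℝ} (ht : t < T) (x : ℝ)
    {a : ℝ → ℝ} (ha : Measurable a) :
    ∫ e in {e : LabelNoise n | t + e.1 < T}ᶜ,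
        a (x + pathEval e.2.2 (T - t).toNNReal) / tail ρ (T - t) ∂(labelLaw P ρ W)
      = ∫ y, heatKernel (T - t) (y - x) * a y := by
  have := h.isProbabilityMeasure_lifetimeLaw
  have htail := tail_pos hρ hρ_pos (sub_nonneg.2 ht.le)
  have hm : Measurable fun e : LabelNoise n => x + pathEval e.2.2 (T - t).toNNReal :=
    measurable_const.add (Measurable.pathEval (measurable_snd.comp measurable_snd) measurable_const)
  have h1 := integral_map
    (μ := (labelLaw P ρ W).restrict {e : LabelNoise n | t + e.1 < T}ᶜ) hm.aemeasurable
    (f := fun y => a y / tail ρ (T - t)) (ha.div_const _).aestronglyMeasurable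
  refine h1.symm.trans ?_
  rw [h.map_survival hρ hρ_pos ht, integral_smul_measure,
    integral_withDensity_eq_integral_toReal_smul (by unfold heatKernel; fun_prop) (by simp),
    ENNReal.toReal_ofReal htail.le, ← integral_smul]
  refine integral_congr_ae (.of_forall fun y => ?_)
  simp only [ENNReal.toReal_ofReal (heatKernel_nonneg _ _), smul_eq_mul]
  field_simp

end IsTreeNoise

end

/-! ### The means of the tree functionals solve the system -/

section

variable {n : ℕ} {Ω : Type*} [MeasurableSpace Ω] {P : Measure Ω}
  {ρ : ℝ → ℝ} {τ : Label → Ω → ℝ} {I : (c : Code n) → Label → Ω → MechIdx c}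
  {W : Label → ℝ≥0 → Ω → ℝ}
  {T : ℝ} {f : (Fin (n + 1) → ℝ) → ℝ} {u : ℝ → ℝ → ℝ}

namespace IsTreeNoise

/-- Almost surely, all paths are continuous, and regularizing them changes nothing. -/
theorem ae_regNoise_toNoise (h : IsTreeNoise P ρ τ I W) :
    ∀ᵐ ω ∂P, regNoise (toNoise τ I W ω) = toNoise τ I W ω := by
  filter_upwards [ae_all_iff.2 fun k => (h.brownian k).cont] with ω hω
  funext k
  simp [regNoise, toNoise, pathEval_eq_of_continuous (hω k)]

variable [IsProbabilityMeasure P]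

theorem measurable_regFunctional (hρ : Measurable ρ) (hev : ∀ c : Code n, Measurable (c.eval f u T))
    (t x : ℝ) (c : Code n) :
    Measurable fun θ : Noise n => noiseFunctional T f u ρ (regNoise θ) t x c :=
  (measurable_noiseFunctional hρ hev c).comp
    (measurable_const.prodMk (measurable_const.prodMk measurable_id))

theorem integrable_regFunctional (h : IsTreeNoise P ρ τ I W) (hρ : Measurable ρ)
    (hev : ∀ c : Code n, Measurable (c.eval f u T)) {t x : ℝ} {c : Code n}
    (hint : Integrable (randomFunctional T f u ρ τ I W t x c) P) :
    Integrable (fun θ => noiseFunctional T f u ρ (regNoise θ) t x c)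
      (noiseLaw (labelLaw P ρ W)) := by
  rw [noiseLaw, ← h.map_toNoise, integrable_map_measure
    (measurable_regFunctional hρ hev t x c).aestronglyMeasurable
    h.measurable_toNoise.aemeasurable]
  refine hint.congr ?_
  filter_upwards [h.ae_regNoise_toNoise] with ω hω
  rw [Function.comp_apply, hω]
  rfl

theorem integral_randomFunctional (h : IsTreeNoise P ρ τ I W) (hρ : Measurable ρ)
    (hev : ∀ c : Code n, Measurable (c.eval f u T)) (t x : ℝ) (c : Code n) :
    ∫ ω, randomFunctional T f u ρ τ I W t x c ω ∂P
      = ∫ θ, noiseFunctional T f u ρ (regNoise θ) t x c ∂(noiseLaw (labelLaw P ρ W)) := by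
  rw [noiseLaw, ← h.map_toNoise, integral_map h.measurable_toNoise.aemeasurable
    (measurable_regFunctional hρ hev t x c).aestronglyMeasurable]
  refine integral_congr_ae ?_
  filter_upwards [h.ae_regNoise_toNoise] with ω hω
  rw [hω]
  rfl

end IsTreeNoise

variable [IsProbabilityMeasure P]

/-- Integration of a product over the children of the root. -/
theorem integral_prod_children {ν : Measure (LabelNoise n)} [IsProbabilityMeasure ν]
    (l : List (Code n)) {F : Code n → Noise n → ℝ} (hF : ∀ c, Measurable (F c)) :
    ∫ η, ∏ i : Fin l.length, F l[i] (η i) ∂(Measure.infinitePi fun _ : ℕ => noiseLaw ν)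
      = (l.map fun c => ∫ θ, F c θ ∂(noiseLaw ν)).prod := by
  have hind : iIndepFun (fun (i : Fin l.length) (η : ℕ → Noise n) => η i)
      (Measure.infinitePi fun _ : ℕ => noiseLaw ν) :=
    (iIndepFun_infinitePi (P := fun _ : ℕ => noiseLaw ν) (X := fun _ x => x)
      fun _ => measurable_id).precomp Fin.val_injective
  rw [hind.integral_fun_prod_comp (f := fun i => F l[i])
    (fun i => (measurable_pi_apply _).aemeasurable) fun i => (hF _).aestronglyMeasurable,
    ← Fin.prod_univ_fun_getElem]
  refine Finset.prod_congr rfl fun i _ => ?_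
  have hmp := measurePreserving_eval_infinitePi (fun _ : ℕ => noiseLaw ν) (i : ℕ)
  have := integral_map hmp.measurable.aemeasurable (f := F l[i]) (by
    rw [hmp.map_eq]; exact (hF _).aestronglyMeasurable)
  rw [hmp.map_eq] at this
  exact this.symm

/-- The functional of the tree, in terms of the noise at the root and in the subtrees. -/
def splitFunctional (T : ℝ) (f : (Fin (n + 1) → ℝ) → ℝ) (u : ℝ → ℝ → ℝ) (ρ : ℝ → ℝ) (t x : ℝ)
    (c : Code n) (p : LabelNoise n × (ℕ → Noise n)) : ℝ :=
  if t + p.1.1 < T then branchFactor ρ c p.1.1 * ∏ i : Fin (mech c (p.1.2.1 c)).length,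
    noiseFunctional T f u ρ (regNoise (p.2 i)) (t + p.1.1)
      (x + pathEval p.1.2.2 p.1.1.toNNReal) (mech c (p.1.2.1 c))[i]
  else c.eval f u T (x + pathEval p.1.2.2 (T - t).toNNReal) / tail ρ (T - t)

theorem measurable_splitFunctional (hρ : Measurable ρ)
    (hev : ∀ c : Code n, Measurable (c.eval f u T)) (t x : ℝ) (c : Code n) :
    Measurable (splitFunctional T f u ρ t x c) := by
  have hpath : Measurable fun p : LabelNoise n × (ℕ → Noise n) => p.1.2.2 :=
    measurable_snd.comp (measurable_snd.comp measurable_fst)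
  refine Measurable.ite (measurableSet_lt (by fun_prop) measurable_const) ?_ ?_
  · refine ((measurable_branchFactor hρ c).comp (by fun_prop)).mul ?_
    refine measurable_choice_case (Z := fun p : LabelNoise n × (ℕ → Noise n) => p.1.2.1 c)
      (G := fun Z p => ∏ i : Fin (mech c Z).length, noiseFunctional T f u ρ (regNoise (p.2 i))
        (t + p.1.1) (x + pathEval p.1.2.2 p.1.1.toNNReal) (mech c Z)[i]) (by fun_prop) fun Z => ?_
    refine Finset.measurable_prod _ fun i _ => ?_
    exact (measurable_noiseFunctional hρ hev _).comp (Measurable.prodMk (by fun_prop)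
      (Measurable.prodMk (measurable_const.add (Measurable.pathEval hpath
        (measurable_real_toNNReal.comp (by fun_prop)))) (by fun_prop)))
  · exact ((hev c).comp
      (measurable_const.add (Measurable.pathEval hpath measurable_const))).div_const _

/-- The product `∏_{z ∈ Z} v_z(s,y)` over a tuple of `M(c)`, as a function of the index of `Z` and
of the point `(s,y)`. -/
def tupleProd (v : Code n → ℝ → ℝ → ℝ) (c : Code n) (p : MechIdx c × ℝ × ℝ) : ℝ :=
  ((mech c p.1).map fun z => v z p.2.1 p.2.2).prod

theorem measurable_tupleProd {v : Code n → ℝ → ℝ → ℝ}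
    (hv : ∀ z, Measurable fun p : ℝ × ℝ => v z p.1 p.2) (c : Code n) :
    Measurable (tupleProd v c) := by
  refine measurable_from_prod_countable_right fun Z => ?_
  simp only [tupleProd]
  induction mech c Z with
  | nil => exact measurable_const
  | cons z l ih =>
    simp only [List.map_cons, List.prod_cons]
    exact (hv z).mul ih

namespace IsTreeNoise

theorem ae_noiseFunctional_eq (h : IsTreeNoise P ρ τ I W) {t : ℝ} (ht : t ≤ T) (x : ℝ)
    (c : Code n) : ∀ᵐ θ ∂(noiseLaw (labelLaw P ρ W)),
      noiseFunctional T f u ρ (regNoise θ) t x c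
        = splitFunctional T f u ρ t x c (θ [], subNoise θ) := by
  have := h.isProbabilityMeasure_lifetimeLaw
  have := h.isProbabilityMeasure_labelLaw
  filter_upwards [ae_finite_particleLabels h.map_fst_labelLaw ht x c] with θ hθ
  rw [noiseFunctional_eq hθ]
  rfl

/-- The branching property: conditionally on the noise at the root, the functional is the product
of independent functionals of trees started at the branching point. -/
theorem branching (h : IsTreeNoise P ρ τ I W) (hρ : Measurable ρ)
    (hρ_pos : ∀ s, 0 < s → 0 < ρ s)
    (hev : ∀ c : Code n, Measurable (c.eval f u T)) {t x : ℝ} (ht : t < T) {c : Code n}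
    (hint : Integrable (randomFunctional T f u ρ τ I W t x c) P) :
    (Integrable fun y => heatKernel (T - t) (y - x) * c.eval f u T y) ∧
    (∀ Z, Integrable (fun p : ℝ × ℝ => tupleProd
      (fun c t x => ∫ ω, randomFunctional T f u ρ τ I W t x c ω ∂P) c (Z, p))
        (kernelMeasure T t x)) ∧
    ∫ ω, randomFunctional T f u ρ τ I W t x c ω ∂P
      = (∫ y, heatKernel (T - t) (y - x) * c.eval f u T y) + ∑ Z, ∫ p, tupleProd
        (fun c t x => ∫ ω, randomFunctional T f u ρ τ I W t x c ω ∂P) c (Z, p)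
          ∂(kernelMeasure T t x) := by
  have := h.isProbabilityMeasure_lifetimeLaw
  have := h.isProbabilityMeasure_labelLaw
  simp only [h.integral_randomFunctional hρ hev]
  set ν : Measure (LabelNoise n) := labelLaw P ρ W
  set U : Code n → ℝ → ℝ → ℝ := fun c t x =>
    ∫ θ, noiseFunctional T f u ρ (regNoise θ) t x c ∂(noiseLaw ν) with hU
  set V : Code n → ℝ → ℝ → ℝ := fun c t x =>
    ∫ θ, ‖noiseFunctional T f u ρ (regNoise θ) t x c‖ ∂(noiseLaw ν) with hV
  have hjoint (z : Code n) : Measurable fun q : (ℝ × ℝ) × Noise n =>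
      noiseFunctional T f u ρ (regNoise q.2) q.1.1 q.1.2 z :=
    (measurable_noiseFunctional hρ hev z).comp
      (f := fun q : (ℝ × ℝ) × Noise n => (q.1.1, q.1.2, q.2)) (by fun_prop)
  have hUm (z : Code n) : Measurable fun p : ℝ × ℝ => U z p.1 p.2 :=
    (hjoint z).stronglyMeasurable.integral_prod_right.measurable
  have hVm (z : Code n) : Measurable fun p : ℝ × ℝ => V z p.1 p.2 :=
    (hjoint z).norm.stronglyMeasurable.integral_prod_right.measurable
  -- the means `V` of the absolute values dominate `U`, and their products are the inner integrals
  -- of the absolute value of the functional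
  have hUV (z : Code n) (s y : ℝ) : |U z s y| ≤ V z s y :=
    norm_integral_le_integral_norm (fun θ => noiseFunctional T f u ρ (regNoise θ) s y z)
  -- integrability with respect to the split noise
  have hsplit : Integrable (splitFunctional T f u ρ t x c)
      (ν.prod (Measure.infinitePi fun _ : ℕ => noiseLaw ν)) := by
    rw [← measurePreserving_split.integrable_comp
      (measurable_splitFunctional hρ hev t x c).aestronglyMeasurable]
    refine (h.integrable_regFunctional hρ hev hint).congr ?_
    exact h.ae_noiseFunctional_eq ht.le x c
  have hdies := measurableSet_dies (n := n) T t
  set a : ℝ → ℝ := fun y => c.eval f u T y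
  have hinner (e : LabelNoise n) :
      ∫ η, splitFunctional T f u ρ t x c (e, η) ∂(Measure.infinitePi fun _ : ℕ => noiseLaw ν)
        = if t + e.1 < T then branchFactor ρ c e.1 * tupleProd U c (branchPoint t x c e)
          else a (x + pathEval e.2.2 (T - t).toNNReal) / tail ρ (T - t) := by
    by_cases he : t + e.1 < T
    · simp only [splitFunctional, he, if_true]
      rw [integral_const_mul]
      congr 1
      exact integral_prod_children (mech c (e.2.1 c)) (F := fun z θ => noiseFunctional T f u ρ
        (regNoise θ) (t + e.1) (x + pathEval e.2.2 e.1.toNNReal) z)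
        fun z => measurable_regFunctional hρ hev _ _ z
    · simp only [splitFunctional, he, if_false]
      rw [integral_const, probReal_univ, one_smul]
  have hinner' (e : LabelNoise n) :
      ∫ η, ‖splitFunctional T f u ρ t x c (e, η)‖ ∂(Measure.infinitePi fun _ : ℕ => noiseLaw ν)
        = if t + e.1 < T then |branchFactor ρ c e.1| * tupleProd V c (branchPoint t x c e)
          else |a (x + pathEval e.2.2 (T - t).toNNReal) / tail ρ (T - t)| := by
    by_cases he : t + e.1 < T
    · simp only [splitFunctional, he, if_true, norm_mul, norm_prod]
      rw [integral_const_mul]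
      congr 1
      exact integral_prod_children (mech c (e.2.1 c)) (F := fun z θ => ‖noiseFunctional T f u ρ
        (regNoise θ) (t + e.1) (x + pathEval e.2.2 e.1.toNNReal) z‖)
        fun z => (measurable_regFunctional hρ hev _ _ z).norm
    · simp only [splitFunctional, he, if_false]
      rw [integral_const, probReal_univ, one_smul]
      rfl
  have hnorm := hsplit.integral_norm_prod_left
  simp only [hinner'] at hnorm
  have hVint : ∀ Z, Integrable (fun p => tupleProd V c (Z, p)) (kernelMeasure T t x) := by
    rw [← h.integrable_branch_iff hρ hρ_pos T t x c (measurable_tupleProd hVm c)]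
    refine (hnorm.integrableOn (s := {e : LabelNoise n | t + e.1 < T})).congr_fun_ae ?_
    filter_upwards [ae_restrict_mem hdies, ae_restrict_of_ae h.labelLaw_ae_pos] with e he he'
    rw [if_pos he, abs_of_nonneg (branchFactor_nonneg hρ_pos c he')]
  have hUint : ∀ Z, Integrable (fun p => tupleProd U c (Z, p)) (kernelMeasure T t x) := by
    intro Z
    refine (hVint Z).mono' ((measurable_tupleProd hUm c).comp
      measurable_prodMk_left).aestronglyMeasurable (.of_forall fun p => ?_)
    simp only [tupleProd]
    induction mech c Z with
    | nil => simp
    | cons z l ih =>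
      simp only [List.map_cons, List.prod_cons, norm_mul]
      exact mul_le_mul (hUV _ _ _) ih (norm_nonneg _) ((abs_nonneg _).trans (hUV _ _ _))
  have hA : Integrable fun y => heatKernel (T - t) (y - x) * a y := by
    rw [← h.integrable_survival_iff hρ hρ_pos ht x (hev c)]
    have h1 := hsplit.integral_prod_left
    simp only [hinner] at h1
    refine (h1.integrableOn (s := {e : LabelNoise n | t + e.1 < T}ᶜ)).congr_fun_ae ?_
    filter_upwards [ae_restrict_mem hdies.compl] with e he
    exact if_neg he
  refine ⟨hA, hUint, ?_⟩
  have hmean : U c t x = ∫ e, (if t + e.1 < T then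
      branchFactor ρ c e.1 * tupleProd U c (branchPoint t x c e)
      else a (x + pathEval e.2.2 (T - t).toNNReal) / tail ρ (T - t)) ∂ν := by
    have hmp := measurePreserving_split (ν := ν)
    simp only [hU]
    rw [integral_congr_ae (h.ae_noiseFunctional_eq ht.le x c)]
    have h2 := integral_map (μ := noiseLaw ν) hmp.measurable.aemeasurable
      (f := splitFunctional T f u ρ t x c)
      (measurable_splitFunctional hρ hev t x c).aestronglyMeasurable
    rw [hmp.map_eq, integral_prod _ hsplit] at h2
    rw [← h2]
    exact integral_congr_ae (.of_forall hinner)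
  change U c t x = _
  have hint1 := hsplit.integral_prod_left
  simp only [hinner] at hint1
  rw [hmean, ← integral_add_compl hdies hint1, add_comm]
  congr 1
  · rw [← h.integral_survival hρ hρ_pos ht x (hev c)]
    exact setIntegral_congr_fun hdies.compl fun e he => if_neg he
  · rw [← h.integral_branch hρ hρ_pos T t x c (measurable_tupleProd hUm c) hUint]
    exact setIntegral_congr_fun hdies fun e he => if_pos he

theorem integral_randomFunctional_terminal (h : IsTreeNoise P ρ τ I W) (hρ : Measurable ρ)
    (hρ_pos : ∀ s, 0 < s → 0 < ρ s) (hev : ∀ c : Code n, Measurable (c.eval f u T)) (x : ℝ)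
    (c : Code n) :
    ∫ ω, randomFunctional T f u ρ τ I W T x c ω ∂P = c.eval f u T x := by
  have := h.isProbabilityMeasure_lifetimeLaw
  have := h.isProbabilityMeasure_choiceLaw
  have := h.isProbabilityMeasure_pathLaw
  have := h.isProbabilityMeasure_labelLaw
  rw [h.integral_randomFunctional hρ hev]
  have h0 : ∀ᵐ e ∂(labelLaw P ρ W : Measure (LabelNoise n)), pathEval e.2.2 0 = 0 := by
    have h1 : ∀ᵐ w ∂(pathLaw P W), pathEval w 0 = 0 := by
      have h2 := h.map_pathEval 0
      rw [gaussianReal_zero_var] at h2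
      have hm : Measurable fun w : ℝ≥0 → ℝ => pathEval w 0 :=
        Measurable.pathEval measurable_id measurable_const
      refine (ae_map_iff (p := fun y => y = 0) hm.aemeasurable (measurableSet_singleton 0)).1 ?_
      rw [h2]
      exact (ae_dirac_iff (p := fun y : ℝ => y = 0) (measurableSet_singleton 0)).2 rfl
    exact Measure.quasiMeasurePreserving_snd.ae (Measure.quasiMeasurePreserving_snd.ae h1)
  have hroot := (measurePreserving_eval_infinitePi
    (fun _ : Label => (labelLaw P ρ W : Measure (LabelNoise n))) []).quasiMeasurePreserving
  have key : ∀ᵐ θ ∂(noiseLaw (labelLaw P ρ W)),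
      noiseFunctional T f u ρ (regNoise θ) T x c = c.eval f u T x := by
    filter_upwards [h.ae_noiseFunctional_eq (f := f) (u := u) le_rfl x c, hroot.ae h0,
      hroot.ae h.labelLaw_ae_pos] with θ h1 h2 h3
    simp only [Function.eval] at h2 h3
    rw [h1, splitFunctional, if_neg (by simpa using h3.le)]
    simp [h2, tail_zero hρ hρ_pos]
  rw [integral_congr_ae key, integral_const, probReal_univ, one_smul]

/-- The means of the tree functionals solve the system. -/
theorem isSystemSolution (h : IsTreeNoise P ρ τ I W) (hρ : Measurable ρ)
    (hρ_pos : ∀ s, 0 < s → 0 < ρ s) (hev : ∀ c : Code n, Measurable (c.eval f u T))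
    (hint : ∀ c : Code n, ∀ t ∈ Icc 0 T, ∀ x : ℝ,
      Integrable (randomFunctional T f u ρ τ I W t x c) P) :
    IsSystemSolution T f u (fun c t x => ∫ ω, randomFunctional T f u ρ τ I W t x c ω ∂P) where
  terminal c x := h.integral_randomFunctional_terminal hρ hρ_pos hev x c
  integrable_terminal c t ht x :=
    (h.branching hρ hρ_pos hev ht.2 (hint c t ⟨ht.1, ht.2.le⟩ x)).1
  integrable_source c t ht x Z := integrable_kernelMeasure_iff.1
    ((h.branching hρ hρ_pos hev ht.2 (hint c t ⟨ht.1, ht.2.le⟩ x)).2.1 Z)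
  equation c t ht x := by
    obtain ⟨-, h1, h2⟩ := h.branching hρ hρ_pos hev ht.2 (hint c t ⟨ht.1, ht.2.le⟩ x)
    rw [h2]
    congr 1
    exact Finset.sum_congr rfl fun Z _ => integral_kernelMeasure ht.2.le (h1 Z)

end IsTreeNoise

end

/-! ### Partial derivatives of smooth functions -/

section Partial

variable {n : ℕ} {h : (Fin (n + 1) → ℝ) → ℝ}

theorem contDiff_partialZ (i : Fin (n + 1)) (hh : ContDiff ℝ (⊤ : ℕ∞) h) :
    ContDiff ℝ (⊤ : ℕ∞) (partialZ i h) :=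
  (hh.fderiv_right (m := (⊤ : ℕ∞)) (by simp)).clm_apply contDiff_const

theorem partialZ_comm (i j : Fin (n + 1)) (hh : ContDiff ℝ (⊤ : ℕ∞) h) :
    partialZ i (partialZ j h) = partialZ j (partialZ i h) := by
  funext z
  have hd : DifferentiableAt ℝ (fderiv ℝ h) z :=
    ((hh.fderiv_right (m := (⊤ : ℕ∞)) (by simp)).differentiable (by simp)) z
  have key (a b : Fin (n + 1)) : partialZ a (partialZ b h) z =
      fderiv ℝ (fderiv ℝ h) z (Pi.single a 1) (Pi.single b 1) := by
    unfold partialZ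
    rw [fderiv_clm_apply hd (differentiableAt_const _)]
    simp
  rw [key, key]
  exact (hh.contDiffAt.isSymmSndFDerivAt (by
    rw [minSmoothness_of_isRCLikeNormedField]
    exact WithTop.coe_le_coe.2 (le_top : (2 : ℕ∞) ≤ ⊤))).eq _ _

theorem contDiff_iterate_partialZ (i : Fin (n + 1)) (m : ℕ) (hh : ContDiff ℝ (⊤ : ℕ∞) h) :
    ContDiff ℝ (⊤ : ℕ∞) ((partialZ i)^[m] h) := by
  induction m with
  | zero => exact hh
  | succ m ih => rw [Function.iterate_succ_apply']; exact contDiff_partialZ i ih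

theorem partialZ_iterate_comm (i j : Fin (n + 1)) (m : ℕ) (hh : ContDiff ℝ (⊤ : ℕ∞) h) :
    partialZ i ((partialZ j)^[m] h) = (partialZ j)^[m] (partialZ i h) := by
  induction m with
  | zero => rfl
  | succ m ih =>
    rw [Function.iterate_succ_apply', partialZ_comm _ _ (contDiff_iterate_partialZ j m hh), ih,
      Function.iterate_succ_apply']

theorem contDiff_foldr_partialZ (α : Fin (n + 1) → ℕ) (l : List (Fin (n + 1)))
    (hh : ContDiff ℝ (⊤ : ℕ∞) h) :
    ContDiff ℝ (⊤ : ℕ∞) (l.foldr (fun i g => (partialZ i)^[α i] g) h) := by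
  induction l with
  | nil => exact hh
  | cons j l ih => exact contDiff_iterate_partialZ j _ ih

theorem contDiff_mixedPartial (α : Fin (n + 1) → ℕ) (hh : ContDiff ℝ (⊤ : ℕ∞) h) :
    ContDiff ℝ (⊤ : ℕ∞) (mixedPartial α h) := contDiff_foldr_partialZ α _ hh

theorem mixedPartial_partialZ (α : Fin (n + 1) → ℕ) (i : Fin (n + 1))
    (hh : ContDiff ℝ (⊤ : ℕ∞) h) :
    mixedPartial α (partialZ i h) = partialZ i (mixedPartial α h) := by
  unfold mixedPartial
  induction List.finRange (n + 1) with
  | nil => rfl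
  | cons j l ih =>
    simp only [List.foldr_cons]
    rw [ih, partialZ_iterate_comm _ _ _ (contDiff_foldr_partialZ α l hh)]

theorem mixedPartial_add_single (α : Fin (n + 1) → ℕ) (i : Fin (n + 1))
    (hh : ContDiff ℝ (⊤ : ℕ∞) h) :
    mixedPartial (α + Pi.single i 1) h = partialZ i (mixedPartial α h) := by
  have key : ∀ l : List (Fin (n + 1)), l.Nodup →
      l.foldr (fun j g => (partialZ j)^[(α + Pi.single i 1 : Fin (n + 1) → ℕ) j] g) h =
        if i ∈ l then partialZ i (l.foldr (fun j g => (partialZ j)^[α j] g) h)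
        else l.foldr (fun j g => (partialZ j)^[α j] g) h := by
    intro l
    induction l with
    | nil => simp
    | cons j l ih =>
      intro hl
      rw [List.nodup_cons] at hl
      simp only [List.foldr_cons, ih hl.2, List.mem_cons]
      by_cases hij : i = j
      · subst hij
        simp only [hl.1, if_false, true_or, if_true, Pi.add_apply, Pi.single_eq_same]
        rw [Function.iterate_succ_apply']
      · simp only [hij, false_or, Pi.add_apply, Pi.single_eq_of_ne (Ne.symm hij), add_zero]
        split_ifs
        · rw [partialZ_iterate_comm _ _ _ (contDiff_foldr_partialZ α l hh)]
        · rfl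
  rw [mixedPartial, key _ (List.nodup_finRange _), if_pos (List.mem_finRange i)]
  rfl

theorem mixedPartial_zero : mixedPartial 0 h = h := by
  unfold mixedPartial
  induction List.finRange (n + 1) with
  | nil => rfl
  | cons j l ih => simp only [List.foldr_cons, ih]; rfl

theorem fderiv_apply_eq_sum (z v : Fin (n + 1) → ℝ) :
    fderiv ℝ h z v = ∑ q, partialZ q h z * v q := by
  have := (fderiv ℝ h z : (Fin (n + 1) → ℝ) →ₗ[ℝ] ℝ).pi_apply_eq_sum_univ v
  refine this.trans (Finset.sum_congr rfl fun q _ => ?_)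
  rw [smul_eq_mul, mul_comm]
  congr 1
  change fderiv ℝ h z _ = fderiv ℝ h z _
  congr 1
  funext j
  simp [Pi.single_apply, eq_comm]

/-- The chain rule along a curve. -/
theorem hasDerivWithinAt_comp_curve (hh : ContDiff ℝ (⊤ : ℕ∞) h) {y : ℝ → Fin (n + 1) → ℝ}
    {y' : Fin (n + 1) → ℝ} {s : Set ℝ} {x : ℝ}
    (hy : ∀ q, HasDerivWithinAt (fun x => y x q) (y' q) s x) :
    HasDerivWithinAt (fun x => h (y x)) (∑ q, partialZ q h (y x) * y' q) s x := by
  rw [← fderiv_apply_eq_sum]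
  exact ((hh.differentiable (by simp)) (y x)).hasFDerivAt.comp_hasDerivWithinAt x
    (hasDerivWithinAt_pi.2 hy)

theorem deriv_comp_curve (hh : ContDiff ℝ (⊤ : ℕ∞) h) {y : ℝ → Fin (n + 1) → ℝ}
    (hy : ∀ q, ContDiff ℝ (⊤ : ℕ∞) fun x => y x q) :
    deriv (fun x => h (y x)) = fun x => ∑ q, partialZ q h (y x) * deriv (fun x => y x q) x := by
  funext x
  refine HasDerivAt.deriv (hasDerivWithinAt_univ.1 (hasDerivWithinAt_comp_curve hh fun q => ?_))
  exact (((hy q).differentiable (by simp)) x).hasDerivAt.hasDerivWithinAt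

end Partial

/-! ### The Faà di Bruno formula -/

section FaaDiBruno

variable {n : ℕ} (K : ℕ)

/-- The multiplicities `m (i, q)` with total weight `∑ (i + 1) m (i, q) = k`, where `i < K`. -/
def weightSet (n K k : ℕ) : Finset (Fin K × Fin (n + 1) → ℕ) :=
  (Fintype.piFinset fun _ => Finset.range (K + 1)).filter
    fun m => ∑ j, m j * ((j.1 : ℕ) + 1) = k

variable {K}

theorem mem_weightSet {k : ℕ} (hk : k ≤ K) {m : Fin K × Fin (n + 1) → ℕ} :
    m ∈ weightSet n K k ↔ ∑ j, m j * ((j.1 : ℕ) + 1) = k := by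
  simp only [weightSet, Finset.mem_filter, Fintype.mem_piFinset, Finset.mem_range,
    and_iff_right_iff_imp]
  intro h j
  have : m j * ((j.1 : ℕ) + 1) ≤ k := h ▸ Finset.single_le_sum
    (f := fun j : Fin K × Fin (n + 1) => m j * ((j.1 : ℕ) + 1)) (fun _ _ => Nat.zero_le _)
    (Finset.mem_univ j)
  nlinarith [Nat.zero_le (m j * (j.1 : ℕ))]

/-- The number of differentiations with respect to `z_q` in the term with multiplicities `m`. -/
def multOrder (m : Fin K × Fin (n + 1) → ℕ) (q : Fin (n + 1)) : ℕ := ∑ i, m (i, q)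

/-- The normalized product `∏ a_j ^ m_j / m_j!`. -/
def multTerm (a : Fin K × Fin (n + 1) → ℝ) (m : Fin K × Fin (n + 1) → ℕ) : ℝ :=
  ∏ j, a j ^ m j / (m j).factorial

theorem multOrder_add_single (m : Fin K × Fin (n + 1) → ℕ) (j : Fin K × Fin (n + 1)) :
    multOrder (m + Pi.single j 1) = multOrder m + Pi.single j.2 1 := by
  funext q
  simp only [multOrder, Pi.add_apply, Finset.sum_add_distrib]
  congr 1
  rcases eq_or_ne q j.2 with rfl | hq
  · rw [Finset.sum_eq_single j.1]
    · simp
    · intro i _ hi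
      rw [Pi.single_eq_of_ne]
      intro h; exact hi (congrArg Prod.fst h)
    · simp
  · rw [Pi.single_eq_of_ne hq, Finset.sum_eq_zero]
    intro i _
    rw [Pi.single_eq_of_ne]
    intro h; exact hq (congrArg Prod.snd h)

theorem multTerm_add_single (a : Fin K × Fin (n + 1) → ℝ) (m : Fin K × Fin (n + 1) → ℕ)
    (j : Fin K × Fin (n + 1)) :
    ((m + Pi.single j 1 : Fin K × Fin (n + 1) → ℕ) j : ℝ) * multTerm a (m + Pi.single j 1)
      = a j * multTerm a m := by
  unfold multTerm
  rw [← Finset.mul_prod_erase _ _ (Finset.mem_univ j),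
    ← Finset.mul_prod_erase Finset.univ (fun j => a j ^ m j / ((m j).factorial : ℝ))
      (Finset.mem_univ j)]
  have h1 : ∏ i ∈ Finset.univ.erase j, a i ^ (m + Pi.single j 1 : Fin K × Fin (n + 1) → ℕ) i
      / ((m + Pi.single j 1 : Fin K × Fin (n + 1) → ℕ) i).factorial
      = ∏ i ∈ Finset.univ.erase j, a i ^ m i / ((m i).factorial : ℝ) := by
    refine Finset.prod_congr rfl fun i hi => ?_
    rw [Pi.add_apply, Pi.single_eq_of_ne (Finset.ne_of_mem_erase hi), add_zero]
  rw [h1, Pi.add_apply, Pi.single_eq_same, Nat.factorial_succ, pow_succ]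
  have h2 : ((m j).factorial : ℝ) ≠ 0 := by positivity
  push_cast
  field_simp

/-- Removing one factor of kind `j` from the terms of weight `k`. -/
theorem sum_weightSet_mul (a : Fin K × Fin (n + 1) → ℝ) (G : (Fin (n + 1) → ℕ) → ℝ) {k : ℕ}
    (hk : k ≤ K) (j : Fin K × Fin (n + 1)) :
    ∑ m ∈ weightSet n K k, (m j : ℝ) * multTerm a m * G (multOrder m)
      = if (j.1 : ℕ) + 1 ≤ k then ∑ m ∈ weightSet n K (k - ((j.1 : ℕ) + 1)),
          a j * multTerm a m * G (multOrder m + Pi.single j.2 1) else 0 := by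
  have hw (m : Fin K × Fin (n + 1) → ℕ) :
      ∑ i, (m + Pi.single j 1 : Fin K × Fin (n + 1) → ℕ) i * ((i.1 : ℕ) + 1)
        = ∑ i, m i * ((i.1 : ℕ) + 1) + ((j.1 : ℕ) + 1) := by
    simp only [Pi.add_apply, add_mul, Finset.sum_add_distrib]
    congr 1
    rw [Finset.sum_eq_single j]
    · simp
    · intro i _ hi; simp [Pi.single_eq_of_ne hi]
    · simp
  have hsub (m : Fin K × Fin (n + 1) → ℕ) (hm : m j ≠ 0) :
      m - Pi.single j 1 + Pi.single j 1 = m := by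
    funext i
    rcases eq_or_ne i j with rfl | hi
    · simp; omega
    · simp [Pi.single_eq_of_ne hi]
  have hfil : ∑ m ∈ weightSet n K k, (m j : ℝ) * multTerm a m * G (multOrder m)
      = ∑ m ∈ (weightSet n K k).filter (fun m => m j ≠ 0),
          (m j : ℝ) * multTerm a m * G (multOrder m) := by
    rw [Finset.sum_filter]
    refine Finset.sum_congr rfl fun m _ => ?_
    by_cases h : m j = 0 <;> simp [h]
  rw [hfil]
  split_ifs with hj
  · refine Finset.sum_nbij' (fun m => m - Pi.single j 1) (fun m => m + Pi.single j 1) ?_ ?_ ?_ ?_ ?_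
    · intro m hm
      rw [Finset.mem_filter, mem_weightSet hk] at hm
      rw [mem_weightSet (by omega)]
      have := hw (m - Pi.single j 1)
      rw [hsub m hm.2, hm.1] at this
      omega
    · intro m hm
      rw [mem_weightSet (by omega)] at hm
      rw [Finset.mem_filter, mem_weightSet hk, hw, hm]
      exact ⟨by omega, by simp⟩
    · intro m hm
      exact hsub m (Finset.mem_filter.1 hm).2
    · intro m _
      funext i
      simp
    · intro m hm
      have h1 := multTerm_add_single a (m - Pi.single j 1) j
      have h2 := multOrder_add_single (m - Pi.single j 1) j
      rw [hsub m (Finset.mem_filter.1 hm).2] at h1 h2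
      rw [h1, h2]
  · refine Finset.sum_eq_zero fun m hm => ?_
    rw [Finset.mem_filter, mem_weightSet hk] at hm
    have := hw (m - Pi.single j 1)
    rw [hsub m hm.2, hm.1] at this
    omega

/-- The recursion in `k` for the sums of the Faà di Bruno formula. -/
theorem succ_mul_sum_weightSet (b : ℕ → Fin (n + 1) → ℝ) (G : (Fin (n + 1) → ℕ) → ℝ) {k : ℕ}
    (hk : k + 1 ≤ K) :
    ((k : ℝ) + 1) * ∑ m ∈ weightSet n K (k + 1), multTerm (fun j => b j.1 j.2) m * G (multOrder m)
      = ∑ q, ∑ i ∈ Finset.range (k + 1), ((i : ℝ) + 1) * b i q * ∑ m ∈ weightSet n K (k - i),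
          multTerm (fun j => b j.1 j.2) m * G (multOrder m + Pi.single q 1) := by
  have h1 : ((k : ℝ) + 1) * ∑ m ∈ weightSet n K (k + 1),
        multTerm (fun j => b j.1 j.2) m * G (multOrder m)
      = ∑ j : Fin K × Fin (n + 1), ((j.1 : ℕ) + 1 : ℝ) *
          ∑ m ∈ weightSet n K (k + 1),
            (m j : ℝ) * multTerm (fun j => b j.1 j.2) m * G (multOrder m) := by
    simp only [Finset.mul_sum]
    rw [Finset.sum_comm]
    refine Finset.sum_congr rfl fun m hm => ?_
    rw [mem_weightSet hk] at hm
    have : ((k : ℝ) + 1) = ∑ j, (m j : ℝ) * ((j.1 : ℕ) + 1 : ℝ) := by exact_mod_cast hm.symm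
    rw [this, Finset.sum_mul]
    exact Finset.sum_congr rfl fun j _ => by ring
  rw [h1, Fintype.sum_prod_type, Finset.sum_comm]
  refine Finset.sum_congr rfl fun q _ => ?_
  set g : ℕ → ℝ := fun i => ((i : ℝ) + 1) * if i + 1 ≤ k + 1 then
    ∑ m ∈ weightSet n K (k + 1 - (i + 1)), b i q * multTerm (fun j => b j.1 j.2) m
      * G (multOrder m + Pi.single q 1) else 0 with hg
  have h2 : ∀ i : Fin K, ((i : ℕ) + 1 : ℝ) * ∑ m ∈ weightSet n K (k + 1),
      (m (i, q) : ℝ) * multTerm (fun j => b j.1 j.2) m * G (multOrder m) = g i := fun i => by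
    rw [sum_weightSet_mul _ G hk]
  rw [Finset.sum_congr rfl fun i _ => h2 i, Fin.sum_univ_eq_sum_range g K]
  rw [← Finset.sum_subset (Finset.range_subset_range.2 hk)]
  · refine Finset.sum_congr rfl fun i hi => ?_
    rw [Finset.mem_range] at hi
    rw [hg]
    dsimp only
    rw [if_pos (by omega), Nat.add_sub_add_right, mul_assoc, Finset.mul_sum _ _ (b i q)]
    simp only [mul_assoc]
  · intro i _ hi
    rw [Finset.mem_range] at hi
    rw [hg]
    dsimp only
    rw [if_neg (by omega), mul_zero]

/-- The Faà di Bruno formula, normalized by factorials. -/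
theorem iteratedDeriv_comp_div_factorial {y : ℝ → Fin (n + 1) → ℝ}
    (hy : ∀ q, ContDiff ℝ (⊤ : ℕ∞) fun x => y x q) (x : ℝ) (k : ℕ) (hk : k ≤ K)
    {h : (Fin (n + 1) → ℝ) → ℝ} (hh : ContDiff ℝ (⊤ : ℕ∞) h) :
    iteratedDeriv k (fun x => h (y x)) x / k.factorial
      = ∑ m ∈ weightSet n K k, multTerm
          (fun j => iteratedDeriv (j.1 + 1) (fun x => y x j.2) x / ((j.1 : ℕ) + 1).factorial) m
          * mixedPartial (multOrder m) h (y x) := by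
  induction k using Nat.strong_induction_on generalizing h with
  | _ k ih =>
  rcases k with _ | k
  · have : weightSet n K 0 = {0} := by
      ext m
      rw [mem_weightSet (Nat.zero_le _), Finset.mem_singleton]
      simp [Finset.sum_eq_zero_iff, funext_iff]
    have h0 : multOrder (0 : Fin K × Fin (n + 1) → ℕ) = 0 := by
      funext q; simp [multOrder]
    simp [this, multTerm, h0, mixedPartial_zero]
  · have hyc : ContDiff ℝ (⊤ : ℕ∞) y := contDiff_pi.2 hy
    have hyd (q : Fin (n + 1)) : ContDiff ℝ (⊤ : ℕ∞) (deriv fun x => y x q) :=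
      (contDiff_infty_iff_deriv.1 (hy q)).2
    have hq (q : Fin (n + 1)) : ContDiff ℝ (⊤ : ℕ∞) fun x => partialZ q h (y x) :=
      (contDiff_partialZ q hh).comp hyc
    refine mul_left_cancel₀ (a := (k : ℝ) + 1) (by positivity) ?_
    rw [succ_mul_sum_weightSet
      (fun i q => iteratedDeriv (i + 1) (fun x => y x q) x / ((i : ℕ) + 1).factorial)
      (fun α => mixedPartial α h (y x)) hk]
    have e1 : ((k : ℝ) + 1) * (iteratedDeriv (k + 1) (fun x => h (y x)) x / (k + 1).factorial)
        = iteratedDeriv (k + 1) (fun x => h (y x)) x / k.factorial := by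
      rw [Nat.factorial_succ]; push_cast; field_simp
    have e2 : (fun x => ∑ q, partialZ q h (y x) * deriv (fun x => y x q) x)
        = fun x => ∑ q, deriv (fun x => y x q) x * partialZ q h (y x) := by
      funext x; exact Finset.sum_congr rfl fun q _ => mul_comm _ _
    rw [e1, iteratedDeriv_succ', deriv_comp_curve hh hy, e2, iteratedDeriv_fun_sum
      (fun q _ => ((hyd q).mul (hq q)).contDiffAt.of_le (by exact_mod_cast le_top)), Finset.sum_div]
    refine Finset.sum_congr rfl fun q _ => ?_
    rw [iteratedDeriv_fun_mul ((hyd q).contDiffAt.of_le (by exact_mod_cast le_top))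
      ((hq q).contDiffAt.of_le (by exact_mod_cast le_top)), Finset.sum_div]
    refine Finset.sum_congr rfl fun i hi => ?_
    rw [Finset.mem_range] at hi
    have := ih (k - i) (by omega) (by omega) (contDiff_partialZ q hh)
    simp only [mixedPartial_partialZ _ q hh, ← mixedPartial_add_single _ q hh] at this
    rw [← this, ← iteratedDeriv_succ', Nat.factorial_succ,
      Nat.cast_choose ℝ (by omega : i ≤ k)]
    push_cast
    field_simp

theorem contDiff_iteratedDeriv (k : ℕ) {g : ℝ → ℝ} (hg : ContDiff ℝ (⊤ : ℕ∞) g) :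
    ContDiff ℝ (⊤ : ℕ∞) (iteratedDeriv k g) := by
  rw [iteratedDeriv_eq_iterate]
  exact hg.iterate_deriv k

/-- The product of the functions denoted by a tuple of the Faà di Bruno family. -/
theorem FdBIdx.prod_map_eval {k : ℕ} (m : FdBIdx n k) (f : (Fin (n + 1) → ℝ) → ℝ)
    (ψ : ℝ → ℝ → ℝ) (t x : ℝ) :
    (m.tuple.map fun z => z.eval f ψ t x).prod
      = (m.coeff : ℝ) * mixedPartial m.order f (jet n ψ t x)
        * ∏ i : Fin k, ∏ q : Fin (n + 1),
          iteratedDeriv ((q : ℕ) + ((i : ℕ) + 1)) (ψ t) x ^ (m.1 i q : ℕ) := by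
  rw [FdBIdx.tuple, List.map_cons, List.prod_cons, List.map_flatMap]
  simp only [List.flatMap_def, List.prod_flatten, Function.comp_def,
    List.map_flatten, List.map_replicate, List.prod_replicate, ← List.ofFn_eq_map, List.prod_ofFn,
    List.map_ofFn]
  rfl

/-- The Faà di Bruno formula for `∂_x^k (f(ψ, ∂_x ψ, …, ∂_x^n ψ))`, as the sum over the tuples of
codes. -/
theorem iteratedDeriv_comp_jet {f : (Fin (n + 1) → ℝ) → ℝ} (hf : ContDiff ℝ (⊤ : ℕ∞) f)
    {ψ : ℝ → ℝ → ℝ} {t : ℝ} (hψ : ContDiff ℝ (⊤ : ℕ∞) (ψ t)) (k : ℕ) (x : ℝ) :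
    iteratedDeriv k (fun x => f (jet n ψ t x)) x
      = ∑ m : FdBIdx n k, (m.tuple.map fun z => z.eval f ψ t x).prod := by
  have hj (q : Fin (n + 1)) : ContDiff ℝ (⊤ : ℕ∞) fun x => jet n ψ t x q :=
    contDiff_iteratedDeriv q hψ
  have h := iteratedDeriv_comp_div_factorial hj x k le_rfl hf
  rw [div_eq_iff (by positivity)] at h
  rw [h, Finset.sum_mul]
  symm
  refine Finset.sum_bij (fun m _ => fun j => (m.1 j.1 j.2 : ℕ)) ?_ ?_ ?_ ?_
  · intro m _
    rw [mem_weightSet le_rfl, Fintype.sum_prod_type]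
    simpa only [Finset.sum_mul] using m.2
  · intro m _ m' _ hm
    refine Subtype.ext ?_
    funext i q
    exact Fin.ext (congrFun hm (i, q))
  · intro m hm
    have hm' := hm
    rw [mem_weightSet le_rfl, Fintype.sum_prod_type] at hm'
    rw [weightSet, Finset.mem_filter, Fintype.mem_piFinset] at hm
    refine ⟨⟨fun i q => ⟨m (i, q), Finset.mem_range.1 (hm.1 (i, q))⟩, ?_⟩, Finset.mem_univ _, rfl⟩
    simpa only [Finset.sum_mul] using hm'
  · intro m _
    rw [FdBIdx.prod_map_eval]
    have ho : multOrder (fun j : Fin k × Fin (n + 1) => (m.1 j.1 j.2 : ℕ)) = m.order := rfl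
    have hd (i : Fin k) (q : Fin (n + 1)) : iteratedDeriv (i + 1) (fun x => jet n ψ t x q) x
        = iteratedDeriv ((q : ℕ) + ((i : ℕ) + 1)) (ψ t) x := by
      simp only [jet, iteratedDeriv_eq_iterate, add_comm (q : ℕ), Function.iterate_add_apply]
    rw [ho, multTerm, Fintype.prod_prod_type, FdBIdx.coeff, Units.val_mk0]
    simp only [hd, div_pow, div_div, Finset.prod_div_distrib, mul_comm (Nat.factorial _ : ℝ)]
    ring

end FaaDiBruno

/-! ### The equations satisfied by the functions `c(u)` -/

theorem sub_eq_integral_of_hasDerivWithinAt {a b : ℝ} (hab : a ≤ b) {v g : ℝ → ℝ}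
    (hv : ∀ t ∈ Icc a b, HasDerivWithinAt v (g t) (Icc a b) t) (hg : ContinuousOn g (Icc a b)) :
    ∫ s in a..b, g s = v b - v a :=
  intervalIntegral.integral_eq_sub_of_hasDerivAt_of_le hab
    (fun t ht => (hv t ht).continuousWithinAt)
    (fun t ht => (hv t (Ioo_subset_Icc_self ht)).hasDerivAt (Icc_mem_nhds ht.1 ht.2))
    (hg.intervalIntegrable_of_Icc hab)

theorem hasDerivWithinAt_integral {a b : ℝ} (hab : a ≤ b) {g : ℝ → ℝ}
    (hg : ContinuousOn g (Icc a b)) {t : ℝ} (ht : t ∈ Icc a b) :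
    HasDerivWithinAt (fun r => ∫ s in a..r, g s) (g t) (Icc a b) t := by
  set G := IccExtend hab ((Icc a b).domRestrict g) with hG
  have hGc : Continuous G := (continuousOn_iff_continuous_domRestrict.1 hg).Icc_extend'
  have hGg : ∀ s ∈ Icc a b, G s = g s := fun s hs => by rw [hG, IccExtend_of_mem _ _ hs]; rfl
  have h := ((hGc.integral_hasStrictDerivAt a t).hasDerivAt).hasDerivWithinAt (s := Icc a b)
  rw [hGg t ht] at h
  refine h.congr (fun r hr => ?_) ?_
  · refine intervalIntegral.integral_congr fun s hs => (hGg s ?_).symm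
    rw [uIcc_of_le hr.1] at hs
    exact ⟨hs.1, hs.2.trans hr.2⟩
  · refine intervalIntegral.integral_congr fun s hs => (hGg s ?_).symm
    rw [uIcc_of_le ht.1] at hs
    exact ⟨hs.1, hs.2.trans ht.2⟩

section Strip

variable {T : ℝ}

theorem continuousOn_time_slice {g : ℝ → ℝ → ℝ}
    (hg : ContinuousOn (fun p : ℝ × ℝ => g p.1 p.2) (Icc 0 T ×ˢ univ)) (x : ℝ) :
    ContinuousOn (fun s => g s x) (Icc 0 T) :=
  hg.comp (f := fun s : ℝ => (s, x)) (by fun_prop) fun s hs => ⟨hs, mem_univ _⟩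

theorem continuous_space_slice {g : ℝ → ℝ → ℝ}
    (hg : ContinuousOn (fun p : ℝ × ℝ => g p.1 p.2) (Icc 0 T ×ˢ univ)) {s : ℝ}
    (hs : s ∈ Icc 0 T) : Continuous (g s) := by
  rw [← continuousOn_univ]
  exact hg.comp (f := fun x : ℝ => (s, x)) (by fun_prop) fun x _ => ⟨hs, mem_univ _⟩

/-- A space derivative inherits a time derivative, namely the space derivative of the time
derivative; no second order regularity in time is involved. -/
theorem hasDerivWithinAt_space_deriv {v g v' g' : ℝ → ℝ → ℝ}
    (hv : ∀ t ∈ Icc 0 T, ∀ x, HasDerivWithinAt (fun s => v s x) (g t x) (Icc 0 T) t)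
    (hvx : ∀ t ∈ Icc 0 T, ∀ x, HasDerivAt (v t) (v' t x) x)
    (hgx : ∀ t ∈ Icc 0 T, ∀ x, HasDerivAt (g t) (g' t x) x)
    (hg : ContinuousOn (fun p : ℝ × ℝ => g p.1 p.2) (Icc 0 T ×ˢ univ))
    (hg' : ContinuousOn (fun p : ℝ × ℝ => g' p.1 p.2) (Icc 0 T ×ˢ univ)) :
    ∀ t ∈ Icc 0 T, ∀ x, HasDerivWithinAt (fun s => v' s x) (g' t x) (Icc 0 T) t := by
  intro t ht x
  have hT : (0 : ℝ) ≤ T := ht.1.trans ht.2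
  have key : ∀ r ∈ Icc 0 T, v' r x = v' 0 x + ∫ s in (0 : ℝ)..r, g' s x := by
    intro r hr
    have hsub : Icc 0 r ⊆ Icc 0 T := Icc_subset_Icc_right hr.2
    have hI (y : ℝ) : ∫ s in (0 : ℝ)..r, g s y = v r y - v 0 y :=
      sub_eq_integral_of_hasDerivWithinAt hr.1 (v := fun s => v s y)
        (fun s hs => (hv s (hsub hs) y).mono hsub) ((continuousOn_time_slice hg y).mono hsub)
    obtain ⟨C, hC⟩ := (isCompact_Icc (a := (0 : ℝ)) (b := T)).prod
      (isCompact_closedBall x 1) |>.exists_bound_of_continuousOn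
      (hg'.mono (prod_mono_right (subset_univ _)))
    have hd := intervalIntegral.hasDerivAt_integral_of_dominated_loc_of_deriv_le (μ := volume)
      (a := 0) (b := r) (F := fun y s => g s y) (F' := fun y s => g' s y) (x₀ := x)
      (s := Metric.ball x 1) (bound := fun _ => C) (Metric.ball_mem_nhds x one_pos)
      (Filter.Eventually.of_forall fun y => by
        rw [uIoc_of_le hr.1]
        exact ((continuousOn_time_slice hg y).mono
          (Ioc_subset_Icc_self.trans hsub)).aestronglyMeasurable measurableSet_Ioc)
      (((continuousOn_time_slice hg x).mono hsub).intervalIntegrable_of_Icc hr.1)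
      (by
        rw [uIoc_of_le hr.1]
        exact ((continuousOn_time_slice hg' x).mono
          (Ioc_subset_Icc_self.trans hsub)).aestronglyMeasurable measurableSet_Ioc)
      (Filter.Eventually.of_forall fun s hs y hy => by
        rw [uIoc_of_le hr.1] at hs
        exact hC (s, y) ⟨hsub ⟨hs.1.le, hs.2⟩, Metric.ball_subset_closedBall hy⟩)
      (by simp)
      (Filter.Eventually.of_forall fun s hs y _ => by
        rw [uIoc_of_le hr.1] at hs
        exact hgx s (hsub ⟨hs.1.le, hs.2⟩) y)
    have h1 := hd.2
    simp only [hI] at h1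
    have h2 := ((hvx r hr x).sub (hvx 0 ⟨le_rfl, hT⟩ x)).unique h1
    linarith
  refine ((hasDerivWithinAt_integral hT (continuousOn_time_slice hg' x) ht).const_add
    (v' 0 x)).congr (fun r hr => key r hr) (key t ht)

end Strip

section Evolution

variable {n : ℕ} {T : ℝ} {f : (Fin (n + 1) → ℝ) → ℝ} {u : ℝ → ℝ → ℝ}

theorem continuousOn_jet (hu : IsC1Infty T u) :
    ContinuousOn (fun p : ℝ × ℝ => jet n u p.1 p.2) (Icc 0 T ×ˢ univ) :=
  continuousOn_pi.2 fun i => hu.continuous_space i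

theorem contDiff_jet (hu : IsC1Infty T u) {t : ℝ} (ht : t ∈ Icc 0 T) :
    ContDiff ℝ (⊤ : ℕ∞) (jet n u t) :=
  contDiff_pi.2 fun i => contDiff_iteratedDeriv i (hu.smooth_space t ht)

theorem hasDerivAt_iteratedDeriv {g : ℝ → ℝ} (hg : ContDiff ℝ (⊤ : ℕ∞) g) (k : ℕ) (x : ℝ) :
    HasDerivAt (iteratedDeriv k g) (iteratedDeriv (k + 1) g x) x := by
  rw [iteratedDeriv_succ]
  exact ((contDiff_iteratedDeriv k hg).differentiable (by simp) x).hasDerivAt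

theorem continuousOn_eval (hf : ContDiff ℝ (⊤ : ℕ∞) f) (hu : IsC1Infty T u) (c : Code n) :
    ContinuousOn (fun p : ℝ × ℝ => c.eval f u p.1 p.2) (Icc 0 T ×ˢ univ) := by
  cases c with
  | id =>
    have h := hu.continuous_space 0
    simp only [iteratedDeriv_zero] at h
    exact h
  | star a α =>
    exact continuousOn_const.mul
      ((contDiff_mixedPartial α hf).continuous.comp_continuousOn (continuousOn_jet hu))
  | dx k hk => exact hu.continuous_space k

theorem contDiff_eval (hf : ContDiff ℝ (⊤ : ℕ∞) f) (hu : IsC1Infty T u) (c : Code n) {t : ℝ}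
    (ht : t ∈ Icc 0 T) : ContDiff ℝ (⊤ : ℕ∞) (c.eval f u t) := by
  cases c with
  | id => exact hu.smooth_space t ht
  | star a α => exact contDiff_const.mul ((contDiff_mixedPartial α hf).comp (contDiff_jet hu ht))
  | dx k hk => exact contDiff_iteratedDeriv k (hu.smooth_space t ht)

theorem continuousOn_list_prod {l : List (ℝ → ℝ → ℝ)} {s : Set (ℝ × ℝ)}
    (h : ∀ g ∈ l, ContinuousOn (fun p : ℝ × ℝ => g p.1 p.2) s) :
    ContinuousOn (fun p : ℝ × ℝ => (l.map fun g => g p.1 p.2).prod) s := by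
  induction l with
  | nil => simpa using continuousOn_const
  | cons a l ih =>
    simp only [List.map_cons, List.prod_cons]
    exact (h a (by simp)).mul (ih fun g hg => h g (by simp [hg]))

theorem continuousOn_prod_eval (hf : ContDiff ℝ (⊤ : ℕ∞) f) (hu : IsC1Infty T u)
    (l : List (Code n)) :
    ContinuousOn (fun p : ℝ × ℝ => (l.map fun z => z.eval f u p.1 p.2).prod) (Icc 0 T ×ˢ univ) := by
  have := continuousOn_list_prod (l := l.map fun z => z.eval f u) (s := Icc 0 T ×ˢ univ) (by
    simp only [List.mem_map, forall_exists_index, and_imp]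
    rintro _ z _ rfl
    exact continuousOn_eval hf hu z)
  simpa only [List.map_map, Function.comp_def] using this

/-- The space derivatives of `u` satisfy the differentiated equation. -/
theorem hasDerivWithinAt_iteratedDeriv (hf : ContDiff ℝ (⊤ : ℕ∞) f) (hu : IsC1Infty T u)
    (hpde : ∀ t ∈ Icc 0 T, ∀ x, derivWithin (fun s => u s x) (Icc 0 T) t
      + 1 / 2 * iteratedDeriv 2 (u t) x + f (jet n u t x) = 0) (k : ℕ) :
    ∀ t ∈ Icc 0 T, ∀ x, HasDerivWithinAt (fun s => iteratedDeriv k (u s) x)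
      (-(1 / 2 * iteratedDeriv (k + 2) (u t) x) - iteratedDeriv k (fun y => f (jet n u t y)) x)
      (Icc 0 T) t := by
  have hfj {t : ℝ} (ht : t ∈ Icc 0 T) : ContDiff ℝ (⊤ : ℕ∞) fun y => f (jet n u t y) :=
    hf.comp (contDiff_jet hu ht)
  have hcont (k : ℕ) : ContinuousOn (fun p : ℝ × ℝ => -(1 / 2 * iteratedDeriv (k + 2) (u p.1) p.2)
      - iteratedDeriv k (fun y => f (jet n u p.1 y)) p.2) (Icc 0 T ×ˢ univ) := by
    refine (continuousOn_const.mul (hu.continuous_space (k + 2))).neg.sub ?_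
    refine (continuousOn_finsetSum Finset.univ fun (m : FdBIdx n k) _ =>
      continuousOn_prod_eval hf hu m.tuple).congr fun p hp => ?_
    exact iteratedDeriv_comp_jet hf (hu.smooth_space p.1 hp.1) k p.2
  induction k with
  | zero =>
    intro t ht x
    have h := ((hu.differentiable_time x) t ht).hasDerivWithinAt
    have e : derivWithin (fun s => u s x) (Icc 0 T) t
        = -(1 / 2 * iteratedDeriv 2 (u t) x) - f (jet n u t x) := by
      linarith [hpde t ht x]
    rw [e] at h
    simpa only [iteratedDeriv_zero] using h
  | succ k ih =>
    refine hasDerivWithinAt_space_deriv (v := fun t => iteratedDeriv k (u t)) (g := fun t x =>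
      -(1 / 2 * iteratedDeriv (k + 2) (u t) x) - iteratedDeriv k (fun y => f (jet n u t y)) x)
      ih (fun t ht x => hasDerivAt_iteratedDeriv (hu.smooth_space t ht) k x)
      (fun t ht x => ?_) (hcont k) (hcont (k + 1))
    exact ((hasDerivAt_iteratedDeriv (hu.smooth_space t ht) (k + 2) x).const_mul
      (1 / 2)).fun_neg.fun_sub (hasDerivAt_iteratedDeriv (hfj ht) k x)

/-- The first space derivative of `h(u, …, ∂_x^n u)`. -/
theorem hasDerivAt_comp_jet {h : (Fin (n + 1) → ℝ) → ℝ} (hh : ContDiff ℝ (⊤ : ℕ∞) h)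
    (hu : IsC1Infty T u) {t : ℝ} (ht : t ∈ Icc 0 T) (x : ℝ) :
    HasDerivAt (fun y => h (jet n u t y))
      (∑ q : Fin (n + 1), partialZ q h (jet n u t x) * iteratedDeriv (q + 1) (u t) x) x := by
  rw [← hasDerivWithinAt_univ]
  exact hasDerivWithinAt_comp_curve hh fun q =>
    (hasDerivAt_iteratedDeriv (hu.smooth_space t ht) q x).hasDerivWithinAt

/-- The second space derivative of `h(u, …, ∂_x^n u)`. -/
theorem hasDerivAt_deriv_comp_jet {h : (Fin (n + 1) → ℝ) → ℝ} (hh : ContDiff ℝ (⊤ : ℕ∞) h)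
    (hu : IsC1Infty T u) {t : ℝ} (ht : t ∈ Icc 0 T) (x : ℝ) :
    HasDerivAt (fun y => ∑ q : Fin (n + 1),
        partialZ q h (jet n u t y) * iteratedDeriv (q + 1) (u t) y)
      (∑ q : Fin (n + 1), ((∑ r : Fin (n + 1), partialZ r (partialZ q h) (jet n u t x)
          * iteratedDeriv (r + 1) (u t) x) * iteratedDeriv (q + 1) (u t) x
        + partialZ q h (jet n u t x) * iteratedDeriv (q + 2) (u t) x)) x :=
  HasDerivAt.fun_sum fun q _ => (hasDerivAt_comp_jet (contDiff_partialZ q hh) hu ht x).mul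
    (hasDerivAt_iteratedDeriv (hu.smooth_space t ht) (q + 1) x)

theorem iteratedDeriv_two_comp_jet {h : (Fin (n + 1) → ℝ) → ℝ} (hh : ContDiff ℝ (⊤ : ℕ∞) h)
    (hu : IsC1Infty T u) {t : ℝ} (ht : t ∈ Icc 0 T) (x : ℝ) :
    iteratedDeriv 2 (fun y => h (jet n u t y)) x
      = ∑ q : Fin (n + 1), ((∑ r : Fin (n + 1), partialZ r (partialZ q h) (jet n u t x)
          * iteratedDeriv (r + 1) (u t) x) * iteratedDeriv (q + 1) (u t) x
        + partialZ q h (jet n u t x) * iteratedDeriv (q + 2) (u t) x) := by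
  have h1 : deriv (fun y => h (jet n u t y)) = _ :=
    funext fun y => (hasDerivAt_comp_jet hh hu ht y).deriv
  rw [iteratedDeriv_succ, iteratedDeriv_one, h1]
  exact (hasDerivAt_deriv_comp_jet hh hu ht x).deriv

theorem eval_fStar (ψ : ℝ → ℝ → ℝ) (t x : ℝ) : (fStar n).eval f ψ t x = f (jet n ψ t x) := by
  simp [fStar, Code.eval, mixedPartial_zero]

theorem sum_mechIdx_star (a : ℝˣ) (α : Fin (n + 1) → ℕ) (F : MechIdx (Code.star a α) → ℝ) :
    ∑ Z, F Z = F (.inl ()) + (∑ k : Fin n, ∑ m : FdBIdx n ((k : ℕ) + 1), F (.inr (.inl ⟨k, m⟩))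
      + ∑ j : Fin (n + 1), ∑ l : Fin (n + 1), F (.inr (.inr (j, l)))) := by
  have h1 := Fintype.sum_sum_type (α₁ := Unit)
    (α₂ := (Σ k : Fin n, FdBIdx n ((k : ℕ) + 1)) ⊕ (Fin (n + 1) × Fin (n + 1))) F
  refine h1.trans ?_
  rw [Fintype.sum_sum_type, Fintype.sum_sigma, Fintype.sum_prod_type, Fintype.sum_unique]

theorem sum_tupleProd_dx (hf : ContDiff ℝ (⊤ : ℕ∞) f) {ψ : ℝ → ℝ → ℝ} {t : ℝ}
    (hψ : ContDiff ℝ (⊤ : ℕ∞) (ψ t)) (x : ℝ) {k : ℕ} (hk : 1 ≤ k) :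
    ∑ Z, tupleProd (fun c => c.eval f ψ) (Code.dx (n := n) k hk) (Z, t, x)
      = iteratedDeriv k (fun y => f (jet n ψ t y)) x :=
  (iteratedDeriv_comp_jet hf hψ k x).symm

theorem sum_tupleProd_id (ψ : ℝ → ℝ → ℝ) (t x : ℝ) :
    ∑ Z, tupleProd (fun c => c.eval f ψ) (Code.id (n := n)) (Z, t, x) = f (jet n ψ t x) := by
  refine (Fintype.sum_unique (ι := Unit) _).trans ?_
  simp [tupleProd, mech, eval_fStar]

theorem sum_tupleProd_star (hf : ContDiff ℝ (⊤ : ℕ∞) f) {ψ : ℝ → ℝ → ℝ} {t : ℝ}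
    (hψ : ContDiff ℝ (⊤ : ℕ∞) (ψ t)) (x : ℝ) (a : ℝˣ) (α : Fin (n + 1) → ℕ) :
    ∑ Z, tupleProd (fun c => c.eval f ψ) (Code.star a α) (Z, t, x)
      = a * (∑ q : Fin (n + 1), partialZ q (mixedPartial α f) (jet n ψ t x)
            * iteratedDeriv q (fun y => f (jet n ψ t y)) x)
        - 1 / 2 * (a * ∑ q : Fin (n + 1), ∑ r : Fin (n + 1),
            partialZ r (partialZ q (mixedPartial α f)) (jet n ψ t x)
              * iteratedDeriv (r + 1) (ψ t) x * iteratedDeriv (q + 1) (ψ t) x) := by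
  have hs (q : Fin (n + 1)) : mixedPartial (α + Pi.single q 1) f
      = partialZ q (mixedPartial α f) := mixedPartial_add_single α q hf
  have hs2 (q r : Fin (n + 1)) : mixedPartial (α + Pi.single q 1 + Pi.single r 1) f
      = partialZ r (partialZ q (mixedPartial α f)) := by
    rw [mixedPartial_add_single _ r hf, hs]
  have e1 : tupleProd (fun c => c.eval f ψ) (Code.star a α) (.inl (), t, x)
      = a * (partialZ 0 (mixedPartial α f) (jet n ψ t x) * f (jet n ψ t x)) := by
    simp only [tupleProd, mech, List.map_cons, List.prod_cons, List.map_nil, List.prod_nil,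
        eval_fStar]
    simp only [Code.eval, hs]
    ring
  have e2 (k : Fin n) (m : FdBIdx n ((k : ℕ) + 1)) :
      tupleProd (fun c => c.eval f ψ) (Code.star a α) (.inr (.inl ⟨k, m⟩), t, x)
      = a * (partialZ k.succ (mixedPartial α f) (jet n ψ t x)
        * (m.tuple.map fun z => z.eval f ψ t x).prod) := by
    simp only [tupleProd, mech, List.map_cons, List.prod_cons]
    rw [← mul_assoc, ← hs]
    rfl
  have e3 (q r : Fin (n + 1)) :
      tupleProd (fun c => c.eval f ψ) (Code.star a α) (.inr (.inr (q, r)), t, x)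
      = -(1 / 2 * (a * (partialZ r (partialZ q (mixedPartial α f)) (jet n ψ t x)
              * iteratedDeriv (r + 1) (ψ t) x * iteratedDeriv (q + 1) (ψ t) x))) := by
    simp only [tupleProd, mech, List.map_cons, List.prod_cons, List.map_nil, List.prod_nil]
    simp only [Code.eval, hs2, Units.val_mul, Units.val_neg, Units.val_mk0]
    ring
  rw [sum_mechIdx_star, e1]
  simp only [e2, e3, ← Finset.mul_sum, Finset.sum_neg_distrib]
  rw [Fin.sum_univ_succ (fun q : Fin (n + 1) => partialZ q (mixedPartial α f) (jet n ψ t x)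
            * iteratedDeriv q (fun y => f (jet n ψ t y)) x)]
  simp only [Fin.val_succ, Fin.val_zero, iteratedDeriv_zero,
    ← iteratedDeriv_comp_jet hf hψ]
  ring

/-- The mechanism is designed so that `∂_t c(u) + ½ ∂_x² c(u) + ∑_{Z ∈ M(c)} ∏_{z ∈ Z} z(u) = 0`
for every code `c`. -/
theorem hasDerivWithinAt_eval (hf : ContDiff ℝ (⊤ : ℕ∞) f) (hu : IsC1Infty T u)
    (hpde : ∀ t ∈ Icc 0 T, ∀ x, derivWithin (fun s => u s x) (Icc 0 T) t
      + 1 / 2 * iteratedDeriv 2 (u t) x + f (jet n u t x) = 0) (c : Code n) :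
    ∀ t ∈ Icc 0 T, ∀ x, HasDerivWithinAt (fun s => c.eval f u s x)
      (-(1 / 2 * iteratedDeriv 2 (c.eval f u t) x)
        - ∑ Z, tupleProd (fun c => c.eval f u) c (Z, t, x)) (Icc 0 T) t := by
  intro t ht x
  have hD := fun k => hasDerivWithinAt_iteratedDeriv hf hu hpde k t ht x
  cases c with
  | id =>
    rw [sum_tupleProd_id]
    have h0 := hD 0
    simp only [iteratedDeriv_zero, zero_add] at h0
    exact h0
  | dx k hk =>
    rw [sum_tupleProd_dx hf (hu.smooth_space t ht)]
    have e : iteratedDeriv 2 ((Code.dx (n := n) k hk).eval f u t) x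
        = iteratedDeriv (k + 2) (u t) x := by
      rw [iteratedDeriv_eq_iterate, iteratedDeriv_eq_iterate, add_comm, Function.iterate_add_apply,
        ← iteratedDeriv_eq_iterate (n := k)]
      rfl
    rw [e]
    exact hD k
  | star a α =>
    have hh : ContDiff ℝ (⊤ : ℕ∞) (mixedPartial α f) := contDiff_mixedPartial α hf
    have h0 := (hasDerivWithinAt_comp_curve hh (y := fun s => jet n u s x)
      (fun q => hD q)).const_mul (a : ℝ)
    have e2 : iteratedDeriv 2 ((Code.star a α).eval f u t) x
        = a * iteratedDeriv 2 (fun y => mixedPartial α f (jet n u t y)) x := by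
      have := (hh.comp (contDiff_jet (n := n) hu ht)).contDiffAt (x := x)
      exact iteratedDeriv_const_mul (a : ℝ)
        (this.of_le (WithTop.coe_le_coe.2 (le_top : (2 : ℕ∞) ≤ ⊤)))
    rw [sum_tupleProd_star hf (hu.smooth_space t ht), e2, iteratedDeriv_two_comp_jet hh hu ht]
    refine h0.congr_deriv ?_
    simp only [Finset.sum_add_distrib, Finset.sum_mul, mul_sub, mul_neg, Finset.sum_sub_distrib,
      Finset.sum_neg_distrib]
    have e3 : ∑ q : Fin (n + 1), partialZ q (mixedPartial α f) (jet n u t x)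
          * (1 / 2 * iteratedDeriv (q + 2) (u t) x)
        = 1 / 2 * ∑ q : Fin (n + 1), partialZ q (mixedPartial α f) (jet n u t x)
          * iteratedDeriv (q + 2) (u t) x := by
      rw [Finset.mul_sum]
      exact Finset.sum_congr rfl fun q _ => by ring
    rw [e3]
    ring

end Evolution

/-! ### Integrability against the heat kernel -/

theorem heatKernel_eq_gaussianPDFReal {s : ℝ} (hs : 0 ≤ s) (x y : ℝ) :
    heatKernel s (y - x) = gaussianPDFReal x s.toNNReal y := by
  rw [heatKernel, gaussianPDFReal, Real.coe_toNNReal _ hs, div_eq_inv_mul]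

theorem integrable_heatKernel {s : ℝ} (hs : 0 ≤ s) (x : ℝ) :
    Integrable fun y => heatKernel s (y - x) := by
  simp only [heatKernel_eq_gaussianPDFReal hs]
  exact integrable_gaussianPDFReal _ _

theorem integral_heatKernel {s : ℝ} (hs : 0 < s) (x : ℝ) : ∫ y, heatKernel s (y - x) = 1 := by
  simp only [heatKernel_eq_gaussianPDFReal hs.le]
  exact integral_gaussianPDFReal_eq_one _ (Real.toNNReal_pos.2 hs).ne'

instance (η : ℝ) : IsFiniteMeasure (gaussWeight η) := by
  refine isFiniteMeasure_withDensity_ofReal ?_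
  rcases le_or_gt 0 η with h | h
  · simpa using (integrable_heatKernel h 0).2
  · have : heatKernel η = 0 := by
      funext x
      rw [heatKernel, Real.sqrt_eq_zero_of_nonpos, div_zero]
      · rfl
      · nlinarith [Real.pi_pos]
    rw [this]
    exact hasFiniteIntegral_zero ..

instance (T η : ℝ) : IsFiniteMeasure (spaceTimeWeight T η) := by
  unfold spaceTimeWeight; infer_instance

/-- Up to the factor `√s`, the heat kernels up to time `T` are dominated by a single Gaussian
weight. -/
theorem sqrt_mul_heatKernel_le {s T : ℝ} (hs : 0 < s) (hsT : s ≤ T) (x y : ℝ) :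
    √s * heatKernel s (y - x) ≤ √(2 * T) * Real.exp (x ^ 2 / (2 * T)) * heatKernel (2 * T) y := by
  have hT : 0 < T := hs.trans_le hsT
  have h1 : √s * heatKernel s (y - x) = Real.exp (-(y - x) ^ 2 / (2 * s)) / √(2 * Real.pi) := by
    have : 0 < √s := Real.sqrt_pos.2 hs
    rw [heatKernel, Real.sqrt_mul (by positivity)]
    field_simp
  have h2 (S : ℝ) (hS : 0 < S) : √S * Real.exp (x ^ 2 / (2 * T)) * heatKernel S y
      = Real.exp (x ^ 2 / (2 * T) + -y ^ 2 / (2 * S)) / √(2 * Real.pi) := by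
    have : 0 < √S := Real.sqrt_pos.2 hS
    rw [heatKernel, Real.sqrt_mul (by positivity), Real.exp_add]
    field_simp
  rw [h1, h2 _ (by positivity)]
  gcongr
  have e1 : (y - x) ^ 2 / (2 * T) ≤ (y - x) ^ 2 / (2 * s) := by gcongr
  have e2 : x ^ 2 / (2 * T) + -y ^ 2 / (2 * (2 * T)) + (y - x) ^ 2 / (2 * T)
      = (y - 2 * x) ^ 2 / (2 * (2 * T)) := by
    field_simp; ring
  have e3 : 0 ≤ (y - 2 * x) ^ 2 / (2 * (2 * T)) := by positivity
  rw [neg_div]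
  linarith

theorem integrable_rpow_mul_heatKernel {T t : ℝ} (htT : t ≤ T) (x : ℝ) :
    Integrable (fun p : ℝ × ℝ => (p.1 - t) ^ (-(1 / 2) : ℝ) * heatKernel (p.1 - t) (p.2 - x))
      ((volume.restrict (Ioc t T)).prod volume) := by
  have hm : Measurable fun p : ℝ × ℝ =>
      (p.1 - t) ^ (-(1 / 2) : ℝ) * heatKernel (p.1 - t) (p.2 - x) :=
    (by fun_prop : Measurable fun p : ℝ × ℝ => (p.1 - t) ^ (-(1 / 2) : ℝ)).mul
      (measurable_heatKernel_sub t x)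
  rw [integrable_prod_iff hm.aestronglyMeasurable]
  constructor
  · filter_upwards [ae_restrict_mem measurableSet_Ioc] with s hs
    exact (integrable_heatKernel (by linarith [hs.1]) x).const_mul _
  · have h1 : IntegrableOn (fun s : ℝ => (s - t) ^ (-(1 / 2) : ℝ)) (Ioc t T) := by
      have := (intervalIntegral.intervalIntegrable_rpow' (a := 0) (b := T - t)
        (r := -(1 / 2)) (by norm_num)).comp_sub_right t
      simp only [zero_add, sub_add_cancel] at this
      exact (intervalIntegrable_iff_integrableOn_Ioc_of_le htT).1 this
    refine h1.congr ?_
    filter_upwards [ae_restrict_mem measurableSet_Ioc] with s hs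
    have h0 : 0 < s - t := by linarith [hs.1]
    have : ∀ y, ‖(s - t) ^ (-(1 / 2) : ℝ) * heatKernel (s - t) (y - x)‖
        = (s - t) ^ (-(1 / 2) : ℝ) * heatKernel (s - t) (y - x) := fun y =>
      Real.norm_of_nonneg (mul_nonneg (Real.rpow_nonneg h0.le _) (heatKernel_nonneg _ _))
    simp only [this]
    rw [integral_const_mul, integral_heatKernel h0, mul_one]

theorem kernelMeasure_absolutelyContinuous (T t x : ℝ) :
    kernelMeasure T t x ≪ (volume.restrict (Ioc t T)).prod volume :=
  withDensity_absolutelyContinuous _ _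

theorem aestronglyMeasurable_of_continuousOn_strip {T t : ℝ} (ht : 0 ≤ t) {g : ℝ → ℝ → ℝ}
    (hg : ContinuousOn (fun p : ℝ × ℝ => g p.1 p.2) (Icc 0 T ×ˢ univ)) :
    AEStronglyMeasurable (fun p : ℝ × ℝ => g p.1 p.2)
      ((volume.restrict (Ioc t T)).prod volume) := by
  have h := (hg.mono (prod_mono_left (Ioc_subset_Icc_self.trans (Icc_subset_Icc_left ht)) :
    Ioc t T ×ˢ univ ⊆ Icc 0 T ×ˢ univ)).aestronglyMeasurable (μ := volume)
    (measurableSet_Ioc.prod MeasurableSet.univ)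
  rwa [Measure.volume_eq_prod, ← Measure.prod_restrict, Measure.restrict_univ] at h

theorem ae_kernelMeasure_mem (T t x : ℝ) : ∀ᵐ p ∂(kernelMeasure T t x), p.1 ∈ Ioc t T := by
  refine (kernelMeasure_absolutelyContinuous T t x).ae_le ?_
  exact Measure.quasiMeasurePreserving_fst.ae (ae_restrict_mem measurableSet_Ioc)

instance (T t x : ℝ) : IsFiniteMeasure (kernelMeasure T t x) := by
  rcases le_or_gt t T with htT | htT
  swap
  · rw [kernelMeasure, Ioc_eq_empty (not_lt.2 htT.le)]
    simp only [Measure.restrict_empty, Measure.zero_prod, withDensity_zero_left]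
    infer_instance
  refine ⟨?_⟩
  rw [kernelMeasure, withDensity_apply _ MeasurableSet.univ, Measure.restrict_univ,
    lintegral_prod _ (measurable_heatKernel_sub t x).ennreal_ofReal.aemeasurable]
  have : ∀ᵐ s ∂(volume.restrict (Ioc t T)),
      ∫⁻ y, ENNReal.ofReal (heatKernel (s - t) (y - x)) = 1 := by
    filter_upwards [ae_restrict_mem measurableSet_Ioc] with s hs
    have h0 : 0 < s - t := by linarith [hs.1]
    have := lintegral_gaussianReal h0 x (g := fun _ => 1) measurable_const
    simpa using this.symm
  rw [lintegral_congr_ae this]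
  simp

/-- Square integrability for a Gaussian weight gives integrability against the heat kernel: with
`r = √(s - t)`, the bound `2 φ |g| ≤ r⁻¹ φ + r φ g²` leaves the integrable singularity `r⁻¹` in
time, and `r φ` is dominated by the weight. -/
theorem integrable_kernelMeasure_of_memLp {T t : ℝ} (ht : t ∈ Ico 0 T) (x : ℝ) {g : ℝ → ℝ → ℝ}
    (hgc : ContinuousOn (fun p : ℝ × ℝ => g p.1 p.2) (Icc 0 T ×ˢ univ))
    (hg : MemLp (fun p : ℝ × ℝ => g p.1 p.2) 2 (spaceTimeWeight T (2 * T))) :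
    Integrable (fun p : ℝ × ℝ => g p.1 p.2) (kernelMeasure T t x) := by
  rw [integrable_kernelMeasure_iff]
  have hw : Measurable (heatKernel (2 * T)) :=
    measurable_heatKernel.comp (f := fun y : ℝ => (2 * T, y)) (by fun_prop)
  have h2 : Integrable (fun p : ℝ × ℝ => heatKernel (2 * T) p.2 * g p.1 p.2 ^ 2)
      ((volume.restrict (Ioc t T)).prod volume) := by
    have h := hg.integrable_sq
    rw [spaceTimeWeight, gaussWeight, prod_withDensity_right hw.ennreal_ofReal,
      integrable_withDensity_iff_integrable_smul' (by fun_prop) (by simp)] at h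
    simp only [ENNReal.toReal_ofReal (heatKernel_nonneg _ _), smul_eq_mul] at h
    exact h.mono_measure (Measure.prod_mono (Measure.restrict_mono
      (Ioc_subset_Icc_self.trans (Icc_subset_Icc_left ht.1)) le_rfl) le_rfl)
  refine (((integrable_rpow_mul_heatKernel ht.2.le x).add
    (h2.const_mul (√(2 * T) * Real.exp (x ^ 2 / (2 * T))))).const_mul (1 / 2)).mono'
    ((measurable_heatKernel_sub t x).aestronglyMeasurable.mul
      (aestronglyMeasurable_of_continuousOn_strip ht.1 hgc)) ?_
  have hmem : ∀ᵐ p ∂((volume.restrict (Ioc t T)).prod (volume : Measure ℝ)), p.1 ∈ Ioc t T :=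
    Measure.quasiMeasurePreserving_fst.ae (ae_restrict_mem measurableSet_Ioc)
  filter_upwards [hmem] with p hp
  have h0 : 0 < p.1 - t := by linarith [hp.1]
  have hk := heatKernel_nonneg (p.1 - t) (p.2 - x)
  have hle := mul_le_mul_of_nonneg_right (sqrt_mul_heatKernel_le h0
    (by linarith [hp.2, ht.1] : p.1 - t ≤ T) x p.2) (sq_nonneg (g p.1 p.2))
  have hr : (p.1 - t) ^ (-(1 / 2) : ℝ) = (√(p.1 - t))⁻¹ := by
    rw [Real.rpow_neg h0.le, Real.sqrt_eq_rpow]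
  have hs : 0 < √(p.1 - t) := Real.sqrt_pos.2 h0
  rw [norm_mul, Real.norm_of_nonneg hk, Pi.add_apply, hr, Real.norm_eq_abs]
  have key : 2 * |g p.1 p.2| ≤ (√(p.1 - t))⁻¹ + √(p.1 - t) * g p.1 p.2 ^ 2 := by
    rw [← sub_nonneg]
    have : (√(p.1 - t))⁻¹ + √(p.1 - t) * g p.1 p.2 ^ 2 - 2 * |g p.1 p.2|
        = (√(p.1 - t))⁻¹ * (1 - √(p.1 - t) * |g p.1 p.2|) ^ 2 := by
      rw [← sq_abs (g p.1 p.2)]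
      field_simp
      ring
    rw [this]
    positivity
  nlinarith [mul_le_mul_of_nonneg_left key hk]

/-! ### Functions of moderate growth -/

/-- A continuous function on `[0,T] × ℝ` all of whose powers are integrable for all Gaussian
weights. These functions form an algebra. -/
structure IsModerate (T : ℝ) (g : ℝ → ℝ → ℝ) : Prop where
  continuousOn : ContinuousOn (fun p : ℝ × ℝ => g p.1 p.2) (Icc 0 T ×ˢ univ)
  memLp : ∀ p : ℕ, 1 ≤ p → ∀ η : ℝ, 0 < η →
    MemLp (fun z : ℝ × ℝ => g z.1 z.2) p (spaceTimeWeight T η)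

namespace IsModerate

variable {T : ℝ} {g h : ℝ → ℝ → ℝ}

theorem const (a : ℝ) : IsModerate T fun _ _ => a :=
  ⟨continuousOn_const, fun _ _ _ _ => memLp_const a⟩

theorem add (hg : IsModerate T g) (hh : IsModerate T h) : IsModerate T fun t x => g t x + h t x :=
  ⟨hg.continuousOn.add hh.continuousOn,
    fun p hp η hη => (hg.memLp p hp η hη).add (hh.memLp p hp η hη)⟩

theorem mul (hg : IsModerate T g) (hh : IsModerate T h) : IsModerate T fun t x => g t x * h t x :=
  ⟨hg.continuousOn.mul hh.continuousOn, fun p hp η hη => by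
    have : ENNReal.HolderTriple ((2 * p : ℕ) : ℝ≥0∞) ((2 * p : ℕ) : ℝ≥0∞) (p : ℝ≥0∞) := ⟨by
      have h0 : (p : ℝ≥0∞) ≠ 0 := by positivity
      rw [Nat.cast_mul, ENNReal.mul_inv (by simp) (by simp), ← add_mul, Nat.cast_ofNat,
        ENNReal.inv_two_add_inv_two, one_mul]⟩
    exact (hh.memLp (2 * p) (by omega) η hη).mul (hg.memLp (2 * p) (by omega) η hη)⟩

theorem sum {ι : Type*} {s : Finset ι} {g : ι → ℝ → ℝ → ℝ} (hg : ∀ i ∈ s, IsModerate T (g i)) :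
    IsModerate T fun t x => ∑ i ∈ s, g i t x := by
  classical
  induction s using Finset.induction_on with
  | empty => simpa using const (T := T) 0
  | insert i s hi ih =>
    simp only [Finset.sum_insert hi]
    exact (hg i (Finset.mem_insert_self i s)).add
      (ih fun j hj => hg j (Finset.mem_insert_of_mem hj))

theorem list_prod {ι : Type*} {l : List ι} {g : ι → ℝ → ℝ → ℝ} (hg : ∀ i ∈ l, IsModerate T (g i)) :
    IsModerate T fun t x => (l.map fun i => g i t x).prod := by
  induction l with
  | nil => simpa using const (T := T) 1
  | cons i l ih =>
    simp only [List.map_cons, List.prod_cons]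
    exact (hg i (by simp)).mul (ih fun j hj => hg j (by simp [hj]))

theorem integrable_kernelMeasure (hg : IsModerate T g) {t : ℝ} (ht : t ∈ Ico 0 T) (x : ℝ) :
    Integrable (fun p : ℝ × ℝ => g p.1 p.2) (kernelMeasure T t x) :=
  integrable_kernelMeasure_of_memLp ht x hg.continuousOn (by
    simpa using hg.memLp 2 (by norm_num) (2 * T) (by linarith [ht.1, ht.2]))

end IsModerate

section Eval

variable {n : ℕ} {T : ℝ} {f : (Fin (n + 1) → ℝ) → ℝ} {φ : ℝ → ℝ} {u : ℝ → ℝ → ℝ}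

theorem AssumptionA.isModerate_iteratedDeriv (hA : AssumptionA T f φ u) (k : ℕ) :
    IsModerate T fun t x => iteratedDeriv k (u t) x :=
  ⟨hA.solution.regular.continuous_space k, hA.memLp_u k⟩

theorem AssumptionA.isModerate_mixedPartial (hA : AssumptionA T f φ u) (α : Fin (n + 1) → ℕ) :
    IsModerate T fun t x => mixedPartial α f (jet n u t x) :=
  ⟨(contDiff_mixedPartial α hA.smooth_f).continuous.comp_continuousOn
    (continuousOn_jet hA.solution.regular), hA.memLp_f α⟩

theorem AssumptionA.isModerate_eval (hA : AssumptionA T f φ u) (c : Code n) :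
    IsModerate T (c.eval f u) := by
  cases c with
  | id =>
    have h := hA.isModerate_iteratedDeriv 0
    simp only [iteratedDeriv_zero] at h
    exact h
  | star a α => exact (IsModerate.const (a : ℝ)).mul (hA.isModerate_mixedPartial α)
  | dx k hk => exact hA.isModerate_iteratedDeriv k

theorem AssumptionA.isModerate_tupleProd (hA : AssumptionA T f φ u) (c : Code n) (Z : MechIdx c) :
    IsModerate T fun t x => tupleProd (fun c => c.eval f u) c (Z, t, x) :=
  IsModerate.list_prod (l := mech c Z) (g := fun c => c.eval f u) fun z _ => hA.isModerate_eval z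

theorem AssumptionA.isModerate_deriv_eval (hA : AssumptionA T f φ u) (c : Code n) :
    ∃ g, IsModerate T g ∧ ∀ t ∈ Icc 0 T, ∀ x, deriv (c.eval f u t) x = g t x := by
  have hu := hA.solution.regular
  cases c with
  | id =>
    refine ⟨_, hA.isModerate_iteratedDeriv 1, fun t _ x => ?_⟩
    rw [iteratedDeriv_one]
    rfl
  | dx k hk =>
    refine ⟨_, hA.isModerate_iteratedDeriv (k + 1), fun t _ x => ?_⟩
    rw [iteratedDeriv_succ]
    rfl
  | star a α =>
    have hh := contDiff_mixedPartial α hA.smooth_f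
    refine ⟨_, (IsModerate.const (a : ℝ)).mul (IsModerate.sum (s := Finset.univ)
      fun (q : Fin (n + 1)) _ => (hA.isModerate_mixedPartial (α + Pi.single q 1)).mul
        (hA.isModerate_iteratedDeriv (q + 1))), fun t ht x => ?_⟩
    have := ((hasDerivAt_comp_jet hh hu ht x).const_mul (a : ℝ)).deriv
    simp only [mixedPartial_add_single _ _ hA.smooth_f]
    exact this

theorem AssumptionA.continuousOn_iteratedDeriv_two_eval (hA : AssumptionA T f φ u) (c : Code n) :
    ContinuousOn (fun p : ℝ × ℝ => iteratedDeriv 2 (c.eval f u p.1) p.2) (Icc 0 T ×ˢ univ) := by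
  have hu := hA.solution.regular
  cases c with
  | id => exact hu.continuous_space 2
  | dx k hk =>
    refine (hu.continuous_space (2 + k)).congr fun p _ => ?_
    change iteratedDeriv 2 (iteratedDeriv k (u p.1)) p.2 = _
    simp only [iteratedDeriv_eq_iterate, Function.iterate_add_apply]
  | star a α =>
    have hh := contDiff_mixedPartial α hA.smooth_f
    have hc {h : (Fin (n + 1) → ℝ) → ℝ} (hh : ContDiff ℝ (⊤ : ℕ∞) h) :=
      hh.continuous.comp_continuousOn (continuousOn_jet hu)
    refine (continuousOn_const (c := (a : ℝ)).mul (continuousOn_finsetSum Finset.univ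
      fun (q : Fin (n + 1)) _ => ((continuousOn_finsetSum Finset.univ fun (r : Fin (n + 1)) _ =>
        (hc (contDiff_partialZ r (contDiff_partialZ q hh))).mul (hu.continuous_space (r + 1))).mul
        (hu.continuous_space (q + 1))).add
        ((hc (contDiff_partialZ q hh)).mul (hu.continuous_space (q + 2))))).congr fun p hp => ?_
    refine Eq.trans ?_ (congrArg ((a : ℝ) * ·) (iteratedDeriv_two_comp_jet hh hu hp.1 p.2))
    have := (hh.comp (contDiff_jet (n := n) hu hp.1)).contDiffAt (x := p.2)
    exact iteratedDeriv_const_mul (a : ℝ)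
      (this.of_le (WithTop.coe_le_coe.2 (le_top : (2 : ℕ∞) ≤ ⊤)))

end Eval

/-! ### The Duhamel formula for compactly supported functions -/

theorem hasDerivAt_heatKernel (s z : ℝ) :
    HasDerivAt (heatKernel s) (-(z / s) * heatKernel s z) z := by
  have h1 : HasDerivAt (fun z : ℝ => -z ^ 2 / (2 * s)) (-(2 * z) / (2 * s)) z := by
    have := ((hasDerivAt_pow 2 z).fun_neg).div_const (2 * s)
    simpa using this
  refine (h1.exp.div_const (√(2 * Real.pi * s))).congr_deriv ?_
  have e : -(2 * z) / (2 * s) = -(z / s) := by rw [neg_div, mul_div_mul_left _ _ two_ne_zero]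
  rw [heatKernel, e]
  ring

theorem hasDerivAt_heatKernel_deriv (s z : ℝ) :
    HasDerivAt (fun z => -(z / s) * heatKernel s z)
      ((z ^ 2 / s ^ 2 - 1 / s) * heatKernel s z) z := by
  have h := (((hasDerivAt_id z).div_const s).fun_neg).fun_mul (hasDerivAt_heatKernel s z)
  refine h.congr_deriv ?_
  simp only [id]
  ring

theorem hasDerivAt_heatKernel_time {s : ℝ} (hs : 0 < s) (z : ℝ) :
    HasDerivAt (fun s => heatKernel s z) (1 / 2 * (z ^ 2 / s ^ 2 - 1 / s) * heatKernel s z) s := by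
  have h1 : HasDerivAt (fun s : ℝ => -z ^ 2 / (2 * s)) (z ^ 2 / (2 * s ^ 2)) s := by
    have := (((hasDerivAt_id s).const_mul 2).fun_inv (by simp; exact hs.ne')).const_mul (-z ^ 2)
    simp only [id] at this
    refine this.congr_deriv ?_
    field_simp
  have hpos : 0 < 2 * Real.pi * s := by positivity
  have h2 : HasDerivAt (fun s : ℝ => √(2 * Real.pi * s))
      (2 * Real.pi / (2 * √(2 * Real.pi * s))) s := by
    have := ((hasDerivAt_id s).const_mul (2 * Real.pi)).sqrt (by simpa using hpos.ne')
    simpa using this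
  have hsq : √(2 * Real.pi * s) ^ 2 = 2 * Real.pi * s := Real.sq_sqrt hpos.le
  have h0 : √(2 * Real.pi * s) ≠ 0 := (Real.sqrt_pos.2 hpos).ne'
  refine (h1.exp.fun_div h2 h0).congr_deriv ?_
  unfold heatKernel
  generalize √(2 * Real.pi * s) = r at *
  have hr : Real.pi = r ^ 2 / (2 * s) := by rw [hsq]; field_simp
  rw [hr]
  field_simp

theorem continuousOn_heatKernel :
    ContinuousOn (fun p : ℝ × ℝ => heatKernel p.1 p.2) (Ioi 0 ×ˢ univ) := by
  unfold heatKernel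
  intro p hp
  have hp1 : (0 : ℝ) < p.1 := hp.1
  refine ContinuousAt.continuousWithinAt ?_
  have h2 : (2 * p.1) ≠ 0 := by positivity
  have h3 : √(2 * Real.pi * p.1) ≠ 0 := (Real.sqrt_pos.2 (by positivity)).ne'
  exact ((by fun_prop : Continuous fun p : ℝ × ℝ => -p.2 ^ 2).continuousAt.div
    (by fun_prop) h2).rexp.div (by fun_prop) h3

theorem integrable_of_continuous_of_eq_zero {R : ℝ} {h : ℝ → ℝ} (hc : Continuous h)
    (hs : ∀ y, R < |y| → h y = 0) : Integrable h := by
  refine hc.integrable_of_hasCompactSupport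
    (HasCompactSupport.intro (isCompact_Icc (a := -R) (b := R)) fun y hy => hs y ?_)
  by_contra hle
  exact hy (abs_le.1 (not_lt.1 hle))

theorem exists_bound_of_eq_zero {T R : ℝ} {g : ℝ → ℝ → ℝ}
    (hg : ContinuousOn (fun p : ℝ × ℝ => g p.1 p.2) (Icc 0 T ×ˢ univ))
    (hs : ∀ s y, R < |y| → g s y = 0) : ∃ C, 0 ≤ C ∧ ∀ s ∈ Icc 0 T, ∀ y, |g s y| ≤ C := by
  obtain ⟨C, hC⟩ := ((isCompact_Icc (a := (0 : ℝ)) (b := T)).prod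
      (isCompact_Icc (a := -R) (b := R))).exists_bound_of_continuousOn
      (hg.mono (prod_mono_right (subset_univ _)))
  refine ⟨max C 0, le_max_right _ _, fun s hs' y => ?_⟩
  rcases le_or_gt |y| R with h | h
  · exact (hC (s, y) ⟨hs', abs_le.1 h⟩).trans (le_max_left _ _)
  · rw [hs s y h, abs_zero]
    exact le_max_right _ _

/-- Rescaling to the standard Gaussian law; the right-hand side is continuous up to `σ = 0`, where
it is `g x`. -/
theorem integral_heatKernel_mul {σ : ℝ} (hσ : 0 < σ) (x : ℝ) {g : ℝ → ℝ} (hg : Continuous g) :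
    ∫ y, heatKernel σ (y - x) * g y = ∫ z, g (x + √σ * z) ∂(gaussianReal 0 1) := by
  have hσ' : σ.toNNReal ≠ 0 := (Real.toNNReal_pos.2 hσ).ne'
  have e : gaussianReal x σ.toNNReal = (gaussianReal 0 1).map fun z => x + √σ * z := by
    have h1 : (gaussianReal 0 1).map (fun z => √σ * z) = gaussianReal 0 σ.toNNReal := by
      rw [gaussianReal_map_const_mul, mul_zero, mul_one]
      congr 1
      ext
      simp [Real.sq_sqrt hσ.le, hσ.le]
    have h2 := gaussianReal_map_const_add (μ := 0) (v := σ.toNNReal) x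
    rw [zero_add, ← h1, Measure.map_map (by fun_prop) (by fun_prop)] at h2
    exact h2.symm
  have h3 := integral_gaussianReal_eq_integral_smul (μ := x) (f := g) hσ'
  rw [e, integral_map (by fun_prop) hg.aestronglyMeasurable] at h3
  rw [h3]
  simp only [heatKernel_eq_gaussianPDFReal hσ.le, smul_eq_mul]

section Compact

variable {T t x R : ℝ} {w w₁ w₂ G : ℝ → ℝ → ℝ}

/-- Time derivative of `s ↦ ∫ φ(s-t,y-x) w(s,y) dy`, for `w` of compact support in space which
solves `∂_s w + ½ ∂_y² w + G = 0`: two integrations by parts cancel the second order terms. -/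
theorem hasDerivAt_integral_heatKernel_mul (ht : 0 ≤ t)
    (hw : ContinuousOn (fun p : ℝ × ℝ => w p.1 p.2) (Icc 0 T ×ˢ univ))
    (hw₁ : ContinuousOn (fun p : ℝ × ℝ => w₁ p.1 p.2) (Icc 0 T ×ˢ univ))
    (hw₂ : ContinuousOn (fun p : ℝ × ℝ => w₂ p.1 p.2) (Icc 0 T ×ˢ univ))
    (hG : ContinuousOn (fun p : ℝ × ℝ => G p.1 p.2) (Icc 0 T ×ˢ univ))
    (hd₁ : ∀ s ∈ Icc 0 T, ∀ y, HasDerivAt (w s) (w₁ s y) y)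
    (hd₂ : ∀ s ∈ Icc 0 T, ∀ y, HasDerivAt (w₁ s) (w₂ s y) y)
    (hdt : ∀ s ∈ Icc 0 T, ∀ y,
      HasDerivWithinAt (fun s => w s y) (-(1 / 2 * w₂ s y) - G s y) (Icc 0 T) s)
    (hsw : ∀ s y, R < |y| → w s y = 0) (hsw₁ : ∀ s y, R < |y| → w₁ s y = 0)
    (hsw₂ : ∀ s y, R < |y| → w₂ s y = 0) (hsG : ∀ s y, R < |y| → G s y = 0)
    {s : ℝ} (hs : s ∈ Ioo t T) :
    HasDerivAt (fun s => ∫ y, heatKernel (s - t) (y - x) * w s y)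
      (-∫ y, heatKernel (s - t) (y - x) * G s y) s := by
  have hsub : Ioo t T ⊆ Icc 0 T := fun r hr => ⟨ht.trans hr.1.le, hr.2.le⟩
  set K : ℝ → ℝ → ℝ := fun s y => 1 / 2 * ((y - x) ^ 2 / (s - t) ^ 2 - 1 / (s - t))
    * heatKernel (s - t) (y - x) with hK
  set D : ℝ → ℝ → ℝ := fun s y =>
    K s y * w s y + heatKernel (s - t) (y - x) * (-(1 / 2 * w₂ s y) - G s y) with hD
  have hkc : ContinuousOn (fun p : ℝ × ℝ => heatKernel (p.1 - t) (p.2 - x)) (Ioo t T ×ˢ univ) :=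
    continuousOn_heatKernel.comp (f := fun p : ℝ × ℝ => (p.1 - t, p.2 - x)) (by fun_prop)
      fun p hp => ⟨sub_pos.2 hp.1.1, mem_univ _⟩
  have hKc : ContinuousOn (fun p : ℝ × ℝ => K p.1 p.2) (Ioo t T ×ˢ univ) := by
    refine (continuousOn_const.mul (ContinuousOn.sub ?_ ?_)).mul hkc
    · exact ContinuousOn.div (by fun_prop) (by fun_prop) fun p hp =>
        pow_ne_zero 2 (sub_pos.2 hp.1.1).ne'
    · exact ContinuousOn.div (by fun_prop) (by fun_prop) fun p hp => (sub_pos.2 hp.1.1).ne'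
  have hmono : Ioo t T ×ˢ (univ : Set ℝ) ⊆ Icc 0 T ×ˢ univ := prod_mono_left hsub
  have hDc : ContinuousOn (fun p : ℝ × ℝ => D p.1 p.2) (Ioo t T ×ˢ univ) :=
    (hKc.mul (hw.mono hmono)).add (hkc.mul
      ((continuousOn_const.mul (hw₂.mono hmono)).neg.sub (hG.mono hmono)))
  have slice {g : ℝ → ℝ → ℝ} (hg : ContinuousOn (fun p : ℝ × ℝ => g p.1 p.2) (Ioo t T ×ˢ univ))
      {r : ℝ} (hr : r ∈ Ioo t T) : Continuous (g r) := by
    rw [← continuousOn_univ]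
    exact hg.comp (f := fun x : ℝ => (r, x)) (by fun_prop) fun x _ => ⟨hr, mem_univ _⟩
  have hsD (r y : ℝ) (hy : R < |y|) : D r y = 0 := by
    simp only [hD, hsw r y hy, hsw₂ r y hy, hsG r y hy]; ring
  obtain ⟨δ, hδ, hball⟩ := Metric.isOpen_iff.1 isOpen_Ioo s hs
  have hcl : Metric.closedBall s (δ / 2) ⊆ Ioo t T :=
    (Metric.closedBall_subset_ball (by linarith)).trans hball
  obtain ⟨C, hC⟩ := ((isCompact_closedBall s (δ / 2)).prod
    (isCompact_Icc (a := -R) (b := R))).exists_bound_of_continuousOn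
    (hDc.mono (prod_mono hcl (subset_univ _)))
  have hmain := hasDerivAt_integral_of_dominated_loc_of_deriv_le (μ := volume)
    (F := fun s y => heatKernel (s - t) (y - x) * w s y) (F' := D) (x₀ := s)
    (s := Metric.ball s (δ / 2)) (bound := (Icc (-R) R).indicator fun _ => C)
    (Metric.ball_mem_nhds s (by linarith))
    (Filter.eventually_of_mem (Ioo_mem_nhds hs.1 hs.2) fun r hr =>
      ((slice (g := fun s y => heatKernel (s - t) (y - x)) hkc hr).mul
        (slice (hw.mono hmono) hr)).aestronglyMeasurable)
    (integrable_of_continuous_of_eq_zero ((slice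
      (g := fun s y => heatKernel (s - t) (y - x)) hkc hs).mul (slice (hw.mono hmono) hs))
      (R := R) fun y hy => by simp [hsw s y hy])
    (slice hDc hs).aestronglyMeasurable
    (Filter.Eventually.of_forall fun y r hr => by
      by_cases hy : y ∈ Icc (-R) R
      · rw [indicator_of_mem hy]
        exact hC (r, y) ⟨Metric.ball_subset_closedBall hr, hy⟩
      · rw [indicator_of_notMem hy, hsD r y, norm_zero]
        exact not_le.1 fun h => hy (abs_le.1 h))
    ((integrable_indicator_iff measurableSet_Icc).2 (by simp))
    (Filter.Eventually.of_forall fun y r hr => by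
      have hr' : r ∈ Ioo t T := hcl (Metric.ball_subset_closedBall hr)
      have h1 := (hasDerivAt_heatKernel_time (sub_pos.2 hr'.1) (y - x)).comp_sub_const r t
      have h2 := (hdt r (hsub hr') y).hasDerivAt (Icc_mem_nhds (ht.trans_lt hr'.1) hr'.2)
      exact h1.fun_mul h2)
  refine hmain.2.congr_deriv ?_
  have hk (y : ℝ) : HasDerivAt (fun y => heatKernel (s - t) (y - x))
      (-((y - x) / (s - t)) * heatKernel (s - t) (y - x)) y :=
    (hasDerivAt_heatKernel (s - t) (y - x)).comp_sub_const y x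
  have hk' (y : ℝ) : HasDerivAt (fun y => -((y - x) / (s - t)) * heatKernel (s - t) (y - x))
      (((y - x) ^ 2 / (s - t) ^ 2 - 1 / (s - t)) * heatKernel (s - t) (y - x)) y :=
    (hasDerivAt_heatKernel_deriv (s - t) (y - x)).comp_sub_const y x
  have hsI : s ∈ Icc 0 T := hsub hs
  have hkcs : Continuous fun y => heatKernel (s - t) (y - x) :=
    slice (g := fun s y => heatKernel (s - t) (y - x)) hkc hs
  have hws := slice (hw.mono hmono) hs
  have hw₁s := slice (hw₁.mono hmono) hs
  have hw₂s := slice (hw₂.mono hmono) hs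
  have hGs := slice (hG.mono hmono) hs
  have hzero : ∫ y, (((y - x) ^ 2 / (s - t) ^ 2 - 1 / (s - t)) * heatKernel (s - t) (y - x) * w s y
      - heatKernel (s - t) (y - x) * w₂ s y) = 0 := by
    refine integral_eq_zero_of_hasDerivAt_of_integrable
      (f := fun y => -((y - x) / (s - t)) * heatKernel (s - t) (y - x) * w s y
        - heatKernel (s - t) (y - x) * w₁ s y) (fun y => ?_)
      (integrable_of_continuous_of_eq_zero (R := R) (by fun_prop) fun y hy => by
        simp [hsw s y hy, hsw₂ s y hy])
      (integrable_of_continuous_of_eq_zero (R := R) (by fun_prop) fun y hy => by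
        simp [hsw s y hy, hsw₁ s y hy])
    refine (((hk' y).fun_mul (hd₁ s hsI y)).fun_sub ((hk y).fun_mul (hd₂ s hsI y))).congr_deriv ?_
    ring
  have hsplit : ∀ y, D s y = 1 / 2 * (((y - x) ^ 2 / (s - t) ^ 2 - 1 / (s - t))
      * heatKernel (s - t) (y - x) * w s y - heatKernel (s - t) (y - x) * w₂ s y)
      - heatKernel (s - t) (y - x) * G s y := fun y => by
    simp only [hD, hK]; ring
  simp only [hsplit]
  rw [integral_sub, integral_const_mul, hzero, mul_zero, zero_sub]
  · exact (integrable_of_continuous_of_eq_zero (R := R) (by fun_prop) fun y hy => by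
        simp [hsw s y hy, hsw₂ s y hy]).const_mul _
  · exact integrable_of_continuous_of_eq_zero (R := R) (by fun_prop) fun y hy => by
        simp [hsG s y hy]

/-- The Duhamel formula for a function of compact support in space: the derivative of
`s ↦ ∫ φ(s-t,y-x) w(s,y) dy` is integrated from `s = t`, where this function is extended by its
limit `w(t,x)`. -/
theorem duhamel_of_compactSupport (ht : t ∈ Ico 0 T)
    (hw : ContinuousOn (fun p : ℝ × ℝ => w p.1 p.2) (Icc 0 T ×ˢ univ))
    (hw₁ : ContinuousOn (fun p : ℝ × ℝ => w₁ p.1 p.2) (Icc 0 T ×ˢ univ))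
    (hw₂ : ContinuousOn (fun p : ℝ × ℝ => w₂ p.1 p.2) (Icc 0 T ×ˢ univ))
    (hG : ContinuousOn (fun p : ℝ × ℝ => G p.1 p.2) (Icc 0 T ×ˢ univ))
    (hd₁ : ∀ s ∈ Icc 0 T, ∀ y, HasDerivAt (w s) (w₁ s y) y)
    (hd₂ : ∀ s ∈ Icc 0 T, ∀ y, HasDerivAt (w₁ s) (w₂ s y) y)
    (hdt : ∀ s ∈ Icc 0 T, ∀ y,
      HasDerivWithinAt (fun s => w s y) (-(1 / 2 * w₂ s y) - G s y) (Icc 0 T) s)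
    (hsw : ∀ s y, R < |y| → w s y = 0) (hsw₁ : ∀ s y, R < |y| → w₁ s y = 0)
    (hsw₂ : ∀ s y, R < |y| → w₂ s y = 0) (hsG : ∀ s y, R < |y| → G s y = 0) :
    w t x = (∫ y, heatKernel (T - t) (y - x) * w T y)
      + ∫ s in t..T, ∫ y, heatKernel (s - t) (y - x) * G s y := by
  have htT : t ≤ T := ht.2.le
  have hsub : Icc t T ⊆ Icc 0 T := Icc_subset_Icc_left ht.1
  set B : ℝ → ℝ := fun s => ∫ z, w s (x + √(s - t) * z) ∂(gaussianReal 0 1) with hB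
  have hBA (s : ℝ) (hs : s ∈ Ioc t T) : B s = ∫ y, heatKernel (s - t) (y - x) * w s y :=
    (integral_heatKernel_mul (sub_pos.2 hs.1) x
      (continuous_space_slice hw (hsub (Ioc_subset_Icc_self hs)))).symm
  have hBt : B t = w t x := by simp [hB]
  have hBc : ContinuousOn B (Icc t T) := by
    obtain ⟨C, _, hC⟩ := exists_bound_of_eq_zero hw hsw
    refine continuousOn_of_dominated (bound := fun _ => C) (fun s hs => ?_) (fun s hs => ?_)
      (integrable_const C) (Filter.Eventually.of_forall fun z => ?_)
    · exact ((continuous_space_slice hw (hsub hs)).comp (by fun_prop)).aestronglyMeasurable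
    · exact Filter.Eventually.of_forall fun z => hC s (hsub hs) _
    · exact hw.comp (f := fun s : ℝ => (s, x + √(s - t) * z)) (by fun_prop)
        fun s hs => ⟨hsub hs, mem_univ _⟩
  have hGi : Integrable (fun p : ℝ × ℝ => G p.1 p.2) (kernelMeasure T t x) := by
    obtain ⟨C, _, hC⟩ := exists_bound_of_eq_zero hG hsG
    refine (integrable_const C).mono' ((aestronglyMeasurable_of_continuousOn_strip ht.1 hG).mono_ac
      (kernelMeasure_absolutelyContinuous T t x)) ?_
    filter_upwards [ae_kernelMeasure_mem T t x] with p hp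
    exact hC p.1 (hsub (Ioc_subset_Icc_self hp)) p.2
  have hint :
      IntervalIntegrable (fun s => -∫ y, heatKernel (s - t) (y - x) * G s y) volume t T := by
    rw [intervalIntegrable_iff_integrableOn_Ioc_of_le htT]
    exact (integrable_kernelMeasure_iff.1 hGi).integral_prod_left.neg
  have hftc := intervalIntegral.integral_eq_sub_of_hasDerivAt_of_le htT hBc (fun s hs =>
    (hasDerivAt_integral_heatKernel_mul (x := x) ht.1 hw hw₁ hw₂ hG hd₁ hd₂ hdt hsw hsw₁ hsw₂ hsG
      hs).congr_of_eventuallyEq (Filter.eventually_of_mem (Ioo_mem_nhds hs.1 hs.2) fun r hr =>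
        hBA r (Ioo_subset_Ioc_self hr))) hint
  rw [intervalIntegral.integral_neg, hBt, hBA T ⟨ht.2, le_rfl⟩] at hftc
  linarith

end Compact

/-! ### The Duhamel formula for the functions `c(u)` -/

/-- A cutoff function with its first two derivatives. -/
theorem exists_cutoff : ∃ (c₀ c₁ c₂ : ℝ → ℝ) (C : ℝ), 0 ≤ C ∧ c₀ 0 = 1 ∧
    Continuous c₀ ∧ Continuous c₁ ∧ Continuous c₂ ∧
    (∀ y, HasDerivAt c₀ (c₁ y) y) ∧ (∀ y, HasDerivAt c₁ (c₂ y) y) ∧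
    (∀ y, 2 < |y| → c₀ y = 0 ∧ c₁ y = 0 ∧ c₂ y = 0) ∧
    ∀ y, |c₀ y| ≤ C ∧ |c₁ y| ≤ C ∧ |c₂ y| ≤ C := by
  let χ : ContDiffBump (0 : ℝ) := ⟨1, 2, one_pos, one_lt_two⟩
  have hχ : ContDiff ℝ (⊤ : ℕ∞) χ := χ.contDiff
  have h1 : ContDiff ℝ (⊤ : ℕ∞) (deriv χ) := (contDiff_infty_iff_deriv.1 hχ).2
  have h2 : ContDiff ℝ (⊤ : ℕ∞) (deriv (deriv χ)) := (contDiff_infty_iff_deriv.1 h1).2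
  have hopen : IsOpen {y : ℝ | 2 < |y|} := isOpen_lt continuous_const continuous_abs
  have z0 : ∀ y : ℝ, 2 < |y| → χ y = 0 := fun y hy =>
    χ.zero_of_le_dist (by rw [Real.dist_0_eq_abs]; exact hy.le)
  have zero_deriv {g : ℝ → ℝ} (hg : ∀ y, 2 < |y| → g y = 0) : ∀ y, 2 < |y| → deriv g y = 0 := by
    intro y hy
    have : g =ᶠ[nhds y] fun _ => 0 := Filter.eventually_of_mem (hopen.mem_nhds hy) hg
    rw [this.deriv_eq, deriv_const]
  have z1 := zero_deriv z0
  have z2 := zero_deriv z1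
  have hb {g : ℝ → ℝ} (hg : Continuous g) (hz : ∀ y, 2 < |y| → g y = 0) :
      ∃ C, 0 ≤ C ∧ ∀ y, |g y| ≤ C := by
    obtain ⟨C, h0, hC⟩ := exists_bound_of_eq_zero (T := 0) (g := fun _ y => g y)
      (hg.comp continuous_snd).continuousOn fun _ => hz
    exact ⟨C, h0, hC 0 ⟨le_rfl, le_rfl⟩⟩
  obtain ⟨C₀, hC₀, b0⟩ := hb hχ.continuous z0
  obtain ⟨C₁, hC₁, b1⟩ := hb h1.continuous z1
  obtain ⟨C₂, hC₂, b2⟩ := hb h2.continuous z2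
  refine ⟨χ, deriv χ, deriv (deriv χ), C₀ + C₁ + C₂, by positivity,
    χ.one_of_mem_closedBall (by simp [χ.rIn_pos.le]), hχ.continuous, h1.continuous, h2.continuous,
    fun y => (hχ.differentiable (by simp) y).hasDerivAt,
    fun y => (h1.differentiable (by simp) y).hasDerivAt,
    fun y hy => ⟨z0 y hy, z1 y hy, z2 y hy⟩, fun y => ⟨?_, ?_, ?_⟩⟩
  · linarith [b0 y]
  · linarith [b1 y]
  · linarith [b2 y]

/-- The Duhamel formula for a function of moderate growth, by truncation in space. -/
theorem duhamel_of_isModerate {T t x : ℝ} {v v₁ v₂ G : ℝ → ℝ → ℝ} (ht : t ∈ Ico 0 T)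
    (hv : IsModerate T v) (hv₁ : IsModerate T v₁)
    (hv₂ : ContinuousOn (fun p : ℝ × ℝ => v₂ p.1 p.2) (Icc 0 T ×ˢ univ)) (hG : IsModerate T G)
    (hd₁ : ∀ s ∈ Icc 0 T, ∀ y, HasDerivAt (v s) (v₁ s y) y)
    (hd₂ : ∀ s ∈ Icc 0 T, ∀ y, HasDerivAt (v₁ s) (v₂ s y) y)
    (hdt : ∀ s ∈ Icc 0 T, ∀ y,
      HasDerivWithinAt (fun s => v s y) (-(1 / 2 * v₂ s y) - G s y) (Icc 0 T) s)
    (hterm : Integrable fun y => heatKernel (T - t) (y - x) * v T y) :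
    v t x = (∫ y, heatKernel (T - t) (y - x) * v T y)
      + ∫ s in t..T, ∫ y, heatKernel (s - t) (y - x) * G s y := by
  obtain ⟨c₀, c₁, c₂, C, hC, h0, k0, k1, k2, d0, d1, hz, hb⟩ := exists_cutoff
  set ε : ℕ → ℝ := fun m => 1 / ((m : ℝ) + 1) with hε
  have εpos (m : ℕ) : 0 < ε m := by simp only [hε]; positivity
  have ε1 (m : ℕ) : ε m ≤ 1 := by
    simp only [hε]
    rw [div_le_one (by positivity)]
    linarith [(Nat.cast_nonneg m : (0 : ℝ) ≤ m)]
  have εlim : Filter.Tendsto ε Filter.atTop (nhds 0) := tendsto_one_div_add_atTop_nhds_zero_nat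
  have hlim {c : ℝ → ℝ} (hc : Continuous c) (y : ℝ) :
      Filter.Tendsto (fun m => c (ε m * y)) Filter.atTop (nhds (c 0)) := by
    have : Filter.Tendsto (fun m => ε m * y) Filter.atTop (nhds 0) := by
      simpa using εlim.mul_const y
    exact (hc.tendsto 0).comp this
  -- the source term of the equation satisfied by the truncated function `c₀ (ε y) v`
  set g : ℕ → ℝ → ℝ → ℝ := fun m s y => c₀ (ε m * y) * G s y - ε m * c₁ (ε m * y) * v₁ s y
    - 1 / 2 * (ε m ^ 2 * c₂ (ε m * y) * v s y) with hg
  have cc {c : ℝ → ℝ} (hc : Continuous c) (m : ℕ) :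
      ContinuousOn (fun p : ℝ × ℝ => c (ε m * p.2)) (Icc 0 T ×ˢ univ) :=
    (hc.comp (by fun_prop)).continuousOn
  have gcont (m : ℕ) : ContinuousOn (fun p : ℝ × ℝ => g m p.1 p.2) (Icc 0 T ×ˢ univ) :=
    (((cc k0 m).mul hG.continuousOn).sub ((continuousOn_const.mul (cc k1 m)).mul
      hv₁.continuousOn)).sub (continuousOn_const.mul ((continuousOn_const.mul (cc k2 m)).mul
        hv.continuousOn))
  have gbound (m : ℕ) (s y : ℝ) : ‖g m s y‖ ≤ C * |G s y| + C * |v₁ s y| + C * |v s y| := by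
    obtain ⟨b0, b1, b2⟩ := hb (ε m * y)
    have e0 := εpos m
    have e2 : ε m ^ 2 ≤ 1 := pow_le_one₀ e0.le (ε1 m)
    have t0 : |c₀ (ε m * y) * G s y| ≤ C * |G s y| := by rw [abs_mul]; gcongr
    have t1 : |ε m * c₁ (ε m * y) * v₁ s y| ≤ C * |v₁ s y| := by
      rw [abs_mul, abs_mul, abs_of_pos e0]
      have : ε m * |c₁ (ε m * y)| ≤ 1 * C := mul_le_mul (ε1 m) b1 (abs_nonneg _) zero_le_one
      rw [one_mul] at this
      gcongr
    have t2 : |1 / 2 * (ε m ^ 2 * c₂ (ε m * y) * v s y)| ≤ C * |v s y| := by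
      rw [abs_mul, abs_mul, abs_mul, abs_of_pos (by positivity : (0 : ℝ) < ε m ^ 2),
        abs_of_pos (by norm_num : (0 : ℝ) < 1 / 2)]
      have : ε m ^ 2 * |c₂ (ε m * y)| ≤ 1 * C := mul_le_mul e2 b2 (abs_nonneg _) zero_le_one
      rw [one_mul] at this
      have h3 := mul_le_mul_of_nonneg_right this (abs_nonneg (v s y))
      have h4 : 0 ≤ ε m ^ 2 * |c₂ (ε m * y)| * |v s y| := by positivity
      linarith
    rw [Real.norm_eq_abs]
    exact (abs_sub _ _).trans (add_le_add ((abs_sub _ _).trans (add_le_add t0 t1)) t2)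
  have hG_int := hG.integrable_kernelMeasure ht x
  have bound_int : Integrable
      (fun p : ℝ × ℝ => C * |G p.1 p.2| + C * |v₁ p.1 p.2| + C * |v p.1 p.2|)
      (kernelMeasure T t x) :=
    ((hG_int.abs.const_mul C).add ((hv₁.integrable_kernelMeasure ht x).abs.const_mul C)).add
      ((hv.integrable_kernelMeasure ht x).abs.const_mul C)
  have gmeas (m : ℕ) : AEStronglyMeasurable (fun p : ℝ × ℝ => g m p.1 p.2) (kernelMeasure T t x) :=
    (aestronglyMeasurable_of_continuousOn_strip ht.1 (gcont m)).mono_ac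
      (kernelMeasure_absolutelyContinuous T t x)
  have g_int (m : ℕ) : Integrable (fun p : ℝ × ℝ => g m p.1 p.2) (kernelMeasure T t x) :=
    bound_int.mono' (gmeas m) (Filter.Eventually.of_forall fun p => gbound m p.1 p.2)
  have key (m : ℕ) : c₀ (ε m * x) * v t x
      = (∫ y, heatKernel (T - t) (y - x) * (c₀ (ε m * y) * v T y))
        + ∫ p, g m p.1 p.2 ∂(kernelMeasure T t x) := by
    have far (y : ℝ) (hy : 2 * ((m : ℝ) + 1) < |y|) : 2 < |ε m * y| := by
      rw [abs_mul, abs_of_pos (εpos m)]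
      simp only [hε]
      rw [one_div_mul_eq_div, lt_div_iff₀ (by positivity)]
      exact hy
    have e0 (y : ℝ) : HasDerivAt (fun y => c₀ (ε m * y)) (ε m * c₁ (ε m * y)) y := by
      have := (d0 (ε m * y)).comp y ((hasDerivAt_id y).const_mul (ε m))
      exact this.congr_deriv (by ring)
    have e1 (y : ℝ) : HasDerivAt (fun y => ε m * c₁ (ε m * y)) (ε m ^ 2 * c₂ (ε m * y)) y := by
      have := ((d1 (ε m * y)).comp y ((hasDerivAt_id y).const_mul (ε m))).const_mul (ε m)
      exact this.congr_deriv (by ring)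
    have := duhamel_of_compactSupport (x := x) (R := 2 * ((m : ℝ) + 1))
      (w := fun s y => c₀ (ε m * y) * v s y)
      (w₁ := fun s y => ε m * c₁ (ε m * y) * v s y + c₀ (ε m * y) * v₁ s y)
      (w₂ := fun s y => (ε m ^ 2 * c₂ (ε m * y) * v s y + ε m * c₁ (ε m * y) * v₁ s y)
        + (ε m * c₁ (ε m * y) * v₁ s y + c₀ (ε m * y) * v₂ s y))
      (G := g m) ht ((cc k0 m).mul hv.continuousOn)
      (((continuousOn_const.mul (cc k1 m)).mul hv.continuousOn).add
        ((cc k0 m).mul hv₁.continuousOn))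
      ((((continuousOn_const.mul (cc k2 m)).mul hv.continuousOn).add
        ((continuousOn_const.mul (cc k1 m)).mul hv₁.continuousOn)).add
        (((continuousOn_const.mul (cc k1 m)).mul hv₁.continuousOn).add ((cc k0 m).mul hv₂)))
      (gcont m)
      (fun s hs y => (e0 y).fun_mul (hd₁ s hs y))
      (fun s hs y => ((e1 y).fun_mul (hd₁ s hs y)).fun_add ((e0 y).fun_mul (hd₂ s hs y)))
      (fun s hs y => ((hdt s hs y).const_mul (c₀ (ε m * y))).congr_deriv (by
        simp only [hg]; ring))
      (fun s y hy => by simp [(hz _ (far y hy)).1])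
      (fun s y hy => by simp [(hz _ (far y hy)).1, (hz _ (far y hy)).2.1])
      (fun s y hy => by simp [(hz _ (far y hy)).1, (hz _ (far y hy)).2.1, (hz _ (far y hy)).2.2])
      (fun s y hy => by
        simp [hg, (hz _ (far y hy)).1, (hz _ (far y hy)).2.1, (hz _ (far y hy)).2.2])
    rw [this, integral_kernelMeasure ht.2.le (g_int m)]
  have lim1 : Filter.Tendsto (fun m => c₀ (ε m * x) * v t x) Filter.atTop (nhds (v t x)) := by
    simpa [h0] using (hlim k0 x).mul_const (v t x)
  have lim2 : Filter.Tendsto (fun m => ∫ y, heatKernel (T - t) (y - x) * (c₀ (ε m * y) * v T y))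
      Filter.atTop (nhds (∫ y, heatKernel (T - t) (y - x) * v T y)) := by
    refine tendsto_integral_of_dominated_convergence
      (fun y => C * |heatKernel (T - t) (y - x) * v T y|) (fun m => ?_) (hterm.abs.const_mul C)
      (fun m => Filter.Eventually.of_forall fun y => ?_) (Filter.Eventually.of_forall fun y => ?_)
    · have e : (fun y => heatKernel (T - t) (y - x) * (c₀ (ε m * y) * v T y))
          = fun y => c₀ (ε m * y) * (heatKernel (T - t) (y - x) * v T y) := by
        funext y; ring
      rw [e]
      exact (k0.comp (by fun_prop : Continuous fun y => ε m * y)).aestronglyMeasurable.mul hterm.1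
    · have e : heatKernel (T - t) (y - x) * (c₀ (ε m * y) * v T y)
          = c₀ (ε m * y) * (heatKernel (T - t) (y - x) * v T y) := by ring
      rw [e, Real.norm_eq_abs, abs_mul]
      exact mul_le_mul_of_nonneg_right (hb _).1 (abs_nonneg _)
    · simpa [h0] using ((hlim k0 y).mul_const (v T y)).const_mul (heatKernel (T - t) (y - x))
  have lim3 : Filter.Tendsto (fun m => ∫ p, g m p.1 p.2 ∂(kernelMeasure T t x)) Filter.atTop
      (nhds (∫ p, G p.1 p.2 ∂(kernelMeasure T t x))) := by
    refine tendsto_integral_of_dominated_convergence _ gmeas bound_int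
      (fun m => Filter.Eventually.of_forall fun p => gbound m p.1 p.2)
      (Filter.Eventually.of_forall fun p => ?_)
    have := (((hlim k0 p.2).mul_const (G p.1 p.2)).sub
      ((εlim.mul (hlim k1 p.2)).mul_const (v₁ p.1 p.2))).sub
      ((((εlim.pow 2).mul (hlim k2 p.2)).mul_const (v p.1 p.2)).const_mul (1 / 2))
    refine this.trans (le_of_eq ?_)
    simp [h0]
  rw [← integral_kernelMeasure ht.2.le hG_int]
  refine tendsto_nhds_unique lim1 ?_
  simp only [key]
  exact lim2.add lim3

section

variable {n : ℕ} {T : ℝ} {f : (Fin (n + 1) → ℝ) → ℝ} {φ : ℝ → ℝ} {u : ℝ → ℝ → ℝ}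

/-- The family `c(u)` solves the system. -/
theorem AssumptionA.isSystemSolution_eval (hA : AssumptionA T f φ u)
    (hterm : ∀ c : Code n, ∀ t ∈ Ico 0 T, ∀ x,
      Integrable fun y => heatKernel (T - t) (y - x) * c.eval f u T y) :
    IsSystemSolution T f u fun c => c.eval f u where
  terminal _ _ := rfl
  integrable_terminal := hterm
  integrable_source c t ht x Z :=
    integrable_kernelMeasure_iff.1 ((hA.isModerate_tupleProd c Z).integrable_kernelMeasure ht x)
  equation c t ht x := by
    have hu := hA.solution.regular
    obtain ⟨v₁, hv₁, hv₁d⟩ := hA.isModerate_deriv_eval c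
    have hG : IsModerate T fun s y => ∑ Z, tupleProd (fun c => c.eval f u) c (Z, s, y) :=
      IsModerate.sum fun Z _ => hA.isModerate_tupleProd c Z
    have hsm {s : ℝ} (hs : s ∈ Icc 0 T) := contDiff_eval hA.smooth_f hu c hs
    have hv₁e {s : ℝ} (hs : s ∈ Icc 0 T) : v₁ s = iteratedDeriv 1 (c.eval f u s) := by
      funext y
      rw [iteratedDeriv_one, hv₁d s hs]
    rw [duhamel_of_isModerate (x := x) ht (hA.isModerate_eval c) hv₁
      (hA.continuousOn_iteratedDeriv_two_eval c) hG
      (fun s hs y => by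
        rw [hv₁e hs]
        simpa using hasDerivAt_iteratedDeriv (hsm hs) 0 y)
      (fun s hs y => by
        rw [hv₁e hs]
        exact hasDerivAt_iteratedDeriv (hsm hs) 1 y)
      (hasDerivWithinAt_eval hA.smooth_f hu hA.solution.pde c) (hterm c t ht x)]
    congr 1
    have hZ (Z : MechIdx c) := (hA.isModerate_tupleProd c Z).integrable_kernelMeasure ht x
    rw [← integral_kernelMeasure ht.2.le (hG.integrable_kernelMeasure ht x),
      integral_finsetSum _ fun Z _ => hZ Z]
    refine Finset.sum_congr rfl fun Z _ => ?_
    rw [integral_kernelMeasure ht.2.le (hZ Z)]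
    rfl

end

end CodingTree

end

theorem theorem1 (n : ℕ) (T : ℝ) (hT : 0 < T)
    (f : (Fin (n + 1) → ℝ) → ℝ) (φ : ℝ → ℝ) (u : ℝ → ℝ → ℝ)
    (hA : AssumptionA T f φ u)
    (ρ : ℝ → ℝ) (hρ_meas : Measurable ρ) (hρ_pos : ∀ s, 0 < s → 0 < ρ s)
    {Ω : Type*} [MeasurableSpace Ω] (P : Measure Ω) [IsProbabilityMeasure P]
    (τ : Label → Ω → ℝ) (I : (c : Code n) → Label → Ω → MechIdx c) (W : Label → ℝ≥0 → Ω → ℝ)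
    (hnoise : IsTreeNoise P ρ τ I W)
    (hint : ∀ c : Code n, ∀ t ∈ Icc 0 T, ∀ x : ℝ,
      Integrable (randomFunctional T f u ρ τ I W t x c) P) :
    IsSystemSolution T f u (fun c t x => ∫ ω, randomFunctional T f u ρ τ I W t x c ω ∂P) ∧
    ∀ 𝒰 : Set (Code n → ℝ → ℝ → ℝ),
      (fun c t x => ∫ ω, randomFunctional T f u ρ τ I W t x c ω ∂P) ∈ 𝒰 →
      (fun c => c.eval f u) ∈ 𝒰 →
      (∀ v ∈ 𝒰, ∀ w ∈ 𝒰, IsSystemSolution T f u v → IsSystemSolution T f u w →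
        ∀ c, ∀ t ∈ Icc 0 T, ∀ x, v c t x = w c t x) →
      (∀ c : Code n, ∀ t ∈ Icc 0 T, ∀ x,
        c.eval f u t x = ∫ ω, randomFunctional T f u ρ τ I W t x c ω ∂P) ∧
      (∀ t ∈ Icc 0 T, ∀ x,
        u t x = ∫ ω, randomFunctional T f u ρ τ I W t x Code.id ω ∂P) := by
  have hev (c : Code n) : Measurable (c.eval f u T) :=
    (contDiff_eval hA.smooth_f hA.solution.regular c ⟨hT.le, le_rfl⟩).continuous.measurable
  have hsol := hnoise.isSystemSolution hρ_meas hρ_pos hev hint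
  refine ⟨hsol, fun 𝒰 h1 h2 huniq => ?_⟩
  have h := huniq _ h2 _ h1 (hA.isSystemSolution_eval hsol.integrable_terminal) hsol
  exact ⟨h, fun t ht x => h Code.id t ht x⟩
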